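/- Model. Let $g\in C^2([0,1])$ and let $(\varepsilon_j)_{j\ge 1}$ be independent copies of a centered second order process $\varepsilon=(\varepsilon(t))_{t\in[0,1]}$ with autocovariance function $R(t,s)=\mathrm{Cov}(\varepsilon(t),\varepsilon(s))$. One observes $Y_j(t)=g(t)+\varepsilon_j(t)$ for $j=1,\dots,m$ at the points of the design $T_n=\{t_{i,n}=F^{-1}(i/n): i=1,\dots,n\}$, where $F(t)=\int_0^t f$ and $f$ is a probability density on $[0,1]$ with $\inf_{[0,1]}f>0$ and $\sup_{[0,1]}f<\infty$. Put $\overline Y(t)=\frac1m\sum_{j=1}^m Y_j(t)$ and $\varphi_{x,h}(t)=\frac1hK\big(\frac{x-t}{h}\big)$ for a kernel $K$ and a bandwidth $h=h(n,m)>0$. The trapezoidal estimator of $g(x)$ is $$\hat g_n^{\mathrm{trap}}(x)=\frac1{2n}\sum_{k=1}^{N-1}\Big\{\Big(\frac{\varphi_{x,h}}{f}\overline Y\Big)(t_{x,k})+\Big(\frac{\varphi_{x,h}}{f}\overline Y\Big)(t_{x,k+1})\Big\},$$ where $t_{x,1}<\dots<t_{x,N}$ are the points of $T_n$ in $[x-h,x+h]$.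 Assumptions. Write $R^{(i,j)}(t,s)=\partial^{i+j}R/\partial t^i\partial s^j$. (A) $R$ is continuous on $[0,1]^2$. (B) For $t\in(0,1)$ the limits $R^{(0,1)}(t,t^-)=\lim_{s\uparrow t}R^{(0,1)}(t,s)$ and $R^{(0,1)}(t,t^+)=\lim_{s\downarrow t}R^{(0,1)}(t,s)$ exist and are continuous in $t$; the jump function $\alpha(t)=R^{(0,1)}(t,t^-)-R^{(0,1)}(t,t^+)$ is continuous and not identically zero. (C) On $\{(t,s)\in[0,1]^2:t\ne s\}$, $R$ has continuous partial derivatives up to order two, and $\sup_{0\le t\ne s\le1}|R^{(i,j)}(t,s)|<\infty$ whenever $0\le i+j\le2$. (D) $K:\mathbb R\to\mathbb R$ is even, vanishes outside $[-1,1]$, satisfies $\int_{-1}^1K=1$ and is continuously differentiable on $\mathbb R$ (so $K(\pm1)=K'(\pm1)=0$); on $[-1,1]$ it is of class $C^2$ with $K''$ Lipschitz. Proposition. Suppose that (A), (B), (C) and (D) hold, that $f\in C^2([0,1])$ with $f''$ Lipschitz on $[0,1]$, and that for each $t\in[0,1]$ the function $R^{(0,2)}(t,\cdot)$ is Lipschitz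 on $[0,t)$ and on $(t,1]$. Let $n\to\infty$, where $m\ge1$ may be fixed or may vary with $n$ in any way, and suppose that $h\to0$ and $nh\to\infty$ in this limit. Then for every $x\in(0,1)$, $$\mathrm{Var}\big(\hat g_n^{\mathrm{trap}}(x)\big)=\frac1m\Big(R(x,x)-\frac h2C_K\,\alpha(x)\Big)+\frac{V}{12\,m\,n^2h}\,\frac{\alpha(x)}{f^2(x)}+o\Big(\frac hm\Big)+O\Big(\frac1{mn^2}+\frac1{mn^3h^3}\Big),$$ where $V=\int_{-1}^1K^2(t)\,dt$ and $C_K=\int_{-1}^1\int_{-1}^1|u-v|K(u)K(v)\,du\,dv$. -/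

import Mathlib

open MeasureTheory ProbabilityTheory Filter Asymptotics Set
open scoped Topology

noncomputable section

namespace TrapReg

/-! ### Sampling design -/

/-- `f` is a probability density on `[0,1]` that is bounded away from `0` and from `∞`. -/
structure IsDesignDensity (f : ℝ → ℝ) : Prop where
  bddBelow : ∃ c : ℝ, 0 < c ∧ ∀ t ∈ Icc (0 : ℝ) 1, c ≤ f t
  bddAbove : ∃ C : ℝ, ∀ t ∈ Icc (0 : ℝ) 1, f t ≤ C
  integral_eq_one : ∫ t in (0 : ℝ)..1, f t = 1

/-- The distribution function `F(t) = ∫₀ᵗ f` (used for `t ∈ [0,1]`). -/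
def designCDF (f : ℝ → ℝ) (t : ℝ) : ℝ := ∫ u in (0 : ℝ)..t, f u

/-- The quantile function `F⁻¹(p) = inf {t ∈ [0,1] : p ≤ F(t)}`. -/
def designQuantile (f : ℝ → ℝ) (p : ℝ) : ℝ :=
  sInf {t : ℝ | t ∈ Icc (0 : ℝ) 1 ∧ p ≤ designCDF f t}

/-- The design point `t_{i,n} = F⁻¹(i/n)`. -/
def designPoint (f : ℝ → ℝ) (n i : ℕ) : ℝ := designQuantile f ((i : ℝ) / (n : ℝ))

/-- The design `T_n = {t_{1,n}, …, t_{n,n}}`. -/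
def design (f : ℝ → ℝ) (n : ℕ) : Finset ℝ := (Finset.Icc 1 n).image (designPoint f n)

open Classical in
/-- The design points lying in the window `[x - h, x + h]`. -/
def windowPoints (f : ℝ → ℝ) (n : ℕ) (x h : ℝ) : Finset ℝ :=
  (design f n).filter (fun t => t ∈ Icc (x - h) (x + h))

/-- The `k`-th point (counted from `k = 0`) of the window in increasing order,
for `k` smaller than the number of points in the window. -/
def windowPoint (f : ℝ → ℝ) (n : ℕ) (x h : ℝ) (k : ℕ) : ℝ :=
  ((windowPoints f n x h).sort (· ≤ ·)).getD k 0

/-! ### Observations and estimator -/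

/-- `φ_{x,h}(t) = h⁻¹ K((x - t)/h)`. -/
def scaledKernel (K : ℝ → ℝ) (x h t : ℝ) : ℝ := 1 / h * K ((x - t) / h)

variable {Ω : Type*}

/-- The observation `Y_j(t) = g(t) + ε_j(t)`. -/
def observation (g : ℝ → ℝ) (ε : ℕ → ℝ → Ω → ℝ) (j : ℕ) (t : ℝ) (ω : Ω) : ℝ :=
  g t + ε j t ω

/-- The mean `(1/m) ∑_j Y_j(t)` over `m` experimental units. -/
def meanObservation (g : ℝ → ℝ) (ε : ℕ → ℝ → Ω → ℝ) (m : ℕ) (t : ℝ) (ω : Ω) : ℝ :=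
  1 / (m : ℝ) * ∑ j ∈ Finset.range m, observation g ε j t ω

/-- The trapezoidal estimator of `g(x)` from the `m` units, with bandwidth `h`. -/
def trapEstimator (K f g : ℝ → ℝ) (ε : ℕ → ℝ → Ω → ℝ) (n m : ℕ) (h x : ℝ) (ω : Ω) : ℝ :=
  1 / (2 * (n : ℝ)) * ∑ k ∈ Finset.range ((windowPoints f n x h).card - 1),
    (scaledKernel K x h (windowPoint f n x h k) / f (windowPoint f n x h k)
        * meanObservation g ε m (windowPoint f n x h k) ω
      + scaledKernel K x h (windowPoint f n x h (k + 1)) / f (windowPoint f n x h (k + 1))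
        * meanObservation g ε m (windowPoint f n x h (k + 1)) ω)

/-- `(ε_j)_j` is a sequence of independent, identically distributed, centered second order
processes on `[0,1]` with autocovariance function `R`. Independence and equality of laws are those
of the whole paths `t ↦ ε_j(t)`, `t ∈ [0,1]`. -/
structure IsErrorSequence [MeasurableSpace Ω] (μ : Measure Ω) (ε : ℕ → ℝ → Ω → ℝ)
    (R : ℝ → ℝ → ℝ) : Prop where
  measurable : ∀ j, ∀ t ∈ Icc (0 : ℝ) 1, Measurable (ε j t)
  memLp : ∀ j, ∀ t ∈ Icc (0 : ℝ) 1, MemLp (ε j t) 2 μ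
  centered : ∀ j, ∀ t ∈ Icc (0 : ℝ) 1, ∫ ω, ε j t ω ∂μ = 0
  autocov : ∀ j, ∀ t ∈ Icc (0 : ℝ) 1, ∀ s ∈ Icc (0 : ℝ) 1, cov[ε j t, ε j s; μ] = R t s
  indep : iIndepFun (fun (j : ℕ) (ω : Ω) (t : Icc (0 : ℝ) 1) => ε j t ω) μ
  identDistrib : ∀ j, IdentDistrib (fun (ω : Ω) (t : Icc (0 : ℝ) 1) => ε j t ω)
    (fun (ω : Ω) (t : Icc (0 : ℝ) 1) => ε 0 t ω) μ μ

/-! ### Assumptions on the autocovariance function and on the kernel -/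

/-- The partial derivative in the first variable (one-sided on the boundary of `[0,1]`). -/
def partialFst (R : ℝ → ℝ → ℝ) (t s : ℝ) : ℝ :=
  derivWithin (fun t' => R t' s) (Icc (0 : ℝ) 1) t

/-- The partial derivative in the second variable (one-sided on the boundary of `[0,1]`). -/
def partialSnd (R : ℝ → ℝ → ℝ) (t s : ℝ) : ℝ :=
  derivWithin (fun s' => R t s') (Icc (0 : ℝ) 1) s

/-- The mixed partial derivative `R^{(i,j)} = ∂^{i+j} R / ∂tⁱ ∂sʲ`. -/
def mixedPartial (R : ℝ → ℝ → ℝ) (i j : ℕ) : ℝ → ℝ → ℝ :=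
  partialFst^[i] (partialSnd^[j] R)

/-- The unit square without its diagonal. -/
def offDiagonal : Set (ℝ × ℝ) :=
  {p | p.1 ∈ Icc (0 : ℝ) 1 ∧ p.2 ∈ Icc (0 : ℝ) 1 ∧ p.1 ≠ p.2}

/-- (A): `R` is continuous on the unit square. -/
def AssumptionA (R : ℝ → ℝ → ℝ) : Prop :=
  ContinuousOn (fun p : ℝ × ℝ => R p.1 p.2) (Icc (0 : ℝ) 1 ×ˢ Icc (0 : ℝ) 1)

/-- (B): on the diagonal, `R` has left and right first order derivatives
`R^{(0,1)}(t,t⁻) = lim_{s ↑ t} ∂R/∂s(t,s)` and `R^{(0,1)}(t,t⁺) = lim_{s ↓ t} ∂R/∂s(t,s)`, which are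
continuous in `t`, and the jump function `α(t) = R^{(0,1)}(t,t⁻) - R^{(0,1)}(t,t⁺)` is continuous
and not identically zero. Both limits make sense for `t ∈ (0,1)`. -/
structure AssumptionB (R : ℝ → ℝ → ℝ) (α : ℝ → ℝ) : Prop where
  exists_limits : ∃ Rleft Rright : ℝ → ℝ,
    ContinuousOn Rleft (Ioo (0 : ℝ) 1) ∧ ContinuousOn Rright (Ioo (0 : ℝ) 1) ∧
    ∀ t ∈ Ioo (0 : ℝ) 1,
      Tendsto (fun s => mixedPartial R 0 1 t s) (𝓝[<] t) (𝓝 (Rleft t)) ∧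
      Tendsto (fun s => mixedPartial R 0 1 t s) (𝓝[>] t) (𝓝 (Rright t)) ∧
      α t = Rleft t - Rright t
  continuousOn : ContinuousOn α (Ioo (0 : ℝ) 1)
  not_identically_zero : ∃ t ∈ Ioo (0 : ℝ) 1, α t ≠ 0

/-- (C): off the diagonal, `R` has continuous partial derivatives up to order two, and these are
bounded. -/
structure AssumptionC (R : ℝ → ℝ → ℝ) : Prop where
  contDiffOn : ContDiffOn ℝ 2 (fun p : ℝ × ℝ => R p.1 p.2) offDiagonal
  bounded : ∀ i j : ℕ, i + j ≤ 2 →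
    ∃ A : ℝ, ∀ p ∈ offDiagonal, |mixedPartial R i j p.1 p.2| ≤ A

/-- (D): `K` is an even kernel (of integral one) supported in `[-1,1]`, twice continuously
differentiable on `[-1,1]` with `K''` Lipschitz there. That `K` is continuously differentiable on
the whole line means that `K` and `K'` vanish at `±1`. -/
structure AssumptionD (K : ℝ → ℝ) : Prop where
  even : ∀ u, K (-u) = K u
  support : ∀ u, u ∉ Icc (-1 : ℝ) 1 → K u = 0
  integral_eq_one : ∫ u in (-1 : ℝ)..1, K u = 1
  contDiff_one : ContDiff ℝ 1 K
  contDiffOn_two : ContDiffOn ℝ 2 K (Icc (-1 : ℝ) 1)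
  lipschitz : ∃ L, LipschitzOnWith L (iteratedDerivWithin 2 K (Icc (-1 : ℝ) 1)) (Icc (-1 : ℝ) 1)

/-- For each `t ∈ [0,1]`, `R^{(0,2)}(t,·)` is Lipschitz on each side of the diagonal. -/
def SecondPartialLipschitz (R : ℝ → ℝ → ℝ) : Prop :=
  ∀ t ∈ Icc (0 : ℝ) 1, ∃ L, LipschitzOnWith L (mixedPartial R 0 2 t) (Ico 0 t) ∧
    LipschitzOnWith L (mixedPartial R 0 2 t) (Ioc t 1)

/-- `V = ∫ K²`. -/
def kernelV (K : ℝ → ℝ) : ℝ := ∫ u in (-1 : ℝ)..1, K u ^ 2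

/-- `C_K = ∫∫ |u - v| K(u) K(v) du dv`. -/
def kernelC (K : ℝ → ℝ) : ℝ :=
  ∫ v in (-1 : ℝ)..1, ∫ u in (-1 : ℝ)..1, |u - v| * K u * K v

end TrapReg

end

/-! The estimator is linear in the averaged data, so its variance is `1/m` times the quadratic form
`∑∑ q(t) q(s) R(t,s)` in the trapezoidal weights `q` (`trapEstimator_eq_sum`,
`IsErrorSequence.variance_sum_mul_meanObservation`). On the window, `R(t,s) = R(x,x) + d(t-x) +
d(s-x) - (α(x)/2)|t-s| + O(h²)` (`exists_covariance_expansion`). Up to `O(h²)` the form therefore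
depends only on the mass of the weights, their first moment about `x` and their mean distance
(`abs_sum_sum_mul_sub_le`).

Let `a = 1/(n h f(x))`, the mesh of the design at `x` in units of the bandwidth. The mass is `1 +
O(ah + a³)`, the first moment is `O(h(a+h))` and the mean distance is `h C_K + O(h(a+h))`
(`exists_trapWeight_moments`).

These come from a comparison with an equispaced design. Since `F(t_i) = i/n`, the variable `z =
(F(t)-F(x))/(h f(x))` runs through a grid of mesh `a`. On that grid the weights `a K(z)` have mass
`1 + O(a³)`, by Euler-Maclaurin with `K = K' = 0` at `±1` (`KernelBounds.abs_sum_sub_one_le`), and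
their other moments are Riemann sums with error `O(a)`. The true weights differ from these by `O(h)`
in total variation. This suffices for the first moment and the mean distance, which carry a further
factor `h`. The mass multiplies `R(x,x)`, which is of order one, and needs the signed estimate
`O(1/n) = O(ah)` of `exists_sum_weightDiff_bound`. Halving the weights at the ends of the window
costs `O(a³)`, because `K` vanishes quadratically there.

Hence the form is `R(x,x) - (h/2) C_K α(x) + O(h(a+h) + a³)`. As `a → 0` and `h → 0`, the first part
of the error is `o(h)`, and `a³` is of order `1/(nh)³`. The term with `V` equals `(1/m)(V α(x)/12)
a² h`, which is itself `o(h/m)`; it is absorbed into the little-o remainder, and its coefficient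
plays no further role. -/

noncomputable section

namespace TrapReg

/-! ### Regularity of the kernel and quadrature errors on one cell. -/

/-- Quantitative regularity of a kernel supported in `[-1,1]`, with `K₂` its second derivative on
`[-1,1]`. -/
structure KernelBounds (K K₂ : ℝ → ℝ) (L : ℝ) : Prop where
  one_le : 1 ≤ L
  diff : ∀ u, HasDerivAt K (deriv K u) u
  zero : ∀ u, 1 ≤ |u| → K u = 0
  deriv_zero : ∀ u, 1 ≤ |u| → deriv K u = 0
  bound : ∀ u, |K u| ≤ L
  lip : ∀ u v, |K u - K v| ≤ L * |u - v|
  deriv_bound : ∀ u, |deriv K u| ≤ L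
  deriv_lip : ∀ u v, |deriv K u - deriv K v| ≤ L * |u - v|
  diff_two : ∀ u ∈ Icc (-1 : ℝ) 1, HasDerivWithinAt (deriv K) (K₂ u) (Icc (-1) 1) u
  two_lip : ∀ u ∈ Icc (-1 : ℝ) 1, ∀ v ∈ Icc (-1 : ℝ) 1, |K₂ u - K₂ v| ≤ L * |u - v|

/-- Mean value inequality for real functions on a convex set. -/
theorem abs_sub_le_of_deriv_bound {s : Set ℝ} (hs : Convex ℝ s) {φ φ' : ℝ → ℝ} {C : ℝ}
    (hd : ∀ u ∈ s, HasDerivWithinAt φ (φ' u) s u) (hb : ∀ u ∈ s, |φ' u| ≤ C) {u v : ℝ}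
    (hu : u ∈ s) (hv : v ∈ s) : |φ u - φ v| ≤ C * |u - v| := by
  have := hs.norm_image_sub_le_of_norm_hasDerivWithin_le hd hb hv hu
  simpa [Real.norm_eq_abs] using this

/-- Being `C¹` on the line forces `K` and `K'` to vanish at `±1`. This makes `deriv K` globally
Lipschitz even though the second derivative may jump at `±1`; only the bounds on `K₂` have to stay
inside `[-1,1]`. -/
theorem AssumptionD.exists_bounds {K : ℝ → ℝ} (hD : AssumptionD K) :
    ∃ K₂ L, KernelBounds K K₂ L := by
  have hne : (-1 : ℝ) < 1 := by norm_num
  have hU := uniqueDiffOn_Icc hne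
  have hdiff : ∀ u, HasDerivAt K (deriv K u) u := fun u =>
    (hD.contDiff_one.differentiable (by norm_num) u).hasDerivAt
  have hcd : Continuous (deriv K) := hD.contDiff_one.continuous_deriv (by norm_num)
  -- A point with `|u| = 1` is a limit of points `u (1 + e/2)` outside the support, so vanishing
  -- extends to `±1` by continuity.
  have hclos : ∀ φ : ℝ → ℝ, Continuous φ → (∀ u, 1 < |u| → φ u = 0) → ∀ u, 1 ≤ |u| → φ u = 0 := by
    intro φ hφ h0 u hu
    have h1 : closure {v : ℝ | 1 < |v|} ⊆ {v | φ v = 0} :=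
      closure_minimal (fun v hv => h0 v hv) (isClosed_eq hφ continuous_const)
    apply h1
    rcases eq_or_lt_of_le hu with h | h
    · rw [Metric.mem_closure_iff]
      intro e he
      refine ⟨u * (1 + e / 2), ?_, ?_⟩
      · simp only [mem_ofPred_eq, abs_mul, ← h, one_mul]
        rw [abs_of_pos (by positivity)]; linarith
      · rw [Real.dist_eq, show u - u * (1 + e / 2) = u * (-(e / 2)) by ring, abs_mul, ← h, abs_neg,
          abs_of_pos (by positivity)]; linarith
    · exact subset_closure h
  have hout : ∀ u, 1 < |u| → K u = 0 := fun u hu => hD.support u (fun h => by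
    exact absurd (abs_le.2 h) hu.not_ge)
  have hzero := hclos K hD.contDiff_one.continuous hout
  have hdzero : ∀ u, 1 ≤ |u| → deriv K u = 0 := by
    apply hclos _ hcd
    intro u hu
    have : K =ᶠ[𝓝 u] fun _ => 0 := by
      filter_upwards [(isOpen_lt continuous_const continuous_abs).mem_nhds hu] with v hv
      exact hout v hv
    rw [this.deriv_eq]; simp
  have hdw : EqOn (derivWithin K (Icc (-1) 1)) (deriv K) (Icc (-1) 1) := fun u hu =>
    (hdiff u).hasDerivWithinAt.derivWithin (hU u hu)
  have hC1 : ContDiffOn ℝ 1 (deriv K) (Icc (-1) 1) :=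
    (hD.contDiffOn_two.derivWithin hU (by norm_num)).congr (fun u hu => (hdw hu).symm)
  set K₂ := derivWithin (deriv K) (Icc (-1) 1) with hK₂
  have hK₂c : ContinuousOn K₂ (Icc (-1) 1) := hC1.continuousOn_derivWithin hU (by norm_num)
  have hd2 : ∀ u ∈ Icc (-1 : ℝ) 1, HasDerivWithinAt (deriv K) (K₂ u) (Icc (-1) 1) u := fun u hu =>
    ((hC1.differentiableOn (by norm_num)) u hu).hasDerivWithinAt
  have hit : EqOn (iteratedDerivWithin 2 K (Icc (-1) 1)) K₂ (Icc (-1) 1) := by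
    intro u hu
    rw [iteratedDerivWithin_succ]
    apply derivWithin_congr
    · intro v hv
      rw [iteratedDerivWithin_one]; exact hdw hv
    · rw [iteratedDerivWithin_one]; exact hdw hu
  obtain ⟨L₀, hL₀⟩ := hD.lipschitz
  obtain ⟨A, hA⟩ := isCompact_Icc.exists_bound_of_continuousOn hK₂c
  obtain ⟨A1, hA1⟩ := isCompact_Icc.exists_bound_of_continuousOn
    (hcd.continuousOn (s := Icc (-1 : ℝ) 1))
  obtain ⟨A0, hA0⟩ := isCompact_Icc.exists_bound_of_continuousOn
    (hD.contDiff_one.continuous.continuousOn (s := Icc (-1 : ℝ) 1))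
  set L := max 1 (max (L₀ : ℝ) (max A (max A1 A0)))
  have l1 : 1 ≤ L := le_max_left _ _
  have l2 : (L₀ : ℝ) ≤ L := (le_max_left _ _).trans (le_max_right _ _)
  have l3 : A ≤ L := ((le_max_left _ _).trans (le_max_right _ _)).trans (le_max_right _ _)
  have l4 : A1 ≤ L := (((le_max_left _ _).trans (le_max_right _ _)).trans (le_max_right _ _)).trans
    (le_max_right _ _)
  have l5 : A0 ≤ L := (((le_max_right _ _).trans (le_max_right _ _)).trans (le_max_right _ _)).trans
    (le_max_right _ _)
  have hin : ∀ u : ℝ, |u| < 1 → u ∈ Icc (-1 : ℝ) 1 := fun u hu => abs_le.1 hu.le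
  have hbd : ∀ u, |deriv K u| ≤ L := by
    intro u
    rcases lt_or_ge |u| 1 with h | h
    · exact (hA1 u (hin u h)).trans l4
    · rw [hdzero u h]; simp; linarith
  -- `deriv K` factors through the projection onto `[-1,1]`, which is 1-Lipschitz; the bound on `K₂`
  -- in `[-1,1]` thus gives a Lipschitz bound on the line.
  have hproj : ∀ u, deriv K u = deriv K (max (-1) (min u 1)) := by
    intro u
    rcases le_or_gt u (-1) with h | h
    · rw [min_eq_left (by linarith), max_eq_left h, hdzero u (by rw [le_abs]; right; linarith),
        hdzero (-1) (by simp)]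
    · rcases le_or_gt u 1 with h' | h'
      · rw [min_eq_left h', max_eq_right h.le]
      · rw [min_eq_right h'.le, max_eq_right (by norm_num),
          hdzero u (by rw [le_abs]; left; linarith), hdzero 1 (by simp)]
  refine ⟨K₂, L, l1, hdiff, hzero, hdzero, ?_, ?_, hbd, ?_, hd2, ?_⟩
  · intro u
    rcases lt_or_ge |u| 1 with h | h
    · exact (hA0 u (hin u h)).trans l5
    · rw [hzero u h]; simp; linarith
  · intro u v
    exact abs_sub_le_of_deriv_bound convex_univ (fun w _ => (hdiff w).hasDerivWithinAt)
      (fun w _ => hbd w) (mem_univ _) (mem_univ _)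
  · intro u v
    rw [hproj u, hproj v]
    have hm : ∀ w : ℝ, max (-1) (min w 1) ∈ Icc (-1 : ℝ) 1 := fun w =>
      ⟨le_max_left _ _, max_le (by norm_num) (min_le_right _ _)⟩
    refine (abs_sub_le_of_deriv_bound (convex_Icc (-1 : ℝ) 1) hd2
      (fun w hw => (hA w hw).trans l3) (hm u) (hm v)).trans ?_
    apply mul_le_mul_of_nonneg_left _ (by linarith)
    calc _ ≤ |min u 1 - min v 1| := by
          simpa using abs_max_sub_max_le_max (-1 : ℝ) (min u 1) (-1) (min v 1)
      _ ≤ _ := by simpa using abs_min_sub_min_le_max u 1 v 1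
  · intro u hu v hv
    have := hL₀.dist_le_mul u hu v hv
    rw [hit hu, hit hv, Real.dist_eq, Real.dist_eq] at this
    exact this.trans (mul_le_mul_of_nonneg_right l2 (abs_nonneg _))

/-- The primitive of `K` that vanishes at `-1`. -/
def kernelCDF (K : ℝ → ℝ) (u : ℝ) : ℝ := ∫ v in (-1 : ℝ)..u, K v

namespace KernelBounds

variable {K K₂ : ℝ → ℝ} {L : ℝ}

theorem continuous (hK : KernelBounds K K₂ L) : Continuous K :=
  continuous_iff_continuousAt.2 fun u => (hK.diff u).continuousAt

theorem hasDerivAt_cdf (hK : KernelBounds K K₂ L) (u : ℝ) :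
    HasDerivAt (kernelCDF K) (K u) u :=
  (hK.continuous.integral_hasStrictDerivAt (-1) u).hasDerivAt

theorem cdf_of_le (hK : KernelBounds K K₂ L) {u : ℝ} (hu : u ≤ -1) : kernelCDF K u = 0 := by
  unfold kernelCDF
  rw [intervalIntegral.integral_symm, intervalIntegral.integral_congr (g := fun _ => 0)]
  · simp
  · intro v hv
    rw [uIcc_of_le hu] at hv
    exact hK.zero v (by rw [le_abs]; right; linarith [hv.2])

theorem cdf_of_ge (hK : KernelBounds K K₂ L) (h1 : ∫ u in (-1 : ℝ)..1, K u = 1) {u : ℝ}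
    (hu : 1 ≤ u) : kernelCDF K u = 1 := by
  unfold kernelCDF
  rw [← intervalIntegral.integral_add_adjacent_intervals (b := 1)
    (hK.continuous.intervalIntegrable _ _) (hK.continuous.intervalIntegrable _ _), h1,
    intervalIntegral.integral_congr (a := 1) (g := fun _ => 0)]
  · simp
  · intro v hv
    rw [uIcc_of_le hu] at hv
    exact hK.zero v (by rw [le_abs]; left; linarith [hv.1])

/-- Near the ends of its support the kernel is quadratically small. -/
theorem bound_sq (hK : KernelBounds K K₂ L) (u : ℝ) :
    |K u| ≤ L * (1 - |u|) ^ 2 := by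
  -- Both `K` and `K'` vanish at `e = ±1`, so `|K'|` is at most `L |u - e|` on the segment from `e`
  -- to `u`.
  have key : ∀ e : ℝ, |e| = 1 → |K u| ≤ L * |u - e| ^ 2 := by
    intro e he
    have := abs_sub_le_of_deriv_bound (convex_uIcc e u) (φ := K) (φ' := deriv K) (C := L * |u - e|)
      (fun w _ => (hK.diff w).hasDerivWithinAt) (fun w hw => by
        have := hK.deriv_lip w e
        rw [hK.deriv_zero e he.ge, sub_zero] at this
        refine this.trans (mul_le_mul_of_nonneg_left ?_ (by linarith [hK.one_le]))
        exact abs_sub_left_of_mem_uIcc hw) right_mem_uIcc left_mem_uIcc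
    rw [hK.zero e he.ge, sub_zero] at this
    linarith [this]
  rcases le_total 0 u with h | h
  · have := key 1 (by simp)
    rw [abs_of_nonneg h]
    rwa [sq_abs, show (u - 1) ^ 2 = (1 - u) ^ 2 by ring] at this
  · have := key (-1) (by simp)
    rw [abs_of_nonpos h]
    rwa [sq_abs, show (u - -1) ^ 2 = (1 - -u) ^ 2 by ring] at this

/-- Error of the trapezoidal rule on one cell for a Lipschitz derivative. -/
theorem trapezoid_cell (hK : KernelBounds K K₂ L) {a : ℝ} (ha : 0 ≤ a) (u : ℝ) :
    |a / 2 * (K u + K (u + a)) - (kernelCDF K (u + a) - kernelCDF K u)| ≤ L * a ^ 3 := by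
  have hL := hK.one_le
  -- The error is viewed as a function of the cell length `s`. It vanishes at `s = 0`, and its
  -- derivative is half a first order Taylor remainder of `K` at `u + s`, hence `O(s²)`.
  have hd : ∀ s ∈ Icc 0 a, HasDerivWithinAt
      (fun s => s / 2 * (K u + K (u + s)) - (kernelCDF K (u + s) - kernelCDF K u))
      ((1 / 2) * (K u + K (u + s)) + s / 2 * deriv K (u + s) - K (u + s)) (Icc 0 a) s := by
    intro s _
    have hs : HasDerivAt (fun s => u + s) 1 s := (hasDerivAt_id s).const_add u
    have h1 := (hK.diff (u + s)).comp s hs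
    have h2 := (hK.hasDerivAt_cdf (u + s)).comp s hs
    have h3 := (((hasDerivAt_id s).div_const 2).mul (h1.const_add (K u))).sub
      (h2.sub_const (kernelCDF K u))
    exact (h3.congr_deriv (by simp)).hasDerivWithinAt
  have hb : ∀ s ∈ Icc 0 a, |(1 / 2) * (K u + K (u + s)) + s / 2 * deriv K (u + s) - K (u + s)| ≤
      L * a ^ 2 := by
    intro s hs
    have h1 := abs_sub_le_of_deriv_bound (convex_Icc u (u + s)) (φ := fun v => K v -
      v * deriv K (u + s)) (φ' := fun v => deriv K v - deriv K (u + s)) (C := L * s)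
      (fun w _ => (((hK.diff w).sub ((hasDerivAt_id w).mul_const _)).congr_deriv
        (by simp)).hasDerivWithinAt)
      (fun w hw => (hK.deriv_lip w (u + s)).trans (mul_le_mul_of_nonneg_left
        (by rw [abs_le]; constructor <;> linarith [hw.1, hw.2, hs.1]) (by linarith)))
      (u := u) (v := u + s) ⟨le_rfl, by linarith [hs.1]⟩ ⟨by linarith [hs.1], le_rfl⟩
    have h2 : |u - (u + s)| = s := by
      rw [show u - (u + s) = -s by ring, abs_neg, abs_of_nonneg hs.1]
    rw [h2] at h1
    rw [show (1 / 2) * (K u + K (u + s)) + s / 2 * deriv K (u + s) - K (u + s) =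
      (1 / 2) * (K u - u * deriv K (u + s) - (K (u + s) - (u + s) * deriv K (u + s))) by ring,
      abs_mul, abs_of_pos (by norm_num : (0 : ℝ) < 1 / 2)]
    have h3 : s * s ≤ a ^ 2 := by nlinarith [hs.1, hs.2]
    nlinarith [mul_le_mul_of_nonneg_left h3 (by linarith : (0 : ℝ) ≤ L), sq_nonneg a]
  have := abs_sub_le_of_deriv_bound (convex_Icc 0 a) hd hb (u := a) (v := 0) ⟨ha, le_rfl⟩
    ⟨le_rfl, ha⟩
  simp only [add_zero, sub_self, zero_div, zero_mul, sub_zero, abs_of_nonneg ha] at this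
  linarith [this]

/-- Corrected trapezoidal rule on one cell inside the support of the kernel. -/
theorem corrected_trapezoid_cell (hK : KernelBounds K K₂ L) {a u : ℝ} (ha : 0 ≤ a) (hu : -1 ≤ u)
    (hua : u + a ≤ 1) :
    |a / 2 * (K u + K (u + a)) - (kernelCDF K (u + a) - kernelCDF K u)
      - a ^ 2 / 12 * (deriv K (u + a) - deriv K u)| ≤ L * a ^ 4 := by
  have hL := hK.one_le
  have hmem : ∀ s ∈ Icc 0 a, u + s ∈ Icc (-1 : ℝ) 1 := fun s hs =>
    ⟨by linarith [hs.1], by linarith [hs.2]⟩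
  have hd : ∀ s ∈ Icc 0 a, HasDerivWithinAt
      (fun s => s / 2 * (K u + K (u + s)) - (kernelCDF K (u + s) - kernelCDF K u)
        - s ^ 2 / 12 * (deriv K (u + s) - deriv K u))
      ((1 / 2) * (K u + K (u + s)) + s / 2 * deriv K (u + s) - K (u + s)
        - (s / 6 * (deriv K (u + s) - deriv K u) + s ^ 2 / 12 * K₂ (u + s))) (Icc 0 a) s := by
    intro s hsa
    have hs : HasDerivAt (fun s => u + s) 1 s := (hasDerivAt_id s).const_add u
    have h1 := (hK.diff (u + s)).comp s hs
    have h2 := (hK.hasDerivAt_cdf (u + s)).comp s hs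
    have h3 := ((((hasDerivAt_id s).div_const 2).mul (h1.const_add (K u))).sub
      (h2.sub_const (kernelCDF K u))).hasDerivWithinAt (s := Icc 0 a)
    have h4 := (hK.diff_two (u + s) (hmem s hsa)).comp s (hs.hasDerivWithinAt (s := Icc 0 a)) hmem
    have h5 := h3.sub ((((hasDerivAt_id s).pow 2).div_const 12).hasDerivWithinAt.mul
      (h4.sub_const (deriv K u)))
    refine h5.congr_deriv ?_
    simp only [id_eq, Function.comp_apply, Pi.pow_apply, Nat.cast_ofNat, Nat.add_one_sub_one, pow_one]
    ring
  have hb : ∀ s ∈ Icc 0 a, |(1 / 2) * (K u + K (u + s)) + s / 2 * deriv K (u + s) - K (u + s)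
        - (s / 6 * (deriv K (u + s) - deriv K u) + s ^ 2 / 12 * K₂ (u + s))| ≤ L * a ^ 3 := by
    intro s hs
    set w := u + s with hw
    have hsub : Icc u w ⊆ Icc (-1) 1 := fun v hv => ⟨hu.trans hv.1, hv.2.trans (hmem s hs).2⟩
    have hwm : w ∈ Icc u w := ⟨by linarith [hs.1], le_rfl⟩
    have hum : u ∈ Icc u w := ⟨le_rfl, by linarith [hs.1]⟩
    have hdist : ∀ v ∈ Icc u w, |v - w| ≤ s := fun v hv => by
      rw [abs_le]; constructor <;> linarith [hv.1, hv.2, hs.1]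
    have h1 : ∀ v ∈ Icc u w, |deriv K v - deriv K w - (v - w) * K₂ w| ≤ L * s ^ 2 := by
      intro v hv
      have := abs_sub_le_of_deriv_bound (convex_Icc u w) (φ := fun v => deriv K v - v * K₂ w)
        (φ' := fun v => K₂ v - K₂ w) (C := L * s)
        (fun r hr => (((hK.diff_two r (hsub hr)).mono hsub).sub
          ((hasDerivAt_id r).mul_const (K₂ w)).hasDerivWithinAt).congr_deriv (by simp))
        (fun r hr => (hK.two_lip r (hsub hr) w (hsub hwm)).trans
          (mul_le_mul_of_nonneg_left (hdist r hr) (by linarith))) hv hwm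
      rw [show deriv K v - deriv K w - (v - w) * K₂ w = deriv K v - v * K₂ w -
        (deriv K w - w * K₂ w) by ring]
      refine this.trans ?_
      rw [pow_two, ← mul_assoc]
      exact mul_le_mul_of_nonneg_left (hdist v hv) (mul_nonneg (by linarith) hs.1)
    have h2 := abs_sub_le_of_deriv_bound (convex_Icc u w)
        (φ := fun v => K v - (v * deriv K w + (v - w) ^ 2 / 2 * K₂ w))
        (φ' := fun v => deriv K v - deriv K w - (v - w) * K₂ w) (C := L * s ^ 2)
        (fun r _ => ((hK.diff r).sub (((hasDerivAt_id r).mul_const (deriv K w)).add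
          (((((hasDerivAt_id r).sub_const w).pow 2).div_const 2).mul_const
            (K₂ w)))).congr_deriv (by simp; ring) |>.hasDerivWithinAt) h1 hum hwm
    have h3 : |u - w| = s := by
      rw [hw, show u - (u + s) = -s by ring, abs_neg, abs_of_nonneg hs.1]
    rw [h3] at h2
    have h4 := h1 u hum
    have e1 : u - w = -s := by rw [hw]; ring
    -- The derivative of the error in the cell length regroups into half the second order Taylor
    -- remainder of `K` at `w`, plus `s/6` times the first order remainder of `K'` at `w`. Both
    -- pieces are `O(s³)`.
    rw [show (1 / 2) * (K u + K w) + s / 2 * deriv K w - K w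
        - (s / 6 * (deriv K w - deriv K u) + s ^ 2 / 12 * K₂ w) =
        (1 / 2) * (K u - (u * deriv K w + (u - w) ^ 2 / 2 * K₂ w) -
          (K w - (w * deriv K w + (w - w) ^ 2 / 2 * K₂ w))) +
        s / 6 * (deriv K u - deriv K w - (u - w) * K₂ w) by
      have : u = w - s := by rw [hw]; ring
      rw [this]; ring]
    refine (abs_add_le _ _).trans ?_
    rw [abs_mul, abs_mul, abs_of_pos (by norm_num : (0 : ℝ) < 1 / 2),
      abs_of_nonneg (by linarith [hs.1] : 0 ≤ s / 6)]
    have h5 : s ^ 3 ≤ a ^ 3 := pow_le_pow_left₀ hs.1 hs.2 3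
    have h6 := mul_le_mul_of_nonneg_left h4 (by linarith [hs.1] : 0 ≤ s / 6)
    have h7 := mul_le_mul_of_nonneg_left h5 (by linarith : (0 : ℝ) ≤ L)
    have h8 : 0 ≤ L * a ^ 3 := by positivity
    nlinarith
  have := abs_sub_le_of_deriv_bound (convex_Icc 0 a) hd hb (u := a) (v := 0) ⟨ha, le_rfl⟩
    ⟨le_rfl, ha⟩
  simp only [add_zero, sub_self, zero_div, zero_mul, sub_zero, abs_of_nonneg ha, mul_zero,
    ne_eq, OfNat.ofNat_ne_zero, not_false_eq_true, zero_pow] at this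
  linarith [this]

end KernelBounds

/-! ### Sums of kernel functions over an equispaced grid. -/

/-- The number of points of a grid of mesh `a` in an interval of length `2r`. -/
theorem card_grid_le {a : ℝ} (ha : 0 < a) (c e r : ℝ) (hr : 0 ≤ r) (n : ℕ) :
    (((Finset.range n).filter fun i : ℕ => |a * ((i : ℝ) - c) - e| ≤ r).card : ℝ) ≤
      2 * r / a + 1 := by
  set S := (Finset.range n).filter fun i : ℕ => |a * ((i : ℝ) - c) - e| ≤ r
  set lo := c + (e - r) / a
  set hi := c + (e + r) / a
  have hsub : S.map Nat.castEmbedding ⊆ Finset.Icc (⌈lo⌉ : ℤ) ⌊hi⌋ := by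
    intro k hk
    rw [Finset.mem_map] at hk
    obtain ⟨i, hi', rfl⟩ := hk
    have h := (Finset.mem_filter.1 hi').2
    rw [abs_le] at h
    rw [Finset.mem_Icc, Int.ceil_le, Int.le_floor]
    simp only [Nat.castEmbedding_apply, Int.cast_natCast, lo, hi]
    constructor
    · rw [← le_sub_iff_add_le', div_le_iff₀ ha]; linarith
    · rw [← sub_le_iff_le_add', le_div_iff₀ ha]; linarith
  have hlen : hi - lo = 2 * r / a := by simp only [lo, hi]; ring
  have hcard := Finset.card_le_card hsub
  rw [Finset.card_map, Int.card_Icc] at hcard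
  have h0 : 0 ≤ 2 * r / a := by positivity
  refine (Nat.cast_le.2 hcard).trans ?_
  rcases le_total 0 (⌊hi⌋ + 1 - ⌈lo⌉) with h | h
  · have : (((⌊hi⌋ + 1 - ⌈lo⌉).toNat : ℤ) : ℝ) = ((⌊hi⌋ + 1 - ⌈lo⌉ : ℤ) : ℝ) := by
      rw [Int.toNat_of_nonneg h]
    rw [Int.cast_natCast] at this
    rw [this]
    push_cast
    linarith [Int.floor_le hi, Int.le_ceil lo]
  · rw [Int.toNat_of_nonpos h]; push_cast; linarith

/-- A sum over a grid of terms that are bounded by `β` and vanish off an interval. -/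
theorem sum_abs_grid_le {a : ℝ} (ha : 0 < a) (c e r : ℝ) (hr : 0 ≤ r) (n : ℕ) {b : ℕ → ℝ} {β : ℝ}
    (hb : ∀ i < n, |a * ((i : ℝ) - c) - e| ≤ r → |b i| ≤ β)
    (h0 : ∀ i < n, r < |a * ((i : ℝ) - c) - e| → b i = 0) (hβ : 0 ≤ β) :
    ∑ i ∈ Finset.range n, |b i| ≤ β * (2 * r / a + 1) := by
  calc ∑ i ∈ Finset.range n, |b i|
      ≤ ∑ i ∈ Finset.range n, if |a * ((i : ℝ) - c) - e| ≤ r then β else 0 := by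
        refine Finset.sum_le_sum fun i hi => ?_
        split_ifs with h
        · exact hb i (Finset.mem_range.1 hi) h
        · rw [h0 i (Finset.mem_range.1 hi) (not_le.1 h), abs_zero]
    _ = (((Finset.range n).filter fun i : ℕ => |a * ((i : ℝ) - c) - e| ≤ r).card : ℝ) * β := by
        rw [← Finset.sum_filter, Finset.sum_const, nsmul_eq_mul]
    _ ≤ _ := by
        rw [mul_comm]
        exact mul_le_mul_of_nonneg_left (card_grid_le ha c e r hr n) hβ

/-- The corrected cell errors telescope, and `K`, `K'` vanish at both ends of the grid, so the
deviation of the sum from one is exactly their sum. About `2/a` cells lie inside the support and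
contribute `O(a⁴)` each. The cells that straddle `±1`, where the second derivative may jump,
contribute only `O(a³)` each, but their number is bounded. -/
theorem KernelBounds.abs_sum_sub_one_le {K K₂ : ℝ → ℝ} {L : ℝ} (hK : KernelBounds K K₂ L)
    (h1 : ∫ u in (-1 : ℝ)..1, K u = 1) {a c : ℝ} {n : ℕ} (ha : 0 < a) (ha1 : a ≤ 1)
    (hc : 1 ≤ a * c) (hn : 1 ≤ a * ((n : ℝ) - c)) :
    |∑ i ∈ Finset.range n, a * K (a * ((i : ℝ) - c)) - 1| ≤ 15 * L * a ^ 3 := by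
  have hL := hK.one_le
  set z : ℕ → ℝ := fun i => a * ((i : ℝ) - c) with hz
  have hzs : ∀ i, z (i + 1) = z i + a := fun i => by simp only [hz]; push_cast; ring
  have hz0 : z 0 ≤ -1 := by simp only [hz]; push_cast; linarith
  set e : ℕ → ℝ := fun i => a / 2 * (K (z i) + K (z i + a)) -
    (kernelCDF K (z i + a) - kernelCDF K (z i)) - a ^ 2 / 12 * (deriv K (z i + a) - deriv K (z i))
  have hge : ∀ u : ℝ, 1 ≤ u → 1 ≤ |u| := fun u hu => hu.trans (le_abs_self u)
  have hle : ∀ u : ℝ, u ≤ -1 → 1 ≤ |u| := fun u hu => by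
    have := neg_le_abs u; linarith
  have hsum : ∑ i ∈ Finset.range n, a * K (z i) - 1 = ∑ i ∈ Finset.range n, e i := by
    have e1 : ∀ i, e i = a * K (z i) + (a / 2 * K (z (i + 1)) - a / 2 * K (z i)) -
        (kernelCDF K (z (i + 1)) - kernelCDF K (z i)) -
        (a ^ 2 / 12 * deriv K (z (i + 1)) - a ^ 2 / 12 * deriv K (z i)) := by
      intro i; rw [hzs]; simp only [e]; ring
    simp only [e1, Finset.sum_sub_distrib, Finset.sum_add_distrib]
    rw [← Finset.sum_sub_distrib, ← Finset.sum_sub_distrib, ← Finset.sum_sub_distrib,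
      Finset.sum_range_sub (fun i => a / 2 * K (z i)), Finset.sum_range_sub (fun i => kernelCDF K (z i)),
      Finset.sum_range_sub (fun i => a ^ 2 / 12 * deriv K (z i)), hK.cdf_of_le hz0,
      hK.cdf_of_ge h1 hn, hK.zero _ (hge _ hn), hK.zero _ (hle _ hz0), hK.deriv_zero _ (hge _ hn),
      hK.deriv_zero _ (hle _ hz0)]
    ring
  have hbad : ∀ i, |e i| ≤ 2 * L * a ^ 3 := by
    intro i
    refine (abs_sub _ _).trans ?_
    have t1 := hK.trapezoid_cell ha.le (z i)
    have t2 := hK.deriv_lip (z i + a) (z i)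
    rw [add_sub_cancel_left, abs_of_pos ha] at t2
    rw [abs_mul (a ^ 2 / 12), abs_of_nonneg (by positivity : 0 ≤ a ^ 2 / 12)]
    have t3 := mul_le_mul_of_nonneg_left t2 (by positivity : 0 ≤ a ^ 2 / 12)
    have t4 : 0 ≤ L * a ^ 3 := by positivity
    nlinarith
  -- One majorant for the cells inside the support and one for the cells straddling each end. By the
  -- grid count they add up to `3 + 6 + 6 = 15` times `L a³`.
  set b₁ : ℕ → ℝ := fun i => if |z i - 0| ≤ 1 then L * a ^ 4 else 0
  set b₂ : ℕ → ℝ := fun i => if |z i - (-1)| ≤ a then 2 * L * a ^ 3 else 0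
  set b₃ : ℕ → ℝ := fun i => if |z i - 1| ≤ a then 2 * L * a ^ 3 else 0
  have p1 : ∀ i, 0 ≤ b₁ i := fun i => by simp only [b₁]; split_ifs <;> positivity
  have p2 : ∀ i, 0 ≤ b₂ i := fun i => by simp only [b₂]; split_ifs <;> positivity
  have p3 : ∀ i, 0 ≤ b₃ i := fun i => by simp only [b₃]; split_ifs <;> positivity
  have hcell : ∀ i, |e i| ≤ |b₁ i| + |b₂ i| + |b₃ i| := by
    intro i
    rw [abs_of_nonneg (p1 i), abs_of_nonneg (p2 i), abs_of_nonneg (p3 i)]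
    have q1 := p1 i
    have q2 := p2 i
    have q3 := p3 i
    have hzero : 1 ≤ z i ∨ z i + a ≤ -1 → e i = 0 := by
      rintro (h | h)
      · simp only [e]
        rw [hK.zero _ (hge _ h), hK.zero _ (hge (z i + a) (by linarith)), hK.deriv_zero _ (hge _ h),
          hK.deriv_zero _ (hge (z i + a) (by linarith)), hK.cdf_of_ge h1 h,
          hK.cdf_of_ge h1 (by linarith : 1 ≤ z i + a)]
        ring
      · simp only [e]
        rw [hK.zero _ (hle _ h), hK.zero _ (hle (z i) (by linarith)), hK.deriv_zero _ (hle _ h),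
          hK.deriv_zero _ (hle (z i) (by linarith)), hK.cdf_of_le h,
          hK.cdf_of_le (by linarith : z i ≤ -1)]
        ring
    by_cases c1 : 1 ≤ z i ∨ z i + a ≤ -1
    · rw [hzero c1, abs_zero]; positivity
    push Not at c1
    by_cases c2 : z i < -1
    · have : b₂ i = 2 * L * a ^ 3 := if_pos (by rw [abs_le]; constructor <;> linarith)
      linarith [hbad i]
    push Not at c2
    by_cases c3 : z i + a ≤ 1
    · have : b₁ i = L * a ^ 4 := if_pos (by rw [abs_le]; constructor <;> linarith)
      linarith [hK.corrected_trapezoid_cell ha.le c2 c3]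
    · have : b₃ i = 2 * L * a ^ 3 := if_pos (by rw [abs_le]; constructor <;> linarith)
      linarith [hbad i]
  have s1 := sum_abs_grid_le ha c 0 1 zero_le_one n (b := b₁) (β := L * a ^ 4)
    (fun i _ h => by rw [abs_of_nonneg (p1 i)]; exact (if_pos h).le)
    (fun i _ h => if_neg (not_le.2 h)) (by positivity)
  have s2 := sum_abs_grid_le ha c (-1) a ha.le n (b := b₂) (β := 2 * L * a ^ 3)
    (fun i _ h => by rw [abs_of_nonneg (p2 i)]; exact (if_pos h).le)
    (fun i _ h => if_neg (not_le.2 h)) (by positivity)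
  have s3 := sum_abs_grid_le ha c 1 a ha.le n (b := b₃) (β := 2 * L * a ^ 3)
    (fun i _ h => by rw [abs_of_nonneg (p3 i)]; exact (if_pos h).le)
    (fun i _ h => if_neg (not_le.2 h)) (by positivity)
  have s4 : ∑ i ∈ Finset.range n, |e i| ≤ ∑ i ∈ Finset.range n, (|b₁ i| + |b₂ i| + |b₃ i|) :=
    Finset.sum_le_sum fun i _ => hcell i
  rw [Finset.sum_add_distrib, Finset.sum_add_distrib] at s4
  rw [hsum]
  refine (Finset.abs_sum_le_sum_abs _ _).trans ?_
  have r1 : L * a ^ 4 * (2 * 1 / a + 1) = 2 * (L * a ^ 3) + L * a ^ 3 * a := by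
    field_simp
  have r2 : 2 * L * a ^ 3 * (2 * a / a + 1) = 6 * (L * a ^ 3) := by
    field_simp; ring
  have r3 : L * a ^ 3 * a ≤ L * a ^ 3 := mul_le_of_le_one_right (by positivity) ha1
  linarith

/-- Riemann sums of a Lipschitz function supported in `[-1,1]`. -/
theorem abs_riemann_sum_sub_integral_le {ψ : ℝ → ℝ} {Λ : ℝ} (hΛ : 0 ≤ Λ)
    (hψ : ∀ u v, |ψ u - ψ v| ≤ Λ * |u - v|) (h0 : ∀ u, 1 ≤ |u| → ψ u = 0) {a c : ℝ} {n : ℕ}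
    (ha : 0 < a) (ha1 : a ≤ 1) (hc : 1 ≤ a * c) (hn : 1 ≤ a * ((n : ℝ) - c)) :
    |∑ i ∈ Finset.range n, a * ψ (a * ((i : ℝ) - c)) - ∫ u in (-1 : ℝ)..1, ψ u| ≤
      5 * Λ * a := by
  have hcont : Continuous ψ := by
    have : LipschitzWith ⟨Λ, hΛ⟩ ψ := LipschitzWith.of_dist_le_mul fun u v => by
      rw [Real.dist_eq, Real.dist_eq]; exact hψ u v
    exact this.continuous
  have hint : ∀ u v, IntervalIntegrable ψ volume u v := hcont.intervalIntegrable
  set z : ℕ → ℝ := fun i => a * ((i : ℝ) - c) with hz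
  have hzs : ∀ i, z (i + 1) = z i + a := fun i => by simp only [hz]; push_cast; ring
  have hz0 : z 0 ≤ -1 := by simp only [hz]; push_cast; linarith
  have hvan : ∀ u v : ℝ, u ≤ v → (1 ≤ u ∨ v ≤ -1) → ∫ w in u..v, ψ w = 0 := by
    intro u v huv h
    rw [intervalIntegral.integral_congr (g := fun _ => 0)]
    · simp
    · intro w hw
      rw [uIcc_of_le huv] at hw
      rcases h with h | h
      · exact h0 w (le_abs.2 (Or.inl (h.trans hw.1)))
      · exact h0 w (le_abs.2 (Or.inr (by linarith [hw.2])))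
  have htot : ∫ u in (-1 : ℝ)..1, ψ u = ∑ i ∈ Finset.range n, ∫ u in z i..z (i + 1), ψ u := by
    rw [intervalIntegral.sum_integral_adjacent_intervals fun k _ => hint _ _,
      ← intervalIntegral.integral_add_adjacent_intervals (hint (z 0) (-1)) (hint (-1) (z n)),
      ← intervalIntegral.integral_add_adjacent_intervals (hint (-1) 1) (hint 1 (z n)),
      hvan _ _ hz0 (Or.inr le_rfl), hvan _ _ hn (Or.inl le_rfl)]
    ring
  rw [htot, ← Finset.sum_sub_distrib]
  refine (Finset.abs_sum_le_sum_abs _ _).trans ?_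
  -- Since `a ≤ 1`, a cell whose left end has modulus above `2` misses the open support, whence the
  -- radius `2`.
  refine (sum_abs_grid_le ha c 0 2 zero_le_two n (β := Λ * a ^ 2) ?_ ?_ (by positivity)).trans ?_
  · intro i _ _
    have h1 : a * ψ (z i) - ∫ u in z i..z (i + 1), ψ u = ∫ u in z i..z (i + 1), (ψ (z i) - ψ u) := by
      rw [intervalIntegral.integral_sub (by simp) (hint _ _), intervalIntegral.integral_const, hzs]
      simp
    rw [show a * ψ (a * ((i : ℝ) - c)) = a * ψ (z i) from rfl, h1]
    have h2 := intervalIntegral.norm_integral_le_of_norm_le_const (a := z i) (b := z (i + 1))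
      (f := fun u => ψ (z i) - ψ u) (C := Λ * a) (fun u hu => by
        rw [hzs, uIoc_of_le (by linarith)] at hu
        refine (hψ _ _).trans (mul_le_mul_of_nonneg_left ?_ hΛ)
        rw [abs_le]; constructor <;> linarith [hu.1, hu.2])
    rw [Real.norm_eq_abs, hzs, add_sub_cancel_left, abs_of_pos ha] at h2
    rw [hzs]; linarith
  · intro i _ hi
    rw [sub_zero] at hi
    have hi' : 2 < |z i| := hi
    rw [h0 (a * ((i : ℝ) - c)) (by linarith), hvan _ _ (by rw [hzs]; linarith)]
    · ring
    · rcases lt_abs.1 hi' with h | h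
      · left; linarith
      · right; rw [hzs]; linarith
  · have : Λ * a ^ 2 * (2 * 2 / a + 1) = 4 * (Λ * a) + Λ * a * a := by field_simp; ring
    rw [this]
    have : Λ * a * a ≤ Λ * a := mul_le_of_le_one_right (by positivity) ha1
    linarith

namespace KernelBounds

variable {K K₂ : ℝ → ℝ} {L : ℝ}

/-- For even `K` the function `K(u) u` is odd and has integral zero, so only the Riemann sum error
remains. -/
theorem abs_sum_mul_le (hK : KernelBounds K K₂ L) (heven : ∀ u, K (-u) = K u) {a c : ℝ} {n : ℕ}
    (ha : 0 < a) (ha1 : a ≤ 1) (hc : 1 ≤ a * c) (hn : 1 ≤ a * ((n : ℝ) - c)) :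
    |∑ i ∈ Finset.range n, a * (K (a * ((i : ℝ) - c)) * (a * ((i : ℝ) - c)))| ≤ 10 * L * a := by
  have hL := hK.one_le
  have key : ∀ u v : ℝ, |u| < 1 → |K u * u - K v * v| ≤ 2 * L * |u - v| := by
    intro u v hu
    rw [show K u * u - K v * v = (K u - K v) * u + K v * (u - v) by ring]
    refine (abs_add_le _ _).trans ?_
    rw [abs_mul, abs_mul]
    have h1 := hK.lip u v
    have h2 := hK.bound v
    have h3 : |K u - K v| * |u| ≤ (L * |u - v|) * 1 :=
      mul_le_mul h1 hu.le (abs_nonneg _) (by positivity)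
    have h4 := mul_le_mul_of_nonneg_right h2 (abs_nonneg (u - v))
    linarith
  have hint : ∫ u in (-1 : ℝ)..1, K u * u = 0 := by
    have h := intervalIntegral.integral_comp_neg (a := -1) (b := 1) (fun u => K u * u)
    simp only [heven, mul_neg, intervalIntegral.integral_neg, neg_neg] at h
    linarith
  have h := abs_riemann_sum_sub_integral_le (ψ := fun u => K u * u) (Λ := 2 * L) (by positivity)
    (fun u v => ?_) (fun u hu => by simp only [hK.zero u hu, zero_mul]) ha ha1 hc hn
  · rw [hint, sub_zero] at h
    linarith
  · rcases lt_or_ge |u| 1 with hu | hu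
    · exact key u v hu
    · rcases lt_or_ge |v| 1 with hv | hv
      · rw [abs_sub_comm, abs_sub_comm u v]; exact key v u hv
      · simp only [hK.zero u hu, hK.zero v hv, zero_mul, sub_zero, abs_zero]; positivity

/-- An iterated Riemann sum: the inner sum approximates `I w = ∫ K(u)|u - w| du` uniformly for `|w|
≤ 1`, and the outer one applies to `K I`, which is again Lipschitz and supported in `[-1,1]`. -/
theorem abs_sum_abs_sub_le (hK : KernelBounds K K₂ L) {a c : ℝ} {n : ℕ}
    (ha : 0 < a) (ha1 : a ≤ 1) (hc : 1 ≤ a * c) (hn : 1 ≤ a * ((n : ℝ) - c)) :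
    |∑ j ∈ Finset.range n, ∑ i ∈ Finset.range n, a * K (a * ((i : ℝ) - c)) *
      (a * K (a * ((j : ℝ) - c))) * |a * ((i : ℝ) - c) - a * ((j : ℝ) - c)| - kernelC K| ≤
      120 * L ^ 2 * a := by
  have hL := hK.one_le
  have hKc := hK.continuous
  have hlip1 : ∀ w : ℝ, |w| ≤ 1 → ∀ u v, |(K u * |u - w| - K v * |v - w|)| ≤ 3 * L * |u - v| := by
    intro w hw
    -- The product split needs `|u - w|` bounded, so one of the two points is taken inside the
    -- support; if both lie outside, the difference is zero.
    have key : ∀ u v : ℝ, |u| < 1 → |(K u * |u - w| - K v * |v - w|)| ≤ 3 * L * |u - v| := by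
      intro u v hu
      rw [show K u * |u - w| - K v * |v - w| = (K u - K v) * |u - w| + K v * (|u - w| - |v - w|)
        by ring]
      refine (abs_add_le _ _).trans ?_
      rw [abs_mul, abs_mul, abs_abs]
      have h1 := hK.lip u v
      have h2 := hK.bound v
      have h3 : |K u - K v| * |u - w| ≤ (L * |u - v|) * 2 :=
        mul_le_mul h1 ((abs_sub _ _).trans (by linarith)) (abs_nonneg _) (by positivity)
      have h5 : |(|u - w| - |v - w|)| ≤ |u - v| := by
        have := abs_abs_sub_abs_le_abs_sub (u - w) (v - w)
        rwa [sub_sub_sub_cancel_right] at this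
      have h4 := mul_le_mul h2 h5 (abs_nonneg _) (by linarith)
      linarith
    intro u v
    rcases lt_or_ge |u| 1 with hu | hu
    · exact key u v hu
    · rcases lt_or_ge |v| 1 with hv | hv
      · rw [abs_sub_comm, abs_sub_comm u v]; exact key v u hv
      · simp only [hK.zero u hu, hK.zero v hv, zero_mul, sub_zero, abs_zero]; positivity
  set I : ℝ → ℝ := fun w => ∫ u in (-1 : ℝ)..1, K u * |u - w| with hI
  have hint : ∀ w, IntervalIntegrable (fun u => K u * |u - w|) volume (-1) 1 := fun w =>
    (by fun_prop : Continuous fun u => K u * |u - w|).intervalIntegrable _ _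
  have hIb : ∀ w : ℝ, |w| ≤ 1 → |I w| ≤ 4 * L := by
    intro w hw
    have := intervalIntegral.norm_integral_le_of_norm_le_const (a := -1) (b := 1)
      (f := fun u => K u * |u - w|) (C := 2 * L) (fun u hu => by
        rw [uIoc_of_le (by norm_num)] at hu
        rw [Real.norm_eq_abs, abs_mul, abs_abs]
        have h1 : |u - w| ≤ 2 := (abs_sub _ _).trans (by
          have : |u| ≤ 1 := abs_le.2 ⟨hu.1.le, hu.2⟩
          linarith)
        have := mul_le_mul (hK.bound u) h1 (abs_nonneg _) (by linarith)
        linarith)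
    rw [Real.norm_eq_abs] at this
    refine this.trans (le_of_eq ?_)
    norm_num; ring
  have hIlip : ∀ v w : ℝ, |I v - I w| ≤ 2 * L * |v - w| := by
    intro v w
    simp only [hI]
    rw [← intervalIntegral.integral_sub (hint v) (hint w)]
    have := intervalIntegral.norm_integral_le_of_norm_le_const (a := -1) (b := 1)
      (f := fun u => K u * |u - v| - K u * |u - w|) (C := L * |v - w|) (fun u _ => by
        rw [Real.norm_eq_abs, ← mul_sub, abs_mul]
        have h1 := abs_abs_sub_abs_le_abs_sub (u - v) (u - w)
        rw [sub_sub_sub_cancel_left, abs_sub_comm w v] at h1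
        exact mul_le_mul (hK.bound u) h1 (abs_nonneg _) (by linarith))
    rw [Real.norm_eq_abs] at this
    refine this.trans (le_of_eq ?_)
    norm_num; ring
  have hlip2 : ∀ u v, |K u * I u - K v * I v| ≤ 6 * L ^ 2 * |u - v| := by
    have key : ∀ u v : ℝ, |u| < 1 → |K u * I u - K v * I v| ≤ 6 * L ^ 2 * |u - v| := by
      intro u v hu
      rw [show K u * I u - K v * I v = (K u - K v) * I u + K v * (I u - I v) by ring]
      refine (abs_add_le _ _).trans ?_
      rw [abs_mul, abs_mul]
      have h3 := mul_le_mul (hK.lip u v) (hIb u hu.le) (abs_nonneg _) (by positivity)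
      have h4 := mul_le_mul (hK.bound v) (hIlip u v) (abs_nonneg _) (by linarith)
      linarith
    intro u v
    rcases lt_or_ge |u| 1 with hu | hu
    · exact key u v hu
    · rcases lt_or_ge |v| 1 with hv | hv
      · rw [abs_sub_comm, abs_sub_comm u v]; exact key v u hv
      · simp only [hK.zero u hu, hK.zero v hv, zero_mul, sub_zero, abs_zero]; positivity
  have hCK : kernelC K = ∫ w in (-1 : ℝ)..1, K w * I w := by
    unfold kernelC
    refine intervalIntegral.integral_congr fun w _ => ?_
    simp only [hI]
    rw [← intervalIntegral.integral_const_mul]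
    refine intervalIntegral.integral_congr fun u _ => ?_
    ring
  have houter := abs_riemann_sum_sub_integral_le (ψ := fun w => K w * I w) (Λ := 6 * L ^ 2)
    (by positivity) hlip2 (fun u hu => by simp only [hK.zero u hu, zero_mul]) ha ha1 hc hn
  rw [← hCK] at houter
  have hinner : ∀ w : ℝ, |w| ≤ 1 →
      |∑ i ∈ Finset.range n, a * (K (a * ((i : ℝ) - c)) * |a * ((i : ℝ) - c) - w|) - I w| ≤
      15 * L * a := by
    intro w hw
    have := abs_riemann_sum_sub_integral_le (ψ := fun u => K u * |u - w|) (Λ := 3 * L)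
      (by positivity) (hlip1 w hw) (fun u hu => by simp only [hK.zero u hu, zero_mul]) ha ha1 hc hn
    simp only [hI]
    linarith
  have hsplit : ∑ j ∈ Finset.range n, ∑ i ∈ Finset.range n, a * K (a * ((i : ℝ) - c)) *
      (a * K (a * ((j : ℝ) - c))) * |a * ((i : ℝ) - c) - a * ((j : ℝ) - c)| - kernelC K =
      ∑ j ∈ Finset.range n, a * K (a * ((j : ℝ) - c)) *
        (∑ i ∈ Finset.range n, a * (K (a * ((i : ℝ) - c)) *
          |a * ((i : ℝ) - c) - a * ((j : ℝ) - c)|) - I (a * ((j : ℝ) - c))) +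
      (∑ j ∈ Finset.range n, a * (K (a * ((j : ℝ) - c)) * I (a * ((j : ℝ) - c))) - kernelC K) := by
    rw [add_sub_assoc', ← Finset.sum_add_distrib]
    congr 1
    refine Finset.sum_congr rfl fun j _ => ?_
    set w := a * ((j : ℝ) - c)
    rw [mul_sub (a * K w), Finset.mul_sum, mul_assoc a (K w) (I w), sub_add_cancel]
    refine Finset.sum_congr rfl fun i _ => ?_
    ring
  rw [hsplit]
  refine (abs_add_le _ _).trans ?_
  have hfirst := (Finset.abs_sum_le_sum_abs (fun j : ℕ => a * K (a * ((j : ℝ) - c)) *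
        (∑ i ∈ Finset.range n, a * (K (a * ((i : ℝ) - c)) *
          |a * ((i : ℝ) - c) - a * ((j : ℝ) - c)|) - I (a * ((j : ℝ) - c))))
          (Finset.range n)).trans
    (sum_abs_grid_le ha c 0 1 zero_le_one n (β := a * L * (15 * L * a)) (fun j _ hj => by
      rw [sub_zero] at hj
      rw [abs_mul, abs_mul, abs_of_pos ha]
      exact mul_le_mul (mul_le_mul_of_nonneg_left (hK.bound _) ha.le) (hinner _ hj) (abs_nonneg _)
        (by positivity)) (fun j _ hj => by
      rw [sub_zero] at hj
      rw [hK.zero _ hj.le]; ring) (by positivity))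
  have : a * L * (15 * L * a) * (2 * 1 / a + 1) = 30 * (L ^ 2 * a) + 15 * (L ^ 2 * a * a) := by
    field_simp; ring
  rw [this] at hfirst
  have h4 : L ^ 2 * a * a ≤ L ^ 2 * a := mul_le_of_le_one_right (by positivity) ha1
  have h5 : 0 ≤ L ^ 2 * a := by positivity
  linarith

end KernelBounds

/-! ### The autocovariance function near the diagonal. -/

/-- Mean value inequality on a closed interval for a function differentiable in its interior. -/
theorem abs_sub_le_of_hasDerivAt_Ioo {φ φ' : ℝ → ℝ} {a b C : ℝ} (hab : a ≤ b)
    (hc : ContinuousOn φ (Icc a b)) (hd : ∀ u ∈ Ioo a b, HasDerivAt φ (φ' u) u)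
    (hb : ∀ u ∈ Ioo a b, |φ' u| ≤ C) : |φ b - φ a| ≤ C * (b - a) := by
  rcases hab.eq_or_lt with rfl | h
  · simp
  obtain ⟨c, hc', he⟩ := exists_hasDerivAt_eq_slope φ φ' h hc hd
  have hpos : 0 < b - a := sub_pos.2 h
  rw [eq_div_iff hpos.ne'] at he
  rw [← he, abs_mul, abs_of_pos hpos]
  exact mul_le_mul_of_nonneg_right (hb c hc') hpos.le

section Covariance

variable {R : ℝ → ℝ → ℝ}

theorem Icc_mem_nhds_of_mem_Ioo {u : ℝ} (hu : u ∈ Ioo (0 : ℝ) 1) : Icc (0 : ℝ) 1 ∈ 𝓝 u :=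
  Icc_mem_nhds hu.1 hu.2

/-- Existence of the partial derivatives at interior points off the diagonal. -/
theorem AssumptionC.hasDerivAt (hC : AssumptionC R) {t s : ℝ} (ht : t ∈ Ioo (0 : ℝ) 1)
    (hs : s ∈ Ioo (0 : ℝ) 1) (hts : t ≠ s) :
    HasDerivAt (fun s' => R t s') (mixedPartial R 0 1 t s) s ∧
    HasDerivAt (fun s' => mixedPartial R 0 1 t s') (mixedPartial R 0 2 t s) s ∧
    HasDerivAt (fun t' => mixedPartial R 0 1 t' s) (mixedPartial R 1 1 t s) t := by
  set Q : ℝ × ℝ → ℝ := fun p => R p.1 p.2 with hQ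
  -- On this open set the derivatives within `[0,1]` agree with ordinary ones, and those are read
  -- off from `fderiv`.
  set U : Set (ℝ × ℝ) := {p | p.1 ∈ Ioo (0 : ℝ) 1 ∧ p.2 ∈ Ioo (0 : ℝ) 1 ∧ p.1 ≠ p.2} with hU
  have hUo : IsOpen U := by
    have h1 : IsOpen {p : ℝ × ℝ | p.1 ∈ Ioo (0 : ℝ) 1} := isOpen_Ioo.preimage continuous_fst
    have h2 : IsOpen {p : ℝ × ℝ | p.2 ∈ Ioo (0 : ℝ) 1} := isOpen_Ioo.preimage continuous_snd
    have h3 : IsOpen {p : ℝ × ℝ | p.1 ≠ p.2} := isOpen_ne_fun continuous_fst continuous_snd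
    exact h1.inter (h2.inter h3)
  have hUsub : U ⊆ offDiagonal := fun p hp =>
    ⟨Ioo_subset_Icc_self hp.1, Ioo_subset_Icc_self hp.2.1, hp.2.2⟩
  have hat : ∀ p ∈ U, ContDiffAt ℝ 2 Q p := fun p hp =>
    (hC.contDiffOn.mono hUsub).contDiffAt (hUo.mem_nhds hp)
  have hline : ∀ p : ℝ × ℝ, HasDerivAt (fun s' => (p.1, s')) ((0 : ℝ), (1 : ℝ)) p.2 := fun p =>
    (hasDerivAt_const p.2 p.1).prodMk (hasDerivAt_id p.2)
  have hfst : ∀ p ∈ U, HasDerivAt (fun s' => R p.1 s') (fderiv ℝ Q p (0, 1)) p.2 := by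
    intro p hp
    have h1 : HasFDerivAt Q (fderiv ℝ Q p) p :=
      ((hat p hp).differentiableAt (by norm_num)).hasFDerivAt
    exact h1.comp_hasDerivAt (f := fun s' => (p.1, s')) p.2 (hline p)
  have hmp : ∀ p ∈ U, mixedPartial R 0 1 p.1 p.2 = fderiv ℝ Q p (0, 1) := by
    intro p hp
    change derivWithin (fun s' => R p.1 s') (Icc (0 : ℝ) 1) p.2 = _
    rw [derivWithin_of_mem_nhds (Icc_mem_nhds_of_mem_Ioo hp.2.1)]
    exact (hfst p hp).deriv
  have hp : (t, s) ∈ U := ⟨ht, hs, hts⟩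
  have hev : (fun q : ℝ × ℝ => mixedPartial R 0 1 q.1 q.2) =ᶠ[𝓝 (t, s)]
      fun q => fderiv ℝ Q q (0, 1) := by
    filter_upwards [hUo.mem_nhds hp] with q hq using hmp q hq
  have hdiff : DifferentiableAt ℝ (fun q : ℝ × ℝ => mixedPartial R 0 1 q.1 q.2) (t, s) := by
    rw [hev.differentiableAt_iff]
    have h2 : DifferentiableAt ℝ (fderiv ℝ Q) (t, s) :=
      ((hat _ hp).fderiv_right (m := 1) (by norm_num)).differentiableAt (by norm_num)
    exact h2.clm_apply (differentiableAt_const _)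
  refine ⟨?_, ?_, ?_⟩
  · rw [hmp _ hp]; exact hfst _ hp
  · have h1 : DifferentiableAt ℝ (fun s' => mixedPartial R 0 1 t s') s :=
      hdiff.comp (f := fun s' => (t, s')) s (by fun_prop)
    have e : mixedPartial R 0 2 t s = deriv (fun s' => mixedPartial R 0 1 t s') s :=
      derivWithin_of_mem_nhds (Icc_mem_nhds_of_mem_Ioo hs)
    rw [e]; exact h1.hasDerivAt
  · have h1 : DifferentiableAt ℝ (fun t' => mixedPartial R 0 1 t' s) t :=
      hdiff.comp (f := fun t' => (t', s)) t
        (by fun_prop)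
    have e : mixedPartial R 1 1 t s = deriv (fun t' => mixedPartial R 0 1 t' s) t :=
      derivWithin_of_mem_nhds (Icc_mem_nhds_of_mem_Ioo ht)
    rw [e]; exact h1.hasDerivAt

/-- `R^{(0,1)}` is Lipschitz in each variable on each side of the diagonal. -/
theorem AssumptionC.exists_lipschitz (hC : AssumptionC R) : ∃ A : ℝ, 0 ≤ A ∧
    (∀ t ∈ Ioo (0 : ℝ) 1, ∀ s ∈ Ioo (0 : ℝ) 1, ∀ s' ∈ Ioo (0 : ℝ) 1,
      (s < t ∧ s' < t ∨ t < s ∧ t < s') →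
      |mixedPartial R 0 1 t s - mixedPartial R 0 1 t s'| ≤ A * |s - s'|) ∧
    (∀ s ∈ Ioo (0 : ℝ) 1, ∀ t ∈ Ioo (0 : ℝ) 1, ∀ t' ∈ Ioo (0 : ℝ) 1,
      (s < t ∧ s < t' ∨ t < s ∧ t' < s) →
      |mixedPartial R 0 1 t s - mixedPartial R 0 1 t' s| ≤ A * |t - t'|) := by
  obtain ⟨A₁, hA₁⟩ := hC.bounded 0 2 (by norm_num)
  obtain ⟨A₂, hA₂⟩ := hC.bounded 1 1 (by norm_num)
  have hoff : ∀ {t s : ℝ}, t ∈ Ioo (0 : ℝ) 1 → s ∈ Ioo (0 : ℝ) 1 → t ≠ s →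
      (t, s) ∈ offDiagonal := fun ht hs h =>
    ⟨Ioo_subset_Icc_self ht, Ioo_subset_Icc_self hs, h⟩
  refine ⟨max 0 (max A₁ A₂), le_max_left _ _, ?_, ?_⟩
  · intro t ht s hs s' hs' h
    have key : ∀ I : Set ℝ, Convex ℝ I → (∀ u ∈ I, u ∈ Ioo (0 : ℝ) 1 ∧ t ≠ u) → s ∈ I → s' ∈ I →
        |mixedPartial R 0 1 t s - mixedPartial R 0 1 t s'| ≤ max 0 (max A₁ A₂) * |s - s'| := by
      intro I hI hmem h1 h2
      exact abs_sub_le_of_deriv_bound hI (fun u hu =>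
        (hC.hasDerivAt ht (hmem u hu).1 (hmem u hu).2).2.1.hasDerivWithinAt) (fun u hu =>
        (hA₁ _ (hoff ht (hmem u hu).1 (hmem u hu).2)).trans
          ((le_max_left _ _).trans (le_max_right _ _))) h1 h2
    rcases h with h | h
    · exact key (Ioo 0 t) (convex_Ioo _ _) (fun u hu => ⟨⟨hu.1, hu.2.trans ht.2⟩, hu.2.ne'⟩)
        ⟨hs.1, h.1⟩ ⟨hs'.1, h.2⟩
    · exact key (Ioo t 1) (convex_Ioo _ _) (fun u hu => ⟨⟨ht.1.trans hu.1, hu.2⟩, hu.1.ne⟩)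
        ⟨h.1, hs.2⟩ ⟨h.2, hs'.2⟩
  · intro s hs t ht t' ht' h
    have key : ∀ I : Set ℝ, Convex ℝ I → (∀ u ∈ I, u ∈ Ioo (0 : ℝ) 1 ∧ u ≠ s) → t ∈ I → t' ∈ I →
        |mixedPartial R 0 1 t s - mixedPartial R 0 1 t' s| ≤ max 0 (max A₁ A₂) * |t - t'| := by
      intro I hI hmem h1 h2
      exact abs_sub_le_of_deriv_bound (φ := fun t => mixedPartial R 0 1 t s) hI (fun u hu =>
        (hC.hasDerivAt (hmem u hu).1 hs (hmem u hu).2).2.2.hasDerivWithinAt) (fun u hu =>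
        (hA₂ _ (hoff (hmem u hu).1 hs (hmem u hu).2)).trans
          ((le_max_right _ _).trans (le_max_right _ _))) h1 h2
    rcases h with h | h
    · exact key (Ioo s 1) (convex_Ioo _ _) (fun u hu => ⟨⟨hs.1.trans hu.1, hu.2⟩, hu.1.ne'⟩)
        ⟨h.1, ht.2⟩ ⟨h.2, ht'.2⟩
    · exact key (Ioo 0 s) (convex_Ioo _ _) (fun u hu => ⟨⟨hu.1, hu.2.trans hs.2⟩, hu.2.ne⟩)
        ⟨ht.1, h.1⟩ ⟨ht'.1, h.2⟩

/-- First order expansion of the autocovariance function at a point of the diagonal. -/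
theorem exists_covariance_expansion {α : ℝ → ℝ} (hA : AssumptionA R) (hB : AssumptionB R α)
    (hC : AssumptionC R)
    (hsymm : ∀ t ∈ Icc (0 : ℝ) 1, ∀ s ∈ Icc (0 : ℝ) 1, R t s = R s t) {x : ℝ}
    (hx : x ∈ Ioo (0 : ℝ) 1) :
    ∃ d C : ℝ, 0 ≤ C ∧ ∀ h : ℝ, 0 < h → 0 < x - 2 * h → x + 2 * h < 1 →
      ∀ t s : ℝ, |t - x| ≤ h → |s - x| ≤ h →
      |R t s - (R x x + d * (t - x) + d * (s - x) - α x / 2 * |t - s|)| ≤ C * h ^ 2 := by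
  obtain ⟨A, hA0, hLs, hLt⟩ := hC.exists_lipschitz
  obtain ⟨Rl, Rr, -, -, hlim⟩ := hB.exists_limits
  obtain ⟨hl, hr, hα⟩ := hlim x hx
  -- For `s ≤ t` the model reduces to `R(x,x) + (Rl + Rr)(t - x) - Rl (t - s)`: a change along the
  -- diagonal followed by a change in the second variable. Each of the two contributes an error `12
  -- A h²`.
  refine ⟨(Rl x + Rr x) / 2, 24 * A, by positivity, ?_⟩
  intro h h0 hlo hhi
  have hwin : ∀ t : ℝ, |t - x| ≤ 2 * h → t ∈ Ioo (0 : ℝ) 1 := fun t ht => by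
    rw [abs_le] at ht; constructor <;> linarith [ht.1, ht.2]
  have hwin' : ∀ t : ℝ, |t - x| ≤ h → t ∈ Ioo (0 : ℝ) 1 := fun t ht => hwin t (by linarith)
  have hleft : |mixedPartial R 0 1 x (x - 2 * h) - Rl x| ≤ A * (2 * h) := by
    refine le_of_tendsto (tendsto_const_nhds.sub hl).abs ?_
    filter_upwards [Ioo_mem_nhdsLT (by linarith : x - 2 * h < x)] with s hs
    refine (hLs x hx (x - 2 * h) ⟨hlo, by linarith [hx.2]⟩ s ⟨by linarith [hs.1],
      by linarith [hs.2, hx.2]⟩ (Or.inl ⟨by linarith, hs.2⟩)).trans ?_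
    exact mul_le_mul_of_nonneg_left (abs_le.2 ⟨by linarith [hs.2], by linarith [hs.1]⟩) hA0
  have hright : |mixedPartial R 0 1 x (x + 2 * h) - Rr x| ≤ A * (2 * h) := by
    refine le_of_tendsto (tendsto_const_nhds.sub hr).abs ?_
    filter_upwards [Ioo_mem_nhdsGT (by linarith : x < x + 2 * h)] with s hs
    refine (hLs x hx (x + 2 * h) ⟨by linarith [hx.1], hhi⟩ s ⟨by linarith [hs.1, hx.1],
      by linarith [hs.2]⟩ (Or.inr ⟨by linarith, hs.1⟩)).trans ?_
    exact mul_le_mul_of_nonneg_left (abs_le.2 ⟨by linarith [hs.2], by linarith [hs.1]⟩) hA0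
  -- The derivative is carried from `(t,s)` to `(t, x-2h)`, then to `(x, x-2h)`, then to the left
  -- limit at `x`. As `x - 2h` lies below every admissible `t`, the path never meets the diagonal.
  -- The lengths `3h`, `h` and `2h` add up to `6h`.
  have hL : ∀ t s : ℝ, |t - x| ≤ h → |s - x| ≤ h → s < t →
      |mixedPartial R 0 1 t s - Rl x| ≤ 6 * A * h := by
    intro t s ht hs hst
    have ht' := abs_le.1 ht
    have hs' := abs_le.1 hs
    have h1 := hLs t (hwin' t ht) s (hwin' s hs) (x - 2 * h) (hwin _ (by
      rw [abs_le]; constructor <;> linarith)) (Or.inl ⟨hst, by linarith⟩)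
    have h2 := hLt (x - 2 * h) (hwin _ (by rw [abs_le]; constructor <;> linarith)) t (hwin' t ht)
      x hx (Or.inl ⟨by linarith, by linarith⟩)
    have h3 : A * |s - (x - 2 * h)| ≤ A * (3 * h) :=
      mul_le_mul_of_nonneg_left (abs_le.2 ⟨by linarith, by linarith⟩) hA0
    have h4 := mul_le_mul_of_nonneg_left ht hA0
    rw [abs_le] at h1 h2 hleft ⊢
    constructor <;> linarith
  have hR : ∀ t s : ℝ, |t - x| ≤ h → |s - x| ≤ h → t < s →
      |mixedPartial R 0 1 t s - Rr x| ≤ 6 * A * h := by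
    intro t s ht hs hst
    have ht' := abs_le.1 ht
    have hs' := abs_le.1 hs
    have h1 := hLs t (hwin' t ht) s (hwin' s hs) (x + 2 * h) (hwin _ (by
      rw [abs_le]; constructor <;> linarith)) (Or.inr ⟨hst, by linarith⟩)
    have h2 := hLt (x + 2 * h) (hwin _ (by rw [abs_le]; constructor <;> linarith)) t (hwin' t ht)
      x hx (Or.inr ⟨by linarith, by linarith⟩)
    have h3 : A * |s - (x + 2 * h)| ≤ A * (3 * h) :=
      mul_le_mul_of_nonneg_left (abs_le.2 ⟨by linarith, by linarith⟩) hA0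
    have h4 := mul_le_mul_of_nonneg_left ht hA0
    rw [abs_le] at h1 h2 hright ⊢
    constructor <;> linarith
  have hcont : ∀ t ∈ Icc (0 : ℝ) 1, ContinuousOn (fun s => R t s) (Icc (0 : ℝ) 1) := by
    intro t ht
    exact ContinuousOn.comp (g := fun p : ℝ × ℝ => R p.1 p.2) (f := fun s => (t, s)) hA
      (by fun_prop) (fun s hs => ⟨ht, hs⟩)
  have hsegm : ∀ u v : ℝ, |u - x| ≤ h → |v - x| ≤ h → ∀ w ∈ Icc u v, |w - x| ≤ h := by
    intro u v hu hv w hw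
    rw [abs_le] at hu hv ⊢
    constructor <;> linarith [hw.1, hw.2]
  have hIL : ∀ t s : ℝ, |t - x| ≤ h → |s - x| ≤ h → s ≤ t →
      |R t s - R t t + Rl x * (t - s)| ≤ 6 * A * h * (t - s) := by
    intro t s ht hs hst
    have hw := hsegm s t hs ht
    have := abs_sub_le_of_hasDerivAt_Ioo (φ := fun u => R t u - u * Rl x)
      (φ' := fun u => mixedPartial R 0 1 t u - Rl x) hst
      (((hcont t (Ioo_subset_Icc_self (hwin' t ht))).mono fun u hu =>
        Ioo_subset_Icc_self (hwin' u (hw u hu))).sub (by fun_prop))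
      (fun u hu => ((hC.hasDerivAt (hwin' t ht) (hwin' u (hw u (Ioo_subset_Icc_self hu)))
        hu.2.ne').1.sub ((hasDerivAt_id u).mul_const (Rl x))).congr_deriv (by simp))
      (fun u hu => hL t u ht (hw u (Ioo_subset_Icc_self hu)) hu.2)
    rw [abs_sub_comm] at this
    rwa [show R t s - R t t + Rl x * (t - s) = R t s - s * Rl x - (R t t - t * Rl x) by ring]
  have hIR : ∀ t s : ℝ, |t - x| ≤ h → |s - x| ≤ h → t ≤ s →
      |R t s - R t t - Rr x * (s - t)| ≤ 6 * A * h * (s - t) := by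
    intro t s ht hs hst
    have hw := hsegm t s ht hs
    have := abs_sub_le_of_hasDerivAt_Ioo (φ := fun u => R t u - u * Rr x)
      (φ' := fun u => mixedPartial R 0 1 t u - Rr x) hst
      (((hcont t (Ioo_subset_Icc_self (hwin' t ht))).mono fun u hu =>
        Ioo_subset_Icc_self (hwin' u (hw u hu))).sub (by fun_prop))
      (fun u hu => ((hC.hasDerivAt (hwin' t ht) (hwin' u (hw u (Ioo_subset_Icc_self hu)))
        hu.1.ne).1.sub ((hasDerivAt_id u).mul_const (Rr x))).congr_deriv (by simp))
      (fun u hu => hR t u ht (hw u (Ioo_subset_Icc_self hu)) hu.1)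
    rwa [show R t s - R t t - Rr x * (s - t) = R t s - s * Rr x - (R t t - t * Rr x) by ring]
  have hxx : |x - x| ≤ h := by simpa using h0.le
  have hmulA : ∀ r : ℝ, r ≤ h → 6 * A * h * r ≤ 6 * A * h ^ 2 := fun r hr => by
    rw [pow_two, ← mul_assoc]; exact mul_le_mul_of_nonneg_left hr (by positivity)
  -- By symmetry `R(t,x) = R(x,t)`; expanding one side from `(t,t)` and the other from `(x,x)` and
  -- subtracting yields the sum of the two one-sided slopes.
  have hdiag : ∀ t : ℝ, |t - x| ≤ h → |R t t - R x x - (Rl x + Rr x) * (t - x)| ≤ 12 * A * h ^ 2 := by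
    intro t ht
    have ht' := abs_le.1 ht
    have hs := hsymm t (Ioo_subset_Icc_self (hwin' t ht)) x (Ioo_subset_Icc_self hx)
    rcases le_total x t with hxt | hxt
    · have h1 := (hIL t x ht hxx hxt).trans (hmulA _ (by linarith))
      have h2 := (hIR x t hxx ht hxt).trans (hmulA _ (by linarith))
      rw [abs_le] at h1 h2 ⊢
      constructor <;> linarith
    · have h1 := (hIR t x ht hxx hxt).trans (hmulA _ (by linarith))
      have h2 := (hIL x t hxx ht hxt).trans (hmulA _ (by linarith))
      rw [abs_le] at h1 h2 ⊢
      constructor <;> linarith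
  have hmain : ∀ t s : ℝ, |t - x| ≤ h → |s - x| ≤ h → s ≤ t →
      |R t s - (R x x + (Rl x + Rr x) / 2 * (t - x) + (Rl x + Rr x) / 2 * (s - x) -
        α x / 2 * |t - s|)| ≤ 24 * A * h ^ 2 := by
    intro t s ht hs hst
    have h1 := hIL t s ht hs hst
    have h2 := hdiag t ht
    have ht' := abs_le.1 ht
    have hs' := abs_le.1 hs
    have h3 : 6 * A * h * (t - s) ≤ 6 * A * h * (2 * h) :=
      mul_le_mul_of_nonneg_left (by linarith) (by positivity)
    rw [abs_of_nonneg (sub_nonneg.2 hst), hα]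
    rw [abs_le] at h1 h2 ⊢
    constructor <;> linarith
  intro t s ht hs
  rcases le_total s t with hst | hst
  · exact hmain t s ht hs hst
  · rw [hsymm t (Ioo_subset_Icc_self (hwin' t ht)) s (Ioo_subset_Icc_self (hwin' s hs)),
      abs_sub_comm t s, add_right_comm (R x x)]
    exact hmain s t hs ht hst

end Covariance

/-! ### The design density, its distribution function and the design points. -/

/-- Quantitative regularity of a design density. -/
structure DensityBounds (f : ℝ → ℝ) (c₀ C₀ C₁ : ℝ) : Prop where
  pos : 0 < c₀
  lower : ∀ t ∈ Icc (0 : ℝ) 1, c₀ ≤ f t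
  upper : ∀ t ∈ Icc (0 : ℝ) 1, f t ≤ C₀
  cont : ContinuousOn f (Icc (0 : ℝ) 1)
  diff : ∀ t ∈ Ioo (0 : ℝ) 1, HasDerivAt f (deriv f t) t
  deriv_bound : ∀ t ∈ Ioo (0 : ℝ) 1, |deriv f t| ≤ C₁
  integral_eq_one : ∫ t in (0 : ℝ)..1, f t = 1

theorem IsDesignDensity.exists_bounds {f : ℝ → ℝ} (hf : IsDesignDensity f)
    (hf1 : ContDiffOn ℝ 1 f (Icc (0 : ℝ) 1)) : ∃ c₀ C₀ C₁, DensityBounds f c₀ C₀ C₁ := by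
  obtain ⟨c₀, hc, hlow⟩ := hf.bddBelow
  obtain ⟨C₀, hup⟩ := hf.bddAbove
  obtain ⟨C₁, h1⟩ := isCompact_Icc.exists_bound_of_continuousOn
    (hf1.continuousOn_derivWithin (uniqueDiffOn_Icc zero_lt_one) le_rfl)
  refine ⟨c₀, C₀, C₁, hc, hlow, hup, hf1.continuousOn, ?_, ?_, hf.integral_eq_one⟩
  · intro t ht
    exact ((hf1.contDiffAt (Icc_mem_nhds ht.1 ht.2)).differentiableAt (by norm_num)).hasDerivAt
  · intro t ht
    have := h1 t (Ioo_subset_Icc_self ht)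
    rwa [derivWithin_of_mem_nhds (Icc_mem_nhds ht.1 ht.2)] at this

namespace DensityBounds

variable {f : ℝ → ℝ} {c₀ C₀ C₁ : ℝ}

theorem le_upper (hf : DensityBounds f c₀ C₀ C₁) : c₀ ≤ C₀ :=
  (hf.lower 0 (by simp)).trans (hf.upper 0 (by simp))

theorem pos_upper (hf : DensityBounds f c₀ C₀ C₁) : 0 < C₀ := hf.pos.trans_le hf.le_upper

theorem deriv_bound_nonneg (hf : DensityBounds f c₀ C₀ C₁) : 0 ≤ C₁ :=
  (abs_nonneg _).trans (hf.deriv_bound (1 / 2) (by norm_num))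

theorem pos_apply (hf : DensityBounds f c₀ C₀ C₁) {t : ℝ} (ht : t ∈ Icc (0 : ℝ) 1) : 0 < f t :=
  hf.pos.trans_le (hf.lower t ht)

theorem intervalIntegrable (hf : DensityBounds f c₀ C₀ C₁) {s t : ℝ} (hs : s ∈ Icc (0 : ℝ) 1)
    (ht : t ∈ Icc (0 : ℝ) 1) : IntervalIntegrable f volume s t :=
  (hf.cont.mono (ordConnected_Icc.uIcc_subset hs ht)).intervalIntegrable

theorem lip (hf : DensityBounds f c₀ C₀ C₁) {s t : ℝ} (hs : s ∈ Icc (0 : ℝ) 1)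
    (ht : t ∈ Icc (0 : ℝ) 1) : |f t - f s| ≤ C₁ * |t - s| := by
  have key : ∀ s t : ℝ, s ∈ Icc (0 : ℝ) 1 → t ∈ Icc (0 : ℝ) 1 → s ≤ t →
      |f t - f s| ≤ C₁ * |t - s| := by
    intro s t hs ht hst
    rw [abs_of_nonneg (sub_nonneg.2 hst)]
    exact abs_sub_le_of_hasDerivAt_Ioo hst (hf.cont.mono (Icc_subset_Icc hs.1 ht.2))
      (fun u hu => hf.diff u ⟨hs.1.trans_lt hu.1, hu.2.trans_le ht.2⟩)
      (fun u hu => hf.deriv_bound u ⟨hs.1.trans_lt hu.1, hu.2.trans_le ht.2⟩)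
  rcases le_total s t with h | h
  · exact key s t hs ht h
  · rw [abs_sub_comm, abs_sub_comm t s]; exact key t s ht hs h

theorem cdf_zero : designCDF f 0 = 0 := intervalIntegral.integral_same

theorem cdf_one (hf : DensityBounds f c₀ C₀ C₁) : designCDF f 1 = 1 := hf.integral_eq_one

theorem cdf_sub (hf : DensityBounds f c₀ C₀ C₁) {s t : ℝ} (hs : s ∈ Icc (0 : ℝ) 1)
    (ht : t ∈ Icc (0 : ℝ) 1) : designCDF f t - designCDF f s = ∫ u in s..t, f u := by
  have h0 : (0 : ℝ) ∈ Icc (0 : ℝ) 1 := by simp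
  exact intervalIntegral.integral_interval_sub_left (hf.intervalIntegrable h0 ht)
    (hf.intervalIntegrable h0 hs)

theorem le_cdf_sub (hf : DensityBounds f c₀ C₀ C₁) {s t : ℝ} (hs : s ∈ Icc (0 : ℝ) 1)
    (ht : t ∈ Icc (0 : ℝ) 1) (hst : s ≤ t) : c₀ * (t - s) ≤ designCDF f t - designCDF f s := by
  rw [hf.cdf_sub hs ht]
  have := intervalIntegral.integral_mono_on (f := fun _ => c₀) (g := f) hst
    (by simp) (hf.intervalIntegrable hs ht)
    (fun u hu => hf.lower u ⟨hs.1.trans hu.1, hu.2.trans ht.2⟩)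
  simpa [mul_comm] using this

theorem cdf_sub_le (hf : DensityBounds f c₀ C₀ C₁) {s t : ℝ} (hs : s ∈ Icc (0 : ℝ) 1)
    (ht : t ∈ Icc (0 : ℝ) 1) (hst : s ≤ t) : designCDF f t - designCDF f s ≤ C₀ * (t - s) := by
  rw [hf.cdf_sub hs ht]
  have := intervalIntegral.integral_mono_on (f := f) (g := fun _ => C₀) hst
    (hf.intervalIntegrable hs ht) (by simp)
    (fun u hu => hf.upper u ⟨hs.1.trans hu.1, hu.2.trans ht.2⟩)
  simpa [mul_comm] using this

theorem abs_cdf_sub (hf : DensityBounds f c₀ C₀ C₁) {s t : ℝ} (hs : s ∈ Icc (0 : ℝ) 1)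
    (ht : t ∈ Icc (0 : ℝ) 1) : c₀ * |t - s| ≤ |designCDF f t - designCDF f s| ∧
      |designCDF f t - designCDF f s| ≤ C₀ * |t - s| := by
  have hc := hf.pos
  rcases le_total s t with h | h
  · have h1 := hf.le_cdf_sub hs ht h
    have h2 := hf.cdf_sub_le hs ht h
    have h3 : 0 ≤ c₀ * (t - s) := mul_nonneg hc.le (sub_nonneg.2 h)
    rw [abs_of_nonneg (sub_nonneg.2 h), abs_of_nonneg (h3.trans h1)]
    exact ⟨h1, h2⟩
  · have h1 := hf.le_cdf_sub ht hs h
    have h2 := hf.cdf_sub_le ht hs h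
    have h3 : 0 ≤ c₀ * (s - t) := mul_nonneg hc.le (sub_nonneg.2 h)
    rw [abs_sub_comm t, abs_sub_comm (designCDF f t), abs_of_nonneg (sub_nonneg.2 h),
      abs_of_nonneg (h3.trans h1)]
    exact ⟨h1, h2⟩

theorem strictMonoOn_cdf (hf : DensityBounds f c₀ C₀ C₁) :
    StrictMonoOn (designCDF f) (Icc (0 : ℝ) 1) := by
  intro s hs t ht hst
  have := hf.le_cdf_sub hs ht hst.le
  have h2 : 0 < c₀ * (t - s) := mul_pos hf.pos (sub_pos.2 hst)
  linarith

theorem hasDerivAt_cdf (hf : DensityBounds f c₀ C₀ C₁) {t : ℝ} (ht : t ∈ Ioo (0 : ℝ) 1) :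
    HasDerivAt (designCDF f) (f t) t := by
  have hI := Icc_mem_nhds ht.1 ht.2
  refine intervalIntegral.integral_hasDerivAt_right
    (hf.intervalIntegrable (by simp) (Ioo_subset_Icc_self ht)) ?_ (hf.cont.continuousAt hI)
  exact ⟨Icc 0 1, hI, hf.cont.aestronglyMeasurable measurableSet_Icc⟩

theorem continuousOn_cdf (hf : DensityBounds f c₀ C₀ C₁) :
    ContinuousOn (designCDF f) (Icc (0 : ℝ) 1) := by
  have : LipschitzOnWith ⟨C₀, hf.pos_upper.le⟩ (designCDF f) (Icc (0 : ℝ) 1) :=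
    LipschitzOnWith.of_dist_le_mul fun t ht s hs => by
      rw [Real.dist_eq, Real.dist_eq]; exact (hf.abs_cdf_sub hs ht).2
  exact this.continuousOn

/-- The quantile function inverts the distribution function. -/
theorem quantile_spec (hf : DensityBounds f c₀ C₀ C₁) {p : ℝ} (hp : p ∈ Icc (0 : ℝ) 1) :
    designQuantile f p ∈ Icc (0 : ℝ) 1 ∧ designCDF f (designQuantile f p) = p := by
  have hp' : p ∈ Icc (designCDF f 0) (designCDF f 1) := by rwa [cdf_zero, hf.cdf_one]
  obtain ⟨t, ht, rfl⟩ := intermediate_value_Icc zero_le_one hf.continuousOn_cdf hp'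
  have : IsLeast {s : ℝ | s ∈ Icc (0 : ℝ) 1 ∧ designCDF f t ≤ designCDF f s} t :=
    ⟨⟨ht, le_rfl⟩, fun s hs => (hf.strictMonoOn_cdf.le_iff_le ht hs.1).1 hs.2⟩
  have e : designQuantile f (designCDF f t) = t := this.csInf_eq
  rw [e]
  exact ⟨ht, rfl⟩

theorem designPoint_spec (hf : DensityBounds f c₀ C₀ C₁) {n i : ℕ} (hn : 0 < n) (hi : i ≤ n) :
    designPoint f n i ∈ Icc (0 : ℝ) 1 ∧ designCDF f (designPoint f n i) = (i : ℝ) / n := by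
  refine hf.quantile_spec ⟨by positivity, ?_⟩
  rw [div_le_one (by positivity)]
  exact_mod_cast hi

theorem designPoint_lt (hf : DensityBounds f c₀ C₀ C₁) {n i j : ℕ} (hn : 0 < n) (hj : j ≤ n)
    (hij : i < j) : designPoint f n i < designPoint f n j := by
  obtain ⟨h1, h2⟩ := hf.designPoint_spec hn (hij.le.trans hj)
  obtain ⟨h3, h4⟩ := hf.designPoint_spec hn hj
  rw [← hf.strictMonoOn_cdf.lt_iff_lt h1 h3, h2, h4]
  have : (0 : ℝ) < n := by exact_mod_cast hn
  gcongr

theorem designPoint_succ_sub_le (hf : DensityBounds f c₀ C₀ C₁) {n i : ℕ} (hn : 0 < n)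
    (hi : i < n) : designPoint f n (i + 1) - designPoint f n i ≤ 1 / (c₀ * n) := by
  obtain ⟨h1, h2⟩ := hf.designPoint_spec hn hi.le
  obtain ⟨h3, h4⟩ := hf.designPoint_spec hn (Nat.succ_le_of_lt hi)
  have h5 := hf.le_cdf_sub h1 h3 (hf.designPoint_lt hn hi (Nat.lt_succ_self i)).le
  rw [h2, h4] at h5
  have hc := hf.pos
  have : (0 : ℝ) < n := by exact_mod_cast hn
  rw [le_div_iff₀ (by positivity)]
  push_cast at h5
  rw [← sub_div, add_sub_cancel_left, le_div_iff₀ this] at h5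
  linarith

theorem designPoint_zero (hf : DensityBounds f c₀ C₀ C₁) {n : ℕ} (hn : 0 < n) :
    designPoint f n 0 = 0 := by
  obtain ⟨h1, h2⟩ := hf.designPoint_spec hn (Nat.zero_le n)
  refine hf.strictMonoOn_cdf.injOn h1 (by simp) ?_
  rw [h2, cdf_zero]; simp

theorem designPoint_self (hf : DensityBounds f c₀ C₀ C₁) {n : ℕ} (hn : 0 < n) :
    designPoint f n n = 1 := by
  obtain ⟨h1, h2⟩ := hf.designPoint_spec hn le_rfl
  refine hf.strictMonoOn_cdf.injOn h1 (by simp) ?_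
  have : (n : ℝ) ≠ 0 := by positivity
  rw [h2, hf.cdf_one, div_self this]

end DensityBounds

/-! ### Comparison of the design with the equispaced design tangent to it at `x`. -/

/-- The distance of `t` from `x` measured by the design, in units of the bandwidth. -/
def designScale (f : ℝ → ℝ) (x h t : ℝ) : ℝ := (designCDF f t - designCDF f x) / (h * f x)

/-- The difference of the weight densities of the design and of the equispaced design that is
tangent to it at `x`. -/
def weightDiff (K f : ℝ → ℝ) (x h t : ℝ) : ℝ :=
  1 / h * (K ((t - x) / h) / f t - K (designScale f x h t) / f x)

section Weights

variable {K K₂ f : ℝ → ℝ} {L c₀ C₀ C₁ x h : ℝ}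

/-- Both `|F(t) - F(x)|` and `f(x)|t - x|` lie between `c₀|t - x|` and `C₀|t - x|`, so the two ways
of measuring distance differ by at most the factor `C₀/c₀`. -/
theorem DensityBounds.abs_designScale (hf : DensityBounds f c₀ C₀ C₁) (hx : x ∈ Icc (0 : ℝ) 1)
    (hh : 0 < h) {t : ℝ} (ht : t ∈ Icc (0 : ℝ) 1) :
    |designScale f x h t| ≤ C₀ / c₀ * |(t - x) / h| ∧
      |(t - x) / h| ≤ C₀ / c₀ * |designScale f x h t| := by
  obtain ⟨h1, h2⟩ := hf.abs_cdf_sub hx ht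
  have hb := hf.lower x hx
  have hB := hf.upper x hx
  have hc := hf.pos
  have hb0 := hf.pos_apply hx
  unfold designScale
  rw [abs_div, abs_div, abs_of_pos hh, abs_of_pos (mul_pos hh hb0)]
  constructor
  · rw [div_le_iff₀ (by positivity)]
    calc _ ≤ C₀ * |t - x| := h2
      _ = C₀ * |t - x| / c₀ * c₀ := by field_simp
      _ ≤ C₀ * |t - x| / c₀ * f x := by
        have := hf.pos_upper
        gcongr
      _ = _ := by field_simp
  · rw [div_le_iff₀ hh]
    have h3 : c₀ * |t - x| * f x ≤ |designCDF f t - designCDF f x| * C₀ :=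
      mul_le_mul h1 hB hb0.le (abs_nonneg _)
    rw [show C₀ / c₀ * (|designCDF f t - designCDF f x| / (h * f x)) * h =
      |designCDF f t - designCDF f x| * C₀ / (c₀ * f x) by field_simp, le_div_iff₀ (by positivity)]
    linarith

theorem DensityBounds.one_le_ratio (hf : DensityBounds f c₀ C₀ C₁) : 1 ≤ C₀ / c₀ := by
  rw [le_div_iff₀ hf.pos, one_mul]; exact hf.le_upper

/-- This makes `C₀/c₀` a common cutoff: beyond it the kernel vanishes at both arguments, so the true
and the equispaced weight are both zero. -/
theorem DensityBounds.one_lt_of_ratio_lt (hf : DensityBounds f c₀ C₀ C₁) (hx : x ∈ Icc (0 : ℝ) 1)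
    (hh : 0 < h) {t : ℝ} (ht : t ∈ Icc (0 : ℝ) 1) (hz : C₀ / c₀ < |designScale f x h t|) :
    1 < |designScale f x h t| ∧ 1 < |(t - x) / h| := by
  refine ⟨hf.one_le_ratio.trans_lt hz, ?_⟩
  have h1 := (hf.abs_designScale hx hh ht).1
  have h2 : 0 < C₀ / c₀ := zero_lt_one.trans_le hf.one_le_ratio
  by_contra hcon
  push Not at hcon
  have := mul_le_mul_of_nonneg_left hcon h2.le
  linarith

/-- Below the cutoff `t - x` is `O(h)`. As `f` is Lipschitz, `F(t) - F(x) - f(x)(t - x)` is then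
`O(h²)`, and dividing by `h f(x)` leaves `O(h)`. -/
theorem DensityBounds.abs_sub_le_of_le_ratio (hf : DensityBounds f c₀ C₀ C₁)
    (hx : x ∈ Icc (0 : ℝ) 1) (hh : 0 < h) {t : ℝ} (ht : t ∈ Icc (0 : ℝ) 1)
    (hz : |designScale f x h t| ≤ C₀ / c₀) :
    |t - x| ≤ (C₀ / c₀) ^ 2 * h ∧
      |(t - x) / h - designScale f x h t| ≤ C₁ * (C₀ / c₀) ^ 4 / c₀ * h := by
  have h1 := (hf.abs_designScale hx hh ht).2
  have hc := hf.pos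
  have hC1 := hf.deriv_bound_nonneg
  have hB : 0 < C₀ / c₀ := zero_lt_one.trans_le hf.one_le_ratio
  have hb0 := hf.pos_apply hx
  have h2 : |t - x| ≤ (C₀ / c₀) ^ 2 * h := by
    have := mul_le_mul_of_nonneg_left hz hB.le
    rw [abs_div, abs_of_pos hh, div_le_iff₀ hh] at h1
    nlinarith
  refine ⟨h2, ?_⟩
  have key : |designCDF f t - designCDF f x - f x * (t - x)| ≤ C₁ * |t - x| * |t - x| := by
    have aux : ∀ s u : ℝ, s ∈ Icc (0 : ℝ) 1 → u ∈ Icc (0 : ℝ) 1 → s ≤ u →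
        (∀ w ∈ Icc s u, |w - x| ≤ |t - x|) →
        |designCDF f u - u * f x - (designCDF f s - s * f x)| ≤ C₁ * |t - x| * (u - s) := by
      intro s u hs hu hsu hw
      refine abs_sub_le_of_hasDerivAt_Ioo (φ := fun v => designCDF f v - v * f x)
        (φ' := fun v => f v - f x) hsu
        ((hf.continuousOn_cdf.mono (Icc_subset_Icc hs.1 hu.2)).sub (by fun_prop))
        (fun v hv => ((hf.hasDerivAt_cdf ⟨hs.1.trans_lt hv.1, hv.2.trans_le hu.2⟩).sub
          ((hasDerivAt_id v).mul_const (f x))).congr_deriv (by simp)) (fun v hv => ?_)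
      refine (hf.lip hx ⟨hs.1.trans hv.1.le, hv.2.le.trans hu.2⟩).trans ?_
      exact mul_le_mul_of_nonneg_left (hw v (Ioo_subset_Icc_self hv)) hC1
    rcases le_total x t with hxt | hxt
    · have := aux x t hx ht hxt (fun w hw => by
        rw [abs_of_nonneg (sub_nonneg.2 hxt), abs_of_nonneg (sub_nonneg.2 hw.1)]
        linarith [hw.2])
      rw [abs_of_nonneg (sub_nonneg.2 hxt)] at this ⊢
      rwa [show designCDF f t - designCDF f x - f x * (t - x) =
        designCDF f t - t * f x - (designCDF f x - x * f x) by ring]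
    · have := aux t x ht hx hxt (fun w hw => by
        rw [abs_of_nonpos (sub_nonpos.2 hxt), abs_of_nonpos (sub_nonpos.2 hw.2)]
        linarith [hw.1])
      rw [abs_of_nonpos (sub_nonpos.2 hxt)] at this ⊢
      rw [show designCDF f t - designCDF f x - f x * (t - x) =
        -(designCDF f x - x * f x - (designCDF f t - t * f x)) by ring, abs_neg]
      rwa [show -(t - x) = x - t by ring] at this ⊢
  have e : (t - x) / h - designScale f x h t =
      -(designCDF f t - designCDF f x - f x * (t - x)) / (h * f x) := by
    unfold designScale; field_simp; ring
  rw [e, abs_div, abs_neg, abs_of_pos (mul_pos hh hb0), div_le_iff₀ (mul_pos hh hb0)]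
  have h3 : |t - x| * |t - x| ≤ (C₀ / c₀) ^ 2 * h * ((C₀ / c₀) ^ 2 * h) :=
    mul_le_mul h2 h2 (abs_nonneg _) (by positivity)
  calc _ ≤ C₁ * |t - x| * |t - x| := key
    _ = C₁ * (|t - x| * |t - x|) := by ring
    _ ≤ C₁ * ((C₀ / c₀) ^ 2 * h * ((C₀ / c₀) ^ 2 * h)) := mul_le_mul_of_nonneg_left h3 hC1
    _ = C₁ * (C₀ / c₀) ^ 4 * h ^ 2 / c₀ * c₀ := by
      rw [div_mul_cancel₀ _ hc.ne']; ring
    _ ≤ C₁ * (C₀ / c₀) ^ 4 * h ^ 2 / c₀ * f x :=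
      mul_le_mul_of_nonneg_left (hf.lower x hx) (by positivity)
    _ = _ := by ring

end Weights

section WeightDifference

variable {K K₂ f : ℝ → ℝ} {L c₀ C₀ C₁ x h : ℝ}

theorem weightDiff_eq_zero (hK : KernelBounds K K₂ L) {t : ℝ} (hz : 1 < |designScale f x h t|)
    (hy : 1 < |(t - x) / h|) : weightDiff K f x h t = 0 := by
  unfold weightDiff
  rw [hK.zero _ hz.le, hK.zero _ hy.le]; simp

/-- The prefactor `1/h` is compensated because both the kernel arguments and the values `f t`, `f x`
differ by `O(h)` wherever the kernels do not vanish. -/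
theorem exists_weightDiff_bound (hK : KernelBounds K K₂ L) (hf : DensityBounds f c₀ C₀ C₁)
    (hx : x ∈ Icc (0 : ℝ) 1) : ∃ C, 0 ≤ C ∧ ∀ h, 0 < h → ∀ t ∈ Icc (0 : ℝ) 1,
      |weightDiff K f x h t| ≤ C := by
  have hL := hK.one_le
  have hc := hf.pos
  have hC0 := hf.pos_upper
  have hC1 := hf.deriv_bound_nonneg
  set κ := C₁ * (C₀ / c₀) ^ 4 / c₀ with hκ
  have hκ0 : 0 ≤ κ := by positivity
  refine ⟨L * κ / c₀ + L * (C₁ * (C₀ / c₀) ^ 2) / c₀ ^ 2, by positivity, ?_⟩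
  intro h hh t ht
  rcases lt_or_ge (C₀ / c₀) |designScale f x h t| with hz | hz
  · obtain ⟨h1, h2⟩ := hf.one_lt_of_ratio_lt hx hh ht hz
    rw [weightDiff_eq_zero hK h1 h2, abs_zero]; positivity
  obtain ⟨h1, h2⟩ := hf.abs_sub_le_of_le_ratio hx hh ht hz
  have hft := hf.pos_apply ht
  have hfx := hf.pos_apply hx
  have hlt := hf.lower t ht
  have hlx := hf.lower x hx
  have e : weightDiff K f x h t = 1 / h * ((K ((t - x) / h) - K (designScale f x h t)) / f t +
      K (designScale f x h t) * (f x - f t) / (f t * f x)) := by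
    unfold weightDiff; field_simp; ring
  rw [e, abs_mul, abs_of_pos (by positivity : 0 < 1 / h), one_div_mul_eq_div, div_le_iff₀ hh]
  refine (abs_add_le _ _).trans ?_
  rw [abs_div, abs_div, abs_mul, abs_of_pos hft, abs_of_pos (mul_pos hft hfx), add_mul]
  refine add_le_add ?_ ?_
  · calc _ ≤ L * (κ * h) / c₀ := by
          gcongr
          exact (hK.lip _ _).trans (mul_le_mul_of_nonneg_left h2 (by linarith))
      _ = _ := by ring
  · calc _ ≤ L * (C₁ * ((C₀ / c₀) ^ 2 * h)) / (c₀ * c₀) := by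
          gcongr
          · exact hK.bound _
          · rw [abs_sub_comm]
            exact (hf.lip hx ht).trans (mul_le_mul_of_nonneg_left h1 hC1)
      _ = _ := by ring

/-- The derivative of `weightDiff`. -/
def weightDiffDeriv (K f : ℝ → ℝ) (x h t : ℝ) : ℝ :=
  1 / h * ((deriv K ((t - x) / h) * (1 / h) * f t - K ((t - x) / h) * deriv f t) / f t ^ 2 -
    deriv K (designScale f x h t) * (f t / (h * f x)) / f x)

theorem hasDerivAt_designScale (hf : DensityBounds f c₀ C₀ C₁) {t : ℝ} (ht : t ∈ Ioo (0 : ℝ) 1) :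
    HasDerivAt (designScale f x h) (f t / (h * f x)) t :=
  ((hf.hasDerivAt_cdf ht).sub_const (designCDF f x)).div_const (h * f x)

theorem hasDerivAt_sub_div (x h t : ℝ) : HasDerivAt (fun t => (t - x) / h) (1 / h) t :=
  ((hasDerivAt_id t).sub_const x).div_const h

theorem hasDerivAt_weightDiff (hK : KernelBounds K K₂ L) (hf : DensityBounds f c₀ C₀ C₁)
    {t : ℝ} (ht : t ∈ Ioo (0 : ℝ) 1) :
    HasDerivAt (weightDiff K f x h) (weightDiffDeriv K f x h t) t := by
  have h1 := (hK.diff ((t - x) / h)).comp t (hasDerivAt_sub_div x h t)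
  have h2 := (hK.diff (designScale f x h t)).comp t (hasDerivAt_designScale (x := x) (h := h) hf ht)
  exact ((h1.div (hf.diff t ht) (hf.pos_apply (Ioo_subset_Icc_self ht)).ne').sub
    (h2.div_const (f x))).const_mul (1 / h)

/-- The same cancellation one derivative higher: each separate term is of order `1/h²`, and the
`O(h)` differences leave `1/h`. -/
theorem exists_weightDiffDeriv_bound (hK : KernelBounds K K₂ L) (hf : DensityBounds f c₀ C₀ C₁)
    (hx : x ∈ Icc (0 : ℝ) 1) : ∃ C, 0 ≤ C ∧ ∀ h, 0 < h → ∀ t ∈ Ioo (0 : ℝ) 1,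
      |weightDiffDeriv K f x h t| ≤ C / h := by
  have hL := hK.one_le
  have hc := hf.pos
  have hC0 := hf.pos_upper
  have hC1 := hf.deriv_bound_nonneg
  set κ := C₁ * (C₀ / c₀) ^ 4 / c₀ with hκ
  have hκ0 : 0 ≤ κ := by positivity
  refine ⟨L * κ / c₀ + L * (C₁ * (C₀ / c₀) ^ 2) * (2 * C₀) / c₀ ^ 3 + L * C₁ / c₀ ^ 2,
    by positivity, ?_⟩
  intro h hh t ht'
  have ht := Ioo_subset_Icc_self ht'
  rcases lt_or_ge (C₀ / c₀) |designScale f x h t| with hz | hz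
  · obtain ⟨h1, h2⟩ := hf.one_lt_of_ratio_lt hx hh ht hz
    unfold weightDiffDeriv
    rw [hK.deriv_zero _ h1.le, hK.deriv_zero _ h2.le, hK.zero _ h2.le]
    simp only [zero_mul, zero_div, sub_zero, mul_zero, abs_zero]
    positivity
  obtain ⟨h1, h2⟩ := hf.abs_sub_le_of_le_ratio hx hh ht hz
  have hft := hf.pos_apply ht
  have hfx := hf.pos_apply hx
  have hlt := hf.lower t ht
  have hlx := hf.lower x hx
  have hut := hf.upper t ht
  have hux := hf.upper x hx
  have e : weightDiffDeriv K f x h t = 1 / h ^ 2 * (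
      (deriv K ((t - x) / h) - deriv K (designScale f x h t)) / f t +
      deriv K (designScale f x h t) * (f x - f t) * (f x + f t) / (f t * f x ^ 2) -
      h * (K ((t - x) / h) * deriv f t) / f t ^ 2) := by
    unfold weightDiffDeriv; field_simp; ring
  rw [e, abs_mul, abs_of_pos (by positivity : 0 < 1 / h ^ 2), one_div_mul_eq_div,
    div_le_div_iff₀ (by positivity) hh]
  rw [show ∀ r : ℝ, r * h ^ 2 = (r * h) * h by intro r; ring]
  refine mul_le_mul_of_nonneg_right ?_ hh.le
  refine (abs_sub _ _).trans ?_
  rw [add_mul]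
  refine add_le_add ((abs_add_le _ _).trans ?_) ?_
  · rw [add_mul, abs_div, abs_div, abs_mul, abs_mul, abs_of_pos hft,
      abs_of_pos (mul_pos hft (pow_pos hfx 2)), abs_of_pos (add_pos hfx hft)]
    refine add_le_add ?_ ?_
    · calc _ ≤ L * (κ * h) / c₀ := by
            gcongr
            exact (hK.deriv_lip _ _).trans (mul_le_mul_of_nonneg_left h2 (by linarith))
        _ = _ := by ring
    · calc _ ≤ L * (C₁ * ((C₀ / c₀) ^ 2 * h)) * (C₀ + C₀) / (c₀ * c₀ ^ 2) := by
            gcongr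
            · exact hK.deriv_bound _
            · rw [abs_sub_comm]
              exact (hf.lip hx ht).trans (mul_le_mul_of_nonneg_left h1 hC1)
        _ = _ := by ring
  · rw [abs_div, abs_mul, abs_mul, abs_of_pos hh, abs_of_pos (pow_pos hft 2)]
    calc _ ≤ h * (L * C₁) / c₀ ^ 2 := by
          gcongr
          · exact hK.bound _
          · exact hf.deriv_bound t ht'
      _ = _ := by ring

theorem DensityBounds.designScale_mono (hf : DensityBounds f c₀ C₀ C₁) (hx : x ∈ Icc (0 : ℝ) 1)
    (hh : 0 < h) {s t : ℝ} (hs : s ∈ Icc (0 : ℝ) 1) (ht : t ∈ Icc (0 : ℝ) 1) (hst : s ≤ t) :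
    designScale f x h s ≤ designScale f x h t := by
  have := hf.strictMonoOn_cdf.monotoneOn hs ht hst
  have := hf.pos_apply hx
  unfold designScale
  gcongr

theorem DensityBounds.designScale_designPoint (hf : DensityBounds f c₀ C₀ C₁) {n i : ℕ}
    (hn : 0 < n) (hi : i ≤ n) :
    designScale f x h (designPoint f n i) =
      1 / (n * h * f x) * ((i : ℝ) - n * designCDF f x) := by
  have : (n : ℝ) ≠ 0 := by positivity
  unfold designScale
  rw [(hf.designPoint_spec hn hi).2]
  field_simp

/-- For small bandwidth the design covers the whole support of the kernel in both scales, as the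
Riemann sum and telescoping arguments require. -/
theorem DensityBounds.designScale_endpoints (hf : DensityBounds f c₀ C₀ C₁)
    (hx : x ∈ Icc (0 : ℝ) 1) (hh : 0 < h) (hlo : C₀ / c₀ * h ≤ x) (hhi : C₀ / c₀ * h ≤ 1 - x) :
    (designScale f x h 0 ≤ -1 ∧ (0 - x) / h ≤ -1) ∧
      (1 ≤ designScale f x h 1 ∧ 1 ≤ (1 - x) / h) := by
  have hB := hf.one_le_ratio
  have hc := hf.pos
  have hfx := hf.pos_apply hx
  have hux := hf.upper x hx
  have h0 : (0 : ℝ) ∈ Icc (0 : ℝ) 1 := by simp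
  have h1 : (1 : ℝ) ∈ Icc (0 : ℝ) 1 := by simp
  have hh1 : h ≤ C₀ / c₀ * h := le_mul_of_one_le_left hh.le hB
  have hq : ∀ r : ℝ, C₀ / c₀ * h ≤ r → h * f x ≤ c₀ * r := by
    intro r hr
    calc h * f x ≤ h * C₀ := mul_le_mul_of_nonneg_left hux hh.le
      _ = c₀ * (C₀ / c₀ * h) := by field_simp
      _ ≤ _ := mul_le_mul_of_nonneg_left hr hc.le
  refine ⟨⟨?_, ?_⟩, ?_, ?_⟩
  · unfold designScale
    rw [div_le_iff₀ (mul_pos hh hfx)]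
    have := hf.le_cdf_sub h0 hx hx.1
    linarith [hq x hlo]
  · rw [div_le_iff₀ hh]; linarith
  · unfold designScale
    rw [le_div_iff₀ (mul_pos hh hfx)]
    have := hf.le_cdf_sub hx h1 hx.2
    linarith [hq _ hhi]
  · rw [le_div_iff₀ hh]; linarith

/-- The total masses of the two families of weights agree up to `O(1/n)`. -/
theorem exists_sum_weightDiff_bound (hK : KernelBounds K K₂ L)
    (hK1 : ∫ u in (-1 : ℝ)..1, K u = 1) (hf : DensityBounds f c₀ C₀ C₁)
    (hx : x ∈ Icc (0 : ℝ) 1) : ∃ C, 0 ≤ C ∧ ∀ (h : ℝ) (n : ℕ), 0 < h → 0 < n →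
      C₀ / c₀ * h ≤ x → C₀ / c₀ * h ≤ 1 - x → 1 / (n * h * f x) ≤ 1 →
      |∑ i ∈ Finset.range n, weightDiff K f x h (designPoint f n i) / n| ≤ C / n := by
  obtain ⟨C, hC, hbound⟩ := exists_weightDiffDeriv_bound hK hf hx
  have hfx := hf.pos_apply hx
  have hc := hf.pos
  have hB := hf.one_le_ratio
  set B := C₀ / c₀ with hBdef
  refine ⟨C / c₀ * (f x * (2 * (B + 1) + 1)), by positivity, ?_⟩
  intro h n hh hn hlo hhi ha1
  have hn' : (0 : ℝ) < n := by exact_mod_cast hn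
  set a := 1 / (n * h * f x) with ha
  have ha0 : 0 < a := by positivity
  set t : ℕ → ℝ := designPoint f n with ht
  -- `E` is a primitive of `f` times `weightDiff`. It takes the value `0` at both ends of `[0,1]`,
  -- since both kernels have total mass one, so its increments sum to zero.
  set E : ℝ → ℝ := fun s => kernelCDF K ((s - x) / h) - kernelCDF K (designScale f x h s) with hE
  have htm : ∀ i ≤ n, t i ∈ Icc (0 : ℝ) 1 := fun i hi => (hf.designPoint_spec hn hi).1
  have hz : ∀ i ≤ n, designScale f x h (t i) = a * ((i : ℝ) - n * designCDF f x) := fun i hi =>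
    hf.designScale_designPoint hn hi
  have htel : ∑ i ∈ Finset.range n, (E (t (i + 1)) - E (t i)) = 0 := by
    rw [Finset.sum_range_sub (fun i => E (t i))]
    obtain ⟨⟨e1, e2⟩, e3, e4⟩ := hf.designScale_endpoints hx hh hlo hhi
    simp only [ht, hE, hf.designPoint_zero hn, hf.designPoint_self hn]
    rw [hK.cdf_of_ge hK1 e3, hK.cdf_of_ge hK1 e4, hK.cdf_of_le e1, hK.cdf_of_le e2]
    simp
  have hdS : ContinuousOn (designScale f x h) (Icc (0 : ℝ) 1) :=
    (hf.continuousOn_cdf.sub continuousOn_const).div_const _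
  have hMc : Continuous (kernelCDF K) :=
    continuous_iff_continuousAt.2 fun u => (hK.hasDerivAt_cdf u).continuousAt
  have hEc : ContinuousOn E (Icc (0 : ℝ) 1) :=
    (hMc.comp_continuousOn (by fun_prop)).sub (hMc.comp_continuousOn hdS)
  have hDc : ContinuousOn (weightDiff K f x h) (Icc (0 : ℝ) 1) :=
    (((hK.continuous.comp_continuousOn (by fun_prop)).div hf.cont
      fun s hs => (hf.pos_apply hs).ne').sub
      ((hK.continuous.comp_continuousOn hdS).div_const _)).const_smul (1 / h)
  have hEd : ∀ s ∈ Ioo (0 : ℝ) 1, HasDerivAt E (f s * weightDiff K f x h s) s := by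
    intro s hs
    have h1 := (hK.hasDerivAt_cdf ((s - x) / h)).comp s (hasDerivAt_sub_div x h s)
    have h2 := (hK.hasDerivAt_cdf (designScale f x h s)).comp s
      (hasDerivAt_designScale (x := x) (h := h) hf hs)
    refine (h1.sub h2).congr_deriv ?_
    have := hf.pos_apply (Ioo_subset_Icc_self hs)
    unfold weightDiff
    field_simp
  -- Cauchy's mean value theorem against `F`, whose increments over cells are exactly `1/n`. Each
  -- summand may then be replaced by `weightDiff` at `t i` minus its value at `ξ`, which gains a
  -- factor `1/(nh)` from the derivative bound.
  have hcell : ∀ i < n, ∃ ξ ∈ Ioo (t i) (t (i + 1)),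
      E (t (i + 1)) - E (t i) = weightDiff K f x h ξ / n := by
    intro i hi
    have hlt : t i < t (i + 1) := hf.designPoint_lt hn hi (Nat.lt_succ_self i)
    have m1 := htm i hi.le
    have m2 := htm (i + 1) hi
    obtain ⟨ξ, hξ, he⟩ := exists_ratio_hasDerivAt_eq_ratio_slope E
      (fun s => f s * weightDiff K f x h s) hlt (hEc.mono (Icc_subset_Icc m1.1 m2.2))
      (fun s hs => hEd s ⟨m1.1.trans_lt hs.1, hs.2.trans_le m2.2⟩) (designCDF f) f
      (hf.continuousOn_cdf.mono (Icc_subset_Icc m1.1 m2.2))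
      (fun s hs => hf.hasDerivAt_cdf ⟨m1.1.trans_lt hs.1, hs.2.trans_le m2.2⟩)
    refine ⟨ξ, hξ, ?_⟩
    have hfξ := hf.pos_apply (t := ξ) ⟨m1.1.trans hξ.1.le, hξ.2.le.trans m2.2⟩
    have hF : designCDF f (t (i + 1)) - designCDF f (t i) = 1 / n := by
      simp only [ht]
      rw [(hf.designPoint_spec hn hi.le).2, (hf.designPoint_spec hn (Nat.succ_le_of_lt hi)).2]
      push_cast; ring
    rw [hF] at he
    have he2 : f ξ * (E (t (i + 1)) - E (t i)) = f ξ * (weightDiff K f x h ξ / n) := by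
      rw [mul_comm (f ξ) (E _ - E _), ← he]; ring
    exact mul_left_cancel₀ hfξ.ne' he2
  have hsum : ∑ i ∈ Finset.range n, weightDiff K f x h (t i) / n =
      ∑ i ∈ Finset.range n, (weightDiff K f x h (t i) / n - (E (t (i + 1)) - E (t i))) := by
    rw [Finset.sum_sub_distrib, htel, sub_zero]
  rw [hsum]
  refine (Finset.abs_sum_le_sum_abs _ _).trans ?_
  -- The extra `1` in the radius accounts for `ξ`, whose scale exceeds that of `t i` by at most `a ≤
  -- 1`. There are `O(nh)` relevant cells, each with error `O(1/(n² h))`.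
  refine (sum_abs_grid_le ha0 (n * designCDF f x) 0 (B + 1) (by linarith) n
    (β := C / h * (1 / (c₀ * n)) / n) ?_ ?_ (by positivity)).trans ?_
  · intro i hi _
    obtain ⟨ξ, hξ, he⟩ := hcell i hi
    rw [he, ← sub_div, abs_div, abs_of_pos hn']
    gcongr
    have m1 := htm i hi.le
    have m2 := htm (i + 1) hi
    have hlen : ξ - t i ≤ 1 / (c₀ * n) := by
      have : t (i + 1) - t i ≤ 1 / (c₀ * n) := hf.designPoint_succ_sub_le hn hi
      linarith [hξ.2]
    rw [abs_sub_comm]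
    refine (abs_sub_le_of_hasDerivAt_Ioo hξ.1.le
      (hDc.mono (Icc_subset_Icc m1.1 (hξ.2.le.trans m2.2)))
      (fun u hu => hasDerivAt_weightDiff hK hf
        ⟨m1.1.trans_lt hu.1, (hu.2.trans hξ.2).trans_le m2.2⟩)
      (fun u hu => hbound h hh u
        ⟨m1.1.trans_lt hu.1, (hu.2.trans hξ.2).trans_le m2.2⟩)).trans ?_
    exact mul_le_mul_of_nonneg_left hlen (by positivity)
  · intro i hi hzi
    rw [sub_zero, ← hz i hi.le] at hzi
    obtain ⟨ξ, hξ, he⟩ := hcell i hi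
    have m1 := htm i hi.le
    have m2 := htm (i + 1) hi
    have mξ : ξ ∈ Icc (0 : ℝ) 1 := ⟨m1.1.trans hξ.1.le, hξ.2.le.trans m2.2⟩
    have w1 := hf.designScale_mono hx hh m1 mξ hξ.1.le
    have w2 := hf.designScale_mono hx hh mξ m2 hξ.2.le
    have w3 : designScale f x h (t (i + 1)) = designScale f x h (t i) + a := by
      rw [hz _ hi, hz _ hi.le]; push_cast; ring
    have q1 : B < |designScale f x h (t i)| := by linarith
    have q2 : B < |designScale f x h ξ| := by
      rcases lt_abs.1 hzi with hq | hq
      · exact lt_abs.2 (Or.inl (by linarith))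
      · exact lt_abs.2 (Or.inr (by linarith))
    obtain ⟨u1, u2⟩ := hf.one_lt_of_ratio_lt hx hh m1 q1
    obtain ⟨v1, v2⟩ := hf.one_lt_of_ratio_lt hx hh mξ q2
    rw [he, weightDiff_eq_zero hK u1 u2, weightDiff_eq_zero hK v1 v2]; simp
  · have e1 : 1 / (h * n) = f x * a := by rw [ha]; field_simp
    have e2 : C / h * (1 / (c₀ * n)) / n * (2 * (B + 1) / a + 1) =
        C / c₀ / n * ((1 / (h * n)) * (2 * (B + 1) / a + 1)) := by field_simp
    rw [e2, e1]
    have e3 : f x * a * (2 * (B + 1) / a + 1) = f x * (2 * (B + 1) + a) := by field_simp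
    rw [e3, show C / c₀ * (f x * (2 * (B + 1) + 1)) / n = C / c₀ / n * (f x * (2 * (B + 1) + 1))
      by ring]
    gcongr

end WeightDifference

/-! ### The estimator as a linear statistic and its variance. -/

/-- The weight of a design point in the rectangle rule. -/
def rectWeight (K f : ℝ → ℝ) (n : ℕ) (x h t : ℝ) : ℝ := scaledKernel K x h t / f t / n

/-- The weight of a design point of the window in the trapezoidal rule. -/
def trapWeight (K f : ℝ → ℝ) (n : ℕ) (x h t : ℝ) : ℝ :=
  rectWeight K f n x h t -
    (if t = windowPoint f n x h 0 then rectWeight K f n x h t / 2 else 0) -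
    (if t = windowPoint f n x h ((windowPoints f n x h).card - 1) then
      rectWeight K f n x h t / 2 else 0)

theorem sum_range_getD (q : ℝ → ℝ) (l : List ℝ) :
    ∑ k ∈ Finset.range l.length, q (l.getD k 0) = (l.map q).sum := by
  induction l with
  | nil => simp
  | cons a l ih =>
    rw [List.length_cons, Finset.sum_range_succ', List.map_cons, List.sum_cons, ← ih, add_comm]
    simp

theorem sum_windowPoint (q : ℝ → ℝ) (f : ℝ → ℝ) (n : ℕ) (x h : ℝ) :
    ∑ k ∈ Finset.range (windowPoints f n x h).card, q (windowPoint f n x h k) =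
      ∑ t ∈ windowPoints f n x h, q t := by
  have h1 := sum_range_getD q ((windowPoints f n x h).sort (· ≤ ·))
  rw [Finset.length_sort, ← List.sum_toFinset q (Finset.sort_nodup _ _),
    Finset.sort_toFinset] at h1
  exact h1

theorem windowPoint_mem (f : ℝ → ℝ) (n : ℕ) (x h : ℝ) {k : ℕ}
    (hk : k < (windowPoints f n x h).card) : windowPoint f n x h k ∈ windowPoints f n x h := by
  unfold windowPoint
  rw [List.getD_eq_getElem _ _ (by rwa [Finset.length_sort]), ← Finset.mem_sort (· ≤ ·)]
  exact List.getElem_mem _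

theorem windowPoint_bounds (f : ℝ → ℝ) (n : ℕ) (x h : ℝ) {t : ℝ} (ht : t ∈ windowPoints f n x h) :
    windowPoint f n x h 0 ≤ t ∧ t ≤ windowPoint f n x h ((windowPoints f n x h).card - 1) := by
  have hpos : 0 < (windowPoints f n x h).card := Finset.card_pos.2 ⟨t, ht⟩
  have hlen : 0 < ((windowPoints f n x h).sort (· ≤ ·)).length := by rwa [Finset.length_sort]
  unfold windowPoint
  constructor
  · rw [List.getD_eq_getElem _ _ hlen, Finset.sorted_zero_eq_min']
    exact Finset.min'_le _ _ ht
  · rw [← Finset.length_sort (· ≤ ·), List.getD_eq_getElem _ _ (by omega),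
      Finset.sorted_last_eq_max']
    exact Finset.le_max' _ _ ht

theorem sum_range_add_succ (q : ℕ → ℝ) (N : ℕ) :
    ∑ k ∈ Finset.range N, (q k + q (k + 1)) = 2 * ∑ k ∈ Finset.range (N + 1), q k - q 0 - q N := by
  rw [Finset.sum_add_distrib]
  have h1 := Finset.sum_range_succ q N
  have h2 := Finset.sum_range_succ' q N
  linarith

/-- Each interior point of the window belongs to two cells and each end to one, so the ends lose
half their weight. For a one-point window both halvings hit that point and its weight is zero, in
agreement with the empty sum over cells. -/
theorem trapEstimator_eq_sum {Ω : Type*} (K f g : ℝ → ℝ) (ε : ℕ → ℝ → Ω → ℝ) (n m : ℕ) (h x : ℝ)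
    (ω : Ω) : trapEstimator K f g ε n m h x ω =
      ∑ t ∈ windowPoints f n x h, trapWeight K f n x h t * meanObservation g ε m t ω := by
  set P := windowPoints f n x h with hP
  set q : ℝ → ℝ := fun t => scaledKernel K x h t / f t * meanObservation g ε m t ω with hq
  have hw : ∀ t, rectWeight K f n x h t * meanObservation g ε m t ω = q t / n := fun t => by
    simp only [hq, rectWeight]; ring
  have hsplit : ∀ t, trapWeight K f n x h t * meanObservation g ε m t ω = q t / n -
      (if t = windowPoint f n x h 0 then q t / n / 2 else 0) -
      (if t = windowPoint f n x h (P.card - 1) then q t / n / 2 else 0) := by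
    intro t
    rw [← hw]
    unfold trapWeight
    split_ifs <;> ring
  change 1 / (2 * (n : ℝ)) * ∑ k ∈ Finset.range (P.card - 1),
    (q (windowPoint f n x h k) + q (windowPoint f n x h (k + 1))) = _
  simp only [hsplit]
  -- For an empty window both sides are empty sums, so the truncated `P.card - 1` and the default
  -- value of `windowPoint` are harmless.
  rcases Nat.eq_zero_or_pos P.card with h0 | h0
  · rw [Finset.card_eq_zero.1 h0]; simp
  rw [sum_range_add_succ (fun k => q (windowPoint f n x h k)), Nat.sub_add_cancel h0,
    sum_windowPoint, Finset.sum_sub_distrib, Finset.sum_sub_distrib, Finset.sum_ite_eq',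
    Finset.sum_ite_eq', if_pos (windowPoint_mem f n x h h0),
    if_pos (windowPoint_mem f n x h (Nat.sub_lt h0 one_pos)), ← Finset.sum_div]
  rw [← hP]
  ring

/-- Variance of a linear statistic of the mean observation. -/
theorem IsErrorSequence.variance_sum_mul_meanObservation {Ω : Type*} [MeasurableSpace Ω]
    {μ : Measure Ω} [IsProbabilityMeasure μ] {ε : ℕ → ℝ → Ω → ℝ} {R : ℝ → ℝ → ℝ}
    (hε : IsErrorSequence μ ε R) (g w : ℝ → ℝ) (P : Finset ℝ) (hP : ∀ t ∈ P, t ∈ Icc (0 : ℝ) 1)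
    {m : ℕ} (hm : 1 ≤ m) :
    Var[fun ω => ∑ t ∈ P, w t * meanObservation g ε m t ω; μ] =
      1 / (m : ℝ) * ∑ t ∈ P, ∑ s ∈ P, w t * w s * R t s := by
  have hm0 : (m : ℝ) ≠ 0 := by positivity
  set Z : ℕ → Ω → ℝ := fun j ω => ∑ t ∈ P, w t * ε j t ω with hZ
  have hterm : ∀ j, ∀ t ∈ P, MemLp (fun ω => w t * ε j t ω) 2 μ := fun j t ht =>
    (hε.memLp j t (hP t ht)).const_mul (w t)
  have hZL : ∀ j, MemLp (Z j) 2 μ := fun j => memLp_finsetSum _ (hterm j)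
  have hZvar : ∀ j, Var[Z j; μ] = ∑ t ∈ P, ∑ s ∈ P, w t * w s * R t s := by
    intro j
    rw [variance_fun_sum' (hterm j)]
    refine Finset.sum_congr rfl fun t ht => Finset.sum_congr rfl fun s hs => ?_
    rw [covariance_const_mul_left, covariance_const_mul_right,
      hε.autocov j t (hP t ht) s (hP s hs), mul_assoc]
  have hZind : Set.Pairwise (Finset.range m : Set ℕ) fun i j => Z i ⟂ᵢ[μ] Z j := by
    -- `Z j` is one fixed measurable function of the `j`-th path on `[0,1]`, so independence of the
    -- paths passes to the `Z j`.
    set G : (Icc (0 : ℝ) 1 → ℝ) → ℝ := fun p =>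
      ∑ t ∈ P, w t * (if ht : t ∈ Icc (0 : ℝ) 1 then p ⟨t, ht⟩ else 0) with hG
    have hGm : Measurable G := by
      refine Finset.measurable_sum _ fun t _ => Measurable.const_mul ?_ _
      split_ifs with ht
      · exact measurable_pi_apply _
      · exact measurable_const
    have hcomp := hε.indep.comp (fun _ => G) (fun _ => hGm)
    have hZG : ∀ j, (G ∘ fun (ω : Ω) (t : Icc (0 : ℝ) 1) => ε j t ω) = Z j := by
      intro j
      funext ω
      refine Finset.sum_congr rfl fun t ht => ?_
      rw [dif_pos (hP t ht)]
    intro i _ j _ hij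
    have := hcomp.indepFun hij
    rwa [hZG, hZG] at this
  have heq : (fun ω => ∑ t ∈ P, w t * meanObservation g ε m t ω) =
      fun ω => (∑ t ∈ P, w t * g t) + 1 / (m : ℝ) * (∑ j ∈ Finset.range m, Z j) ω := by
    funext ω
    have h1 : ∀ t, w t * meanObservation g ε m t ω =
        w t * g t + 1 / (m : ℝ) * ∑ j ∈ Finset.range m, w t * ε j t ω := by
      intro t
      simp only [meanObservation, observation, Finset.sum_add_distrib, Finset.sum_const,
        Finset.card_range, nsmul_eq_mul, ← Finset.mul_sum]
      field_simp
    simp only [h1, Finset.sum_add_distrib, Finset.sum_apply, hZ]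
    rw [← Finset.mul_sum, Finset.sum_comm]
  have hsumL : MemLp (∑ j ∈ Finset.range m, Z j) 2 μ := memLp_finsetSum' _ fun j _ => hZL j
  rw [heq, variance_const_add (hsumL.aestronglyMeasurable.const_mul _), variance_const_mul,
    IndepFun.variance_sum (fun j _ => hZL j) hZind]
  simp only [hZvar, Finset.sum_const, Finset.card_range, nsmul_eq_mul]
  field_simp

/-! ### Sums over the window and the weights at its ends. -/

section Window

variable {K K₂ f : ℝ → ℝ} {L c₀ C₀ C₁ x h : ℝ} {n : ℕ}

theorem mem_windowPoints (f : ℝ → ℝ) (n : ℕ) (x h t : ℝ) : t ∈ windowPoints f n x h ↔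
    (∃ i, (1 ≤ i ∧ i ≤ n) ∧ designPoint f n i = t) ∧ x - h ≤ t ∧ t ≤ x + h := by
  unfold windowPoints design
  rw [Finset.mem_filter, Finset.mem_image]
  simp only [Finset.mem_Icc, mem_Icc]

theorem DensityBounds.windowPoints_subset (hf : DensityBounds f c₀ C₀ C₁) (hn : 0 < n) {t : ℝ}
    (ht : t ∈ windowPoints f n x h) : t ∈ Icc (0 : ℝ) 1 ∧ |t - x| ≤ h := by
  obtain ⟨⟨i, hi, rfl⟩, h1, h2⟩ := (mem_windowPoints f n x h t).1 ht
  exact ⟨(hf.designPoint_spec hn hi.2).1, abs_le.2 ⟨by linarith, by linarith⟩⟩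

theorem scaledKernel_eq_of_even (heven : ∀ u, K (-u) = K u)
    (x h t : ℝ) : scaledKernel K x h t = 1 / h * K ((t - x) / h) := by
  unfold scaledKernel
  rw [← heven]
  congr 2
  ring

theorem KernelBounds.rectWeight_eq_zero (hK : KernelBounds K K₂ L) (hh : 0 < h) {t : ℝ}
    (ht : h ≤ |t - x|) : rectWeight K f n x h t = 0 := by
  unfold rectWeight scaledKernel
  rw [hK.zero]
  · simp
  · rw [abs_div, abs_of_pos hh, abs_sub_comm, le_div_iff₀ hh, one_mul]; exact ht

/-- Sums over the window are sums over the whole design. -/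
theorem sum_windowPoints_rectWeight (hK : KernelBounds K K₂ L) (hf : DensityBounds f c₀ C₀ C₁)
    (hn : 0 < n) (hh : 0 < h) (hlo : h ≤ x) (hhi : h ≤ 1 - x) (G : ℝ → ℝ → ℝ)
    (hG : ∀ t, G 0 t = 0) :
    ∑ t ∈ windowPoints f n x h, G (rectWeight K f n x h t) t =
      ∑ i ∈ Finset.range n, G (rectWeight K f n x h (designPoint f n i)) (designPoint f n i) := by
  have hinj : InjOn (designPoint f n) (Finset.Icc 1 n : Finset ℕ) := by
    intro i hi j hj hij
    rw [Finset.mem_coe, Finset.mem_Icc] at hi hj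
    rcases lt_trichotomy i j with h | h | h
    · exact absurd hij (hf.designPoint_lt hn hj.2 h).ne
    · exact h
    · exact absurd hij (hf.designPoint_lt hn hi.2 h).ne'
  have h1 : ∑ t ∈ windowPoints f n x h, G (rectWeight K f n x h t) t =
      ∑ t ∈ design f n, G (rectWeight K f n x h t) t := by
    refine Finset.sum_subset (Finset.filter_subset _ _) fun t ht hnt => ?_
    have hout : ¬(t ∈ Icc (x - h) (x + h)) := fun hmem => hnt (by
      unfold windowPoints; exact Finset.mem_filter.2 ⟨ht, hmem⟩)
    rw [hK.rectWeight_eq_zero hh, hG]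
    by_contra hcon
    push Not at hcon
    rw [abs_lt] at hcon
    exact hout ⟨by linarith, by linarith⟩
  -- The design has indices `1, …, n` and the grid sums `0, …, n-1`. The points `t_0 = 0` and `t_n =
  -- 1` carry no weight, so the shift is free.
  have hz0 : G (rectWeight K f n x h (designPoint f n 0)) (designPoint f n 0) = 0 := by
    rw [hK.rectWeight_eq_zero hh, hG]
    rw [hf.designPoint_zero hn, le_abs]; right; linarith
  have hzn : G (rectWeight K f n x h (designPoint f n n)) (designPoint f n n) = 0 := by
    rw [hK.rectWeight_eq_zero hh, hG]
    rw [hf.designPoint_self hn, le_abs]; left; linarith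
  rw [h1, design, Finset.sum_image hinj]
  set q : ℕ → ℝ := fun i => G (rectWeight K f n x h (designPoint f n i)) (designPoint f n i)
  have h2 : ∑ i ∈ Finset.Icc 1 n, q i = ∑ i ∈ Finset.range n, q (i + 1) := by
    rw [Finset.range_eq_Ico, Finset.sum_Ico_add' q 0 n 1]
    congr 1
  have h3 := Finset.sum_range_succ q n
  have h4 := Finset.sum_range_succ' q n
  have e0 : q 0 = 0 := hz0
  have en : q n = 0 := hzn
  rw [h2]
  linarith

/-- The weights at the ends of the window are small. -/
theorem rectWeight_end_le (hK : KernelBounds K K₂ L) (heven : ∀ u, K (-u) = K u)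
    (hf : DensityBounds f c₀ C₀ C₁) (hn : 0 < n) (hh : 0 < h) (hlo : h < x) (hhi : h < 1 - x)
    {t : ℝ} (ht : t ∈ windowPoints f n x h)
    (hend : (∀ s ∈ windowPoints f n x h, t ≤ s) ∨ (∀ s ∈ windowPoints f n x h, s ≤ t)) :
    |rectWeight K f n x h t| ≤ L / c₀ ^ 3 * (1 / (n * h)) ^ 3 := by
  have hc := hf.pos
  have hL := hK.one_le
  have hn' : (0 : ℝ) < n := by exact_mod_cast hn
  obtain ⟨htI, htx⟩ := hf.windowPoints_subset hn ht
  have hft := hf.pos_apply htI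
  have hlt := hf.lower t htI
  -- The neighbour of an end point on the outer side lies outside the window, so the end is within
  -- one spacing of the edge. There the quadratic smallness of `K` gives `(1/(nh))²`, and the factor
  -- `1/(nh)` of the weight gives the third power.
  have hgap : h - |t - x| ≤ 1 / (c₀ * n) := by
    obtain ⟨⟨i, hi, hit⟩, h1, h2⟩ := (mem_windowPoints f n x h t).1 ht
    rcases hend with hend | hend
    · have hlt' : designPoint f n (i - 1) < designPoint f n i :=
        hf.designPoint_lt hn hi.2 (by omega)
      have hs := hf.designPoint_succ_sub_le (i := i - 1) hn (by omega)
      rw [Nat.sub_add_cancel hi.1] at hs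
      have hout : designPoint f n (i - 1) < x - h := by
        rcases Nat.eq_zero_or_pos (i - 1) with h0 | h0
        · rw [h0, hf.designPoint_zero hn]; linarith
        · by_contra hcon
          push Not at hcon
          have := hend _ ((mem_windowPoints f n x h _).2 ⟨⟨i - 1, ⟨h0, by omega⟩, rfl⟩, hcon,
            by linarith⟩)
          linarith
      linarith [neg_le_abs (t - x)]
    · have hin : i < n := by
        rcases hi.2.lt_or_eq with h0 | h0
        · exact h0
        · rw [h0, hf.designPoint_self hn] at hit; linarith
      have hlt' : designPoint f n i < designPoint f n (i + 1) :=
        hf.designPoint_lt hn hin (Nat.lt_succ_self i)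
      have hs := hf.designPoint_succ_sub_le hn hin
      have hout : x + h < designPoint f n (i + 1) := by
        by_contra hcon
        push Not at hcon
        have := hend _ ((mem_windowPoints f n x h _).2 ⟨⟨i + 1, ⟨by omega, hin⟩, rfl⟩,
          by linarith, hcon⟩)
        linarith
      linarith [le_abs_self (t - x)]
  have hsq := hK.bound_sq ((t - x) / h)
  have hd : 1 - |(t - x) / h| = (h - |t - x|) / h := by
    rw [abs_div, abs_of_pos hh]; field_simp
  rw [hd] at hsq
  have hb : |K ((t - x) / h)| ≤ L * (1 / (c₀ * n) / h) ^ 2 := by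
    refine hsq.trans ?_
    have : 0 ≤ h - |t - x| := by linarith
    gcongr
  unfold rectWeight
  rw [scaledKernel_eq_of_even heven, abs_div, abs_div, abs_mul, abs_of_pos hft, abs_of_pos hn',
    abs_of_pos (by positivity : 0 < 1 / h)]
  calc _ ≤ 1 / h * (L * (1 / (c₀ * n) / h) ^ 2) / c₀ / n := by gcongr
    _ = _ := by field_simp

end Window

/-! ### Stability of weighted sums under changes of weights and points. -/

section Perturbation

variable {ι : Type*} {s : Finset ι} {w k y z : ι → ℝ} {W M δ ρ B : ℝ}

theorem abs_sum_sub_sum_le (hδ : ∑ i ∈ s, |w i - k i| ≤ δ) :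
    |∑ i ∈ s, w i - ∑ i ∈ s, k i| ≤ δ := by
  rw [← Finset.sum_sub_distrib]
  exact (Finset.abs_sum_le_sum_abs _ _).trans hδ

theorem sum_abs_le_of_sum_abs_sub_le (hM : ∑ i ∈ s, |k i| ≤ M)
    (hδ : ∑ i ∈ s, |w i - k i| ≤ δ) : ∑ i ∈ s, |w i| ≤ M + δ := by
  calc ∑ i ∈ s, |w i| ≤ ∑ i ∈ s, (|k i| + |w i - k i|) := Finset.sum_le_sum fun i _ => by
        have := abs_add_le (k i) (w i - k i)
        rwa [add_sub_cancel] at this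
    _ ≤ _ := by rw [Finset.sum_add_distrib]; linarith

/-- Stability of a weighted mean under a perturbation of weights and points. -/
theorem abs_sum_mul_sub_le (hρ : 0 ≤ ρ) (hB : 0 ≤ B) (hW : ∑ i ∈ s, |w i| ≤ W)
    (hδ : ∑ i ∈ s, |w i - k i| ≤ δ)
    (hyz : ∀ i ∈ s, |z i| ≤ B ∧ |y i - z i| ≤ ρ ∨ w i = 0 ∧ k i = 0) :
    |∑ i ∈ s, w i * y i - ∑ i ∈ s, k i * z i| ≤ ρ * W + B * δ := by
  rw [← Finset.sum_sub_distrib]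
  refine (Finset.abs_sum_le_sum_abs _ _).trans ?_
  calc ∑ i ∈ s, |w i * y i - k i * z i| ≤ ∑ i ∈ s, (ρ * |w i| + B * |w i - k i|) := by
        refine Finset.sum_le_sum fun i hi => ?_
        rcases hyz i hi with ⟨h1, h2⟩ | ⟨h1, h2⟩
        · rw [show w i * y i - k i * z i = (y i - z i) * w i + z i * (w i - k i) by ring]
          refine (abs_add_le _ _).trans ?_
          rw [abs_mul, abs_mul]
          gcongr
        · simp [h1, h2]
    _ ≤ _ := by
      rw [Finset.sum_add_distrib, ← Finset.mul_sum, ← Finset.mul_sum]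
      gcongr

/-- Stability of a weighted mean distance under a perturbation of weights and points. -/
theorem abs_sum_sum_abs_sub_le (hρ : 0 ≤ ρ) (hB : 0 ≤ B) (hW : ∑ i ∈ s, |w i| ≤ W)
    (hM : ∑ i ∈ s, |k i| ≤ M) (hδ : ∑ i ∈ s, |w i - k i| ≤ δ)
    (hyz : ∀ i ∈ s, |z i| ≤ B ∧ |y i - z i| ≤ ρ ∨ w i = 0 ∧ k i = 0) :
    |(∑ i ∈ s, ∑ j ∈ s, w i * w j * |y i - y j| - ∑ i ∈ s, ∑ j ∈ s, k i * k j * |z i - z j|)| ≤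
      2 * ρ * (W * W) + 2 * B * (δ * W + M * δ) := by
  have hW0 : 0 ≤ W := (Finset.sum_nonneg fun i _ => abs_nonneg (w i)).trans hW
  have hM0 : 0 ≤ M := (Finset.sum_nonneg fun i _ => abs_nonneg (k i)).trans hM
  have hδ0 : 0 ≤ δ := (Finset.sum_nonneg fun i _ => abs_nonneg (w i - k i)).trans hδ
  rw [← Finset.sum_sub_distrib]
  simp only [← Finset.sum_sub_distrib]
  refine (Finset.abs_sum_le_sum_abs _ _).trans ?_
  refine (Finset.sum_le_sum fun i _ => Finset.abs_sum_le_sum_abs _ _).trans ?_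
  calc ∑ i ∈ s, ∑ j ∈ s, |(w i * w j * |y i - y j| - k i * k j * |z i - z j|)|
      ≤ ∑ i ∈ s, ∑ j ∈ s, (2 * ρ * (|w i| * |w j|) +
          2 * B * (|w i - k i| * |w j| + |k i| * |w j - k j|)) := by
        refine Finset.sum_le_sum fun i hi => Finset.sum_le_sum fun j hj => ?_
        rcases hyz i hi with ⟨h1, h2⟩ | ⟨h1, h2⟩
        · rcases hyz j hj with ⟨h3, h4⟩ | ⟨h3, h4⟩
          · rw [show w i * w j * |y i - y j| - k i * k j * |z i - z j| =
              (|y i - y j| - |z i - z j|) * (w i * w j) +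
              |z i - z j| * ((w i - k i) * w j + k i * (w j - k j)) by ring]
            refine (abs_add_le _ _).trans ?_
            rw [abs_mul, abs_mul, abs_mul, abs_abs]
            have g1 : |(|y i - y j| - |z i - z j|)| ≤ 2 * ρ := by
              refine (abs_abs_sub_abs_le_abs_sub _ _).trans ?_
              rw [show y i - y j - (z i - z j) = (y i - z i) - (y j - z j) by ring]
              exact (abs_sub _ _).trans (by linarith)
            have g2 : |z i - z j| ≤ 2 * B := (abs_sub _ _).trans (by linarith)
            have g3 : |(w i - k i) * w j + k i * (w j - k j)| ≤
                |w i - k i| * |w j| + |k i| * |w j - k j| := by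
              refine (abs_add_le _ _).trans ?_
              rw [abs_mul, abs_mul]
            gcongr
          · simp only [h3, h4, mul_zero, zero_mul, sub_self, abs_zero, add_zero, le_refl]
        · simp only [h1, h2, mul_zero, zero_mul, sub_self, abs_zero, add_zero, le_refl]
    _ = 2 * ρ * ((∑ i ∈ s, |w i|) * ∑ j ∈ s, |w j|) +
        2 * B * ((∑ i ∈ s, |w i - k i|) * (∑ j ∈ s, |w j|) +
          (∑ i ∈ s, |k i|) * ∑ j ∈ s, |w j - k j|) := by
      simp only [Finset.sum_add_distrib, ← Finset.mul_sum, ← Finset.sum_mul]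
    _ ≤ _ := by
      have p1 : 0 ≤ ∑ i ∈ s, |w i| := Finset.sum_nonneg fun i _ => abs_nonneg _
      have p2 : 0 ≤ ∑ i ∈ s, |w i - k i| := Finset.sum_nonneg fun i _ => abs_nonneg _
      gcongr

end Perturbation

/-! ### Moments of the rectangle and trapezoidal weights. -/

section Moments

variable {K K₂ f : ℝ → ℝ} {L c₀ C₀ C₁ x : ℝ}

theorem sum_abs_trapWeight_sub_le (hK : KernelBounds K K₂ L) (heven : ∀ u, K (-u) = K u)
    (hf : DensityBounds f c₀ C₀ C₁) {n : ℕ} {h : ℝ} (hn : 0 < n) (hh : 0 < h) (hlo : h < x)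
    (hhi : h < 1 - x) :
    ∑ t ∈ windowPoints f n x h, |trapWeight K f n x h t - rectWeight K f n x h t| ≤
      L / c₀ ^ 3 * (1 / (n * h)) ^ 3 := by
  have hc := hf.pos
  have hL := hK.one_le
  set P := windowPoints f n x h with hP
  set β := L / c₀ ^ 3 * (1 / (n * h)) ^ 3
  have hβ : 0 ≤ β := by positivity
  rcases Nat.eq_zero_or_pos P.card with h0 | h0
  · rw [Finset.card_eq_zero.1 h0]; simpa using hβ
  have m1 := windowPoint_mem f n x h h0
  have m2 := windowPoint_mem f n x h (Nat.sub_lt h0 one_pos)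
  have e1 := rectWeight_end_le hK heven hf hn hh hlo hhi m1
    (Or.inl fun s hs => (windowPoint_bounds f n x h hs).1)
  have e2 := rectWeight_end_le hK heven hf hn hh hlo hhi m2
    (Or.inr fun s hs => (windowPoint_bounds f n x h hs).2)
  calc ∑ t ∈ P, |trapWeight K f n x h t - rectWeight K f n x h t|
      ≤ ∑ t ∈ P, ((if t = windowPoint f n x h 0 then |rectWeight K f n x h t| / 2 else 0) +
          (if t = windowPoint f n x h (P.card - 1) then |rectWeight K f n x h t| / 2 else 0)) := by
        refine Finset.sum_le_sum fun t _ => ?_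
        unfold trapWeight
        rw [show ∀ p q r : ℝ, p - q - r - p = -(q + r) by intros; ring, abs_neg]
        refine (abs_add_le _ _).trans (le_of_eq ?_)
        congr 1 <;> split_ifs <;> simp [abs_div]
    _ ≤ β := by
        rw [Finset.sum_add_distrib, Finset.sum_ite_eq', Finset.sum_ite_eq', if_pos m1, if_pos m2]
        linarith

/-- The moments of the weights of the rectangle rule. -/
theorem exists_rectWeight_moments (hK : KernelBounds K K₂ L) (heven : ∀ u, K (-u) = K u)
    (hK1 : ∫ u in (-1 : ℝ)..1, K u = 1) (hf : DensityBounds f c₀ C₀ C₁)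
    (hx : x ∈ Icc (0 : ℝ) 1) : ∃ C, 0 ≤ C ∧ ∀ (h : ℝ) (n : ℕ), 0 < h → h ≤ 1 → 0 < n →
      C₀ / c₀ * h < x → C₀ / c₀ * h < 1 - x → 1 / (n * h * f x) ≤ 1 →
      |∑ t ∈ windowPoints f n x h, rectWeight K f n x h t - 1| ≤
        C * (1 / (n * h * f x) * h + (1 / (n * h * f x)) ^ 3) ∧
      ∑ t ∈ windowPoints f n x h, |rectWeight K f n x h t| ≤ C ∧
      |∑ t ∈ windowPoints f n x h, rectWeight K f n x h t * ((t - x) / h)| ≤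
        C * (1 / (n * h * f x) + h) ∧
      |∑ t ∈ windowPoints f n x h, ∑ s ∈ windowPoints f n x h,
        rectWeight K f n x h t * rectWeight K f n x h s * |(t - x) / h - (s - x) / h| -
          kernelC K| ≤ C * (1 / (n * h * f x) + h) := by
  have hL := hK.one_le
  have hc := hf.pos
  have hC1 := hf.deriv_bound_nonneg
  have hb := hf.pos_apply hx
  have hB1 := hf.one_le_ratio
  set b := f x with hbdef
  set B := C₀ / c₀ with hBdef
  have hB : 0 < B := by linarith
  obtain ⟨Cd, hCd, hD⟩ := exists_weightDiff_bound hK hf hx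
  obtain ⟨Cs, hCs, hS⟩ := exists_sum_weightDiff_bound hK hK1 hf hx
  set κ := C₁ * B ^ 4 / c₀ with hκ
  have hκ0 : 0 ≤ κ := by positivity
  -- `Q h` will bound the total variation between the true and the equispaced weights; `3 L` and `M`
  -- will bound the absolute masses of the equispaced and of the true weights.
  set Q := Cd * b * (2 * B + 1) with hQ
  have hQ0 : 0 ≤ Q := by positivity
  set M := 3 * L + Q with hM
  have hM0 : 0 ≤ M := by positivity
  set T₁ := Cs * b + 15 * L with hT1
  set T₃ := κ * M + B * Q + 10 * L with hT3
  set T₄ := 2 * κ * (M * M) + 2 * B * (Q * M + 3 * L * Q) + 120 * L ^ 2 with hT4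
  have hT1' : 0 ≤ T₁ := by positivity
  have hT3' : 0 ≤ T₃ := by positivity
  have hT4' : 0 ≤ T₄ := by positivity
  refine ⟨T₁ + M + T₃ + T₄, by positivity, ?_⟩
  intro h n hh hh1 hn hlo hhi ha1
  have hn' : (0 : ℝ) < n := by exact_mod_cast hn
  set a := 1 / (n * h * b) with ha
  have ha0 : 0 < a := by positivity
  -- Turns any error `O(1/n)` into `O(ah)`.
  have han : 1 / (n : ℝ) = b * a * h := by rw [ha]; field_simp
  have hhB : h ≤ B * h := le_mul_of_one_le_left hh.le hB1
  have hlo' : h < x := by linarith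
  have hhi' : h < 1 - x := by linarith
  set P := windowPoints f n x h with hP
  set c := n * designCDF f x with hcdef
  set t : ℕ → ℝ := designPoint f n with ht
  set z : ℕ → ℝ := fun i => a * ((i : ℝ) - c) with hz
  set y : ℕ → ℝ := fun i => (t i - x) / h with hy
  set w : ℕ → ℝ := fun i => rectWeight K f n x h (t i) with hw
  set k : ℕ → ℝ := fun i => a * K (z i) with hk
  have hzt : ∀ i < n, designScale f x h (t i) = z i := fun i hi =>
    hf.designScale_designPoint hn hi.le
  have htI : ∀ i < n, t i ∈ Icc (0 : ℝ) 1 := fun i hi => (hf.designPoint_spec hn hi.le).1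
  obtain ⟨⟨hz0, -⟩, hz1, -⟩ := hf.designScale_endpoints hx hh hlo.le hhi.le
  have hac : 1 ≤ a * c := by
    have := hf.designScale_designPoint (x := x) (h := h) hn (Nat.zero_le n)
    rw [hf.designPoint_zero hn] at this
    rw [this] at hz0
    push_cast at hz0
    linarith
  have han1 : 1 ≤ a * ((n : ℝ) - c) := by
    have := hf.designScale_designPoint (x := x) (h := h) hn le_rfl
    rw [hf.designPoint_self hn] at this
    rwa [this] at hz1
  have hwk : ∀ i < n, w i - k i = weightDiff K f x h (t i) / n := by
    intro i hi
    simp only [hw, hk, rectWeight]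
    rw [scaledKernel_eq_of_even heven, weightDiff, hzt i hi, ha, ← hbdef]
    have := hf.pos_apply (htI i hi)
    field_simp
  -- Up to the cutoff `B` the two scales differ by `O(h)`; beyond it both weights vanish and the
  -- location of the points is irrelevant.
  have hrel : ∀ i ∈ Finset.range n, |z i| ≤ B ∧ |y i - z i| ≤ κ * h ∨ w i = 0 ∧ k i = 0 := by
    intro i hi
    rw [Finset.mem_range] at hi
    rcases lt_or_ge B |z i| with hzB | hzB
    · right
      rw [← hzt i hi] at hzB
      obtain ⟨h1, h2⟩ := hf.one_lt_of_ratio_lt hx hh (htI i hi) hzB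
      rw [hzt i hi] at h1
      refine ⟨?_, ?_⟩
      · simp only [hw, rectWeight]
        rw [scaledKernel_eq_of_even heven, hK.zero _ h2.le]; simp
      · simp only [hk]; rw [hK.zero _ h1.le, mul_zero]
    · left
      have := (hf.abs_sub_le_of_le_ratio hx hh (htI i hi) (by rwa [hzt i hi])).2
      rw [hzt i hi] at this
      exact ⟨hzB, this⟩
  have hδ : ∑ i ∈ Finset.range n, |w i - k i| ≤ Q * h := by
    refine (sum_abs_grid_le ha0 c 0 B hB.le n (β := Cd * (b * a * h)) ?_ ?_
      (by positivity)).trans ?_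
    · intro i hi _
      rw [hwk i hi, ← han, abs_div, abs_of_pos hn', div_eq_mul_one_div]
      gcongr
      exact hD h hh (t i) (htI i hi)
    · intro i hi hzi
      rw [sub_zero] at hzi
      rcases hrel i (Finset.mem_range.2 hi) with ⟨h1, -⟩ | ⟨h1, h2⟩
      · exact absurd h1 (not_le.2 hzi)
      · rw [h1, h2, sub_zero]
    · have : Cd * (b * a * h) * (2 * B / a + 1) = Cd * b * h * (2 * B + a) := by
        field_simp
      rw [this, hQ, show Cd * b * (2 * B + 1) * h = Cd * b * h * (2 * B + 1) by ring]
      gcongr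
  have hk3 : ∑ i ∈ Finset.range n, |k i| ≤ 3 * L := by
    refine (sum_abs_grid_le ha0 c 0 1 zero_le_one n (β := a * L) ?_ ?_ (by positivity)).trans ?_
    · intro i _ _
      simp only [hk]
      rw [abs_mul, abs_of_pos ha0]
      exact mul_le_mul_of_nonneg_left (hK.bound _) ha0.le
    · intro i _ hzi
      rw [sub_zero] at hzi
      simp only [hk]
      rw [hK.zero _ hzi.le, mul_zero]
    · have : a * L * (2 * 1 / a + 1) = L * (2 + a) := by field_simp
      rw [this, mul_comm]
      exact mul_le_mul_of_nonneg_right (by linarith) (by linarith)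
  have hwM : ∑ i ∈ Finset.range n, |w i| ≤ M :=
    (sum_abs_le_of_sum_abs_sub_le hk3 hδ).trans (by
      rw [hM]
      have := mul_le_mul_of_nonneg_left hh1 hQ0
      linarith)
  -- The total variation bound `Q h` would be too weak here, since the mass is multiplied by
  -- `R(x,x)` and must be known to `o(h)` apart from `a³`. The signed sum of the weight differences
  -- is `O(1/n)`.
  have hw1 : |∑ i ∈ Finset.range n, w i - 1| ≤ Cs * b * (a * h) + 15 * L * a ^ 3 := by
    have h1 := hS h n hh hn hlo.le hhi.le ha1
    have h2 := hK.abs_sum_sub_one_le hK1 ha0 ha1 hac han1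
    have h3 : ∑ i ∈ Finset.range n, weightDiff K f x h (t i) / n =
        ∑ i ∈ Finset.range n, w i - ∑ i ∈ Finset.range n, k i := by
      rw [← Finset.sum_sub_distrib]
      exact Finset.sum_congr rfl fun i hi => (hwk i (Finset.mem_range.1 hi)).symm
    rw [h3, div_eq_mul_one_div, han, show Cs * (b * a * h) = Cs * b * (a * h) by ring] at h1
    have h4 : |∑ i ∈ Finset.range n, k i - 1| ≤ 15 * L * a ^ 3 := h2
    have := abs_add_le (∑ i ∈ Finset.range n, w i - ∑ i ∈ Finset.range n, k i)
      (∑ i ∈ Finset.range n, k i - 1)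
    rw [sub_add_sub_cancel] at this
    exact this.trans (add_le_add h1 h4)
  have hw3 : |∑ i ∈ Finset.range n, w i * y i| ≤ κ * h * M + B * (Q * h) + 10 * L * a := by
    have h1 := abs_sum_mul_sub_le (by positivity) hB.le hwM hδ hrel
    have h2 := hK.abs_sum_mul_le heven ha0 ha1 hac han1
    have h3 : ∑ i ∈ Finset.range n, k i * z i =
        ∑ i ∈ Finset.range n, a * (K (a * ((i : ℝ) - c)) * (a * ((i : ℝ) - c))) :=
      Finset.sum_congr rfl fun i _ => mul_assoc _ _ _
    rw [← h3] at h2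
    have := abs_add_le (∑ i ∈ Finset.range n, w i * y i - ∑ i ∈ Finset.range n, k i * z i)
      (∑ i ∈ Finset.range n, k i * z i)
    rw [sub_add_cancel] at this
    exact this.trans (add_le_add h1 h2)
  have hw4 : |∑ i ∈ Finset.range n, ∑ j ∈ Finset.range n, w i * w j * |y i - y j| - kernelC K| ≤
      2 * (κ * h) * (M * M) + 2 * B * (Q * h * M + 3 * L * (Q * h)) + 120 * L ^ 2 * a := by
    have h1 := abs_sum_sum_abs_sub_le (by positivity) hB.le hwM hk3 hδ hrel
    have h2 := hK.abs_sum_abs_sub_le ha0 ha1 hac han1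
    rw [Finset.sum_comm] at h2
    have h3 : |∑ i ∈ Finset.range n, ∑ j ∈ Finset.range n, k i * k j * |z i - z j| - kernelC K| ≤
      120 * L ^ 2 * a := h2
    have := abs_add_le (∑ i ∈ Finset.range n, ∑ j ∈ Finset.range n, w i * w j * |y i - y j| -
      ∑ i ∈ Finset.range n, ∑ j ∈ Finset.range n, k i * k j * |z i - z j|)
      (∑ i ∈ Finset.range n, ∑ j ∈ Finset.range n, k i * k j * |z i - z j| - kernelC K)
    rw [sub_add_sub_cancel] at this
    exact this.trans (add_le_add h1 h3)
  have tr := sum_windowPoints_rectWeight hK hf hn hh hlo'.le hhi'.le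
  have tr0 : ∑ r ∈ P, rectWeight K f n x h r = ∑ i ∈ Finset.range n, w i :=
    tr (fun v _ => v) (fun _ => rfl)
  have tr1 : ∑ r ∈ P, |rectWeight K f n x h r| = ∑ i ∈ Finset.range n, |w i| :=
    tr (fun v _ => |v|) (fun _ => abs_zero)
  have tr2 : ∑ r ∈ P, rectWeight K f n x h r * ((r - x) / h) =
      ∑ i ∈ Finset.range n, w i * y i := tr (fun v r => v * ((r - x) / h)) (fun _ => zero_mul _)
  have tr3 : ∑ r ∈ P, ∑ s ∈ P, rectWeight K f n x h r * rectWeight K f n x h s *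
      |(r - x) / h - (s - x) / h| =
      ∑ i ∈ Finset.range n, ∑ j ∈ Finset.range n, w i * w j * |y i - y j| := by
    rw [tr (fun v r => ∑ s ∈ P, v * rectWeight K f n x h s * |(r - x) / h - (s - x) / h|)
      (fun _ => by simp)]
    refine Finset.sum_congr rfl fun i _ => ?_
    exact tr (fun v s => rectWeight K f n x h (designPoint f n i) * v *
      |(designPoint f n i - x) / h - (s - x) / h|) (fun _ => by simp)
  rw [tr0, tr1, tr2, tr3]
  refine ⟨hw1.trans ?_, hwM.trans (by linarith only [hT1', hT3', hT4']), hw3.trans ?_,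
    hw4.trans ?_⟩
  · calc _ ≤ T₁ * (a * h + a ^ 3) := by
          rw [hT1]
          have p1 : 0 ≤ Cs * b * a ^ 3 := by positivity
          have p2 : 0 ≤ 15 * L * (a * h) := by positivity
          linarith only [p1, p2]
      _ ≤ _ := mul_le_mul_of_nonneg_right (by linarith only [hM0, hT3', hT4']) (by positivity)
  · calc _ ≤ T₃ * (a + h) := by
          rw [hT3]
          have p1 : 0 ≤ (κ * M + B * Q) * a := by positivity
          have p2 : 0 ≤ 10 * L * h := by positivity
          linarith only [p1, p2]
      _ ≤ _ := mul_le_mul_of_nonneg_right (by linarith only [hM0, hT1', hT4']) (by positivity)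
  · calc _ ≤ T₄ * (a + h) := by
          rw [hT4]
          have p1 : 0 ≤ (2 * κ * (M * M) + 2 * B * (Q * M + 3 * L * Q)) * a := by positivity
          have p2 : 0 ≤ 120 * L ^ 2 * h := by positivity
          linarith only [p1, p2]
      _ ≤ _ := mul_le_mul_of_nonneg_right (by linarith only [hM0, hT1', hT3']) (by positivity)

/-- The moments of the trapezoidal weights. -/
theorem exists_trapWeight_moments (hK : KernelBounds K K₂ L) (heven : ∀ u, K (-u) = K u)
    (hK1 : ∫ u in (-1 : ℝ)..1, K u = 1) (hf : DensityBounds f c₀ C₀ C₁)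
    (hx : x ∈ Icc (0 : ℝ) 1) : ∃ C, 0 ≤ C ∧ ∀ (h : ℝ) (n : ℕ), 0 < h → h ≤ 1 → 0 < n →
      C₀ / c₀ * h < x → C₀ / c₀ * h < 1 - x → 1 / (n * h * f x) ≤ 1 →
      |∑ t ∈ windowPoints f n x h, trapWeight K f n x h t - 1| ≤
        C * (1 / (n * h * f x) * h + (1 / (n * h * f x)) ^ 3) ∧
      ∑ t ∈ windowPoints f n x h, |trapWeight K f n x h t| ≤ C ∧
      |∑ t ∈ windowPoints f n x h, trapWeight K f n x h t * (t - x)| ≤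
        C * (h * (1 / (n * h * f x) + h)) ∧
      |∑ t ∈ windowPoints f n x h, ∑ s ∈ windowPoints f n x h,
        trapWeight K f n x h t * trapWeight K f n x h s * |t - s| - h * kernelC K| ≤
        C * (h * (1 / (n * h * f x) + h)) := by
  have hL := hK.one_le
  have hc := hf.pos
  have hb := hf.pos_apply hx
  have hB1 := hf.one_le_ratio
  obtain ⟨M, hM0, hM⟩ := exists_rectWeight_moments hK heven hK1 hf hx
  set b := f x with hbdef
  set G := L / c₀ ^ 3 * b ^ 3 with hG
  have hG0 : 0 ≤ G := by positivity
  set N := M + G with hN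
  have hN0 : 0 ≤ N := by positivity
  set T := 2 * (G * N + M * G) with hT
  have hT0 : 0 ≤ T := by positivity
  refine ⟨N + T, by positivity, ?_⟩
  intro h n hh hh1 hn hlo hhi ha1
  obtain ⟨hw1, hwM, hw3, hw4⟩ := hM h n hh hh1 hn hlo hhi ha1
  have hn' : (0 : ℝ) < n := by exact_mod_cast hn
  set a := 1 / (n * h * b) with ha
  have ha0 : 0 < a := by positivity
  have hhB : h ≤ C₀ / c₀ * h := le_mul_of_one_le_left hh.le hB1
  have hlo' : h < x := hhB.trans_lt hlo
  have hhi' : h < 1 - x := hhB.trans_lt hhi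
  set P := windowPoints f n x h with hP
  set p : ℝ → ℝ := rectWeight K f n x h with hp
  set q : ℝ → ℝ := trapWeight K f n x h with hq
  have hend : ∑ r ∈ P, |q r - p r| ≤ G * a ^ 3 := by
    have := sum_abs_trapWeight_sub_le hK heven hf hn hh hlo' hhi'
    refine this.trans (le_of_eq ?_)
    rw [hG, ha]; field_simp
  -- Only the weights change here, so the perturbation estimates are applied with identical points,
  -- `ρ = 0` and `B = 1`.
  have hwin : ∀ r ∈ P, |(r - x) / h| ≤ 1 ∧ |(r - x) / h - (r - x) / h| ≤ 0 ∨ q r = 0 ∧ p r = 0 := by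
    intro r hr
    left
    refine ⟨?_, by simp⟩
    rw [abs_div, abs_of_pos hh, div_le_one hh]
    exact (hf.windowPoints_subset hn hr).2
  have ha3 : a ^ 3 ≤ a := by
    have : a ^ 2 ≤ 1 := pow_le_one₀ ha0.le ha1
    calc a ^ 3 = a ^ 2 * a := by ring
      _ ≤ 1 * a := by gcongr
      _ = a := one_mul a
  have hGa : G * a ^ 3 ≤ G * a := mul_le_mul_of_nonneg_left ha3 hG0
  have hGa1 : G * a ≤ G := mul_le_of_le_one_right hG0 ha1
  have hqN : ∑ r ∈ P, |q r| ≤ N :=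
    (sum_abs_le_of_sum_abs_sub_le hwM hend).trans (by rw [hN]; linarith only [hGa, hGa1])
  refine ⟨?_, hqN.trans (by linarith only [hT0]), ?_, ?_⟩
  · have h1 := abs_sum_sub_sum_le hend
    have := abs_add_le (∑ r ∈ P, q r - ∑ r ∈ P, p r) (∑ r ∈ P, p r - 1)
    rw [sub_add_sub_cancel] at this
    refine (this.trans (add_le_add h1 hw1)).trans ?_
    have p1 : 0 ≤ T * (a * h + a ^ 3) := by positivity
    have p2 : 0 ≤ G * (a * h) := by positivity
    rw [hN]
    linarith only [p1, p2]
  · have e : ∑ r ∈ P, q r * (r - x) = h * ∑ r ∈ P, q r * ((r - x) / h) := by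
      rw [Finset.mul_sum]
      refine Finset.sum_congr rfl fun r _ => ?_
      field_simp
    rw [e, abs_mul, abs_of_pos hh, mul_left_comm]
    refine mul_le_mul_of_nonneg_left ?_ hh.le
    have h1 := abs_sum_mul_sub_le le_rfl zero_le_one hqN hend hwin
    have := abs_add_le (∑ r ∈ P, q r * ((r - x) / h) - ∑ r ∈ P, p r * ((r - x) / h))
      (∑ r ∈ P, p r * ((r - x) / h))
    rw [sub_add_cancel] at this
    refine (this.trans (add_le_add h1 hw3)).trans ?_
    have p1 : 0 ≤ T * (a + h) := by positivity
    have p2 : 0 ≤ G * h := by positivity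
    rw [hN]
    linarith only [p1, p2, hGa]
  · have e : ∑ r ∈ P, ∑ s ∈ P, q r * q s * |r - s| - h * kernelC K =
        h * (∑ r ∈ P, ∑ s ∈ P, q r * q s * |(r - x) / h - (s - x) / h| - kernelC K) := by
      rw [mul_sub, Finset.mul_sum]
      congr 1
      refine Finset.sum_congr rfl fun r _ => ?_
      rw [Finset.mul_sum]
      refine Finset.sum_congr rfl fun s _ => ?_
      rw [← sub_div, sub_sub_sub_cancel_right, abs_div, abs_of_pos hh]
      field_simp
    rw [e, abs_mul, abs_of_pos hh, mul_left_comm]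
    refine mul_le_mul_of_nonneg_left ?_ hh.le
    have h1 := abs_sum_sum_abs_sub_le le_rfl zero_le_one hqN hwM hend hwin
    have := abs_add_le (∑ r ∈ P, ∑ s ∈ P, q r * q s * |(r - x) / h - (s - x) / h| -
      ∑ r ∈ P, ∑ s ∈ P, p r * p s * |(r - x) / h - (s - x) / h|)
      (∑ r ∈ P, ∑ s ∈ P, p r * p s * |(r - x) / h - (s - x) / h| - kernelC K)
    rw [sub_add_sub_cancel] at this
    refine (this.trans (add_le_add h1 hw4)).trans ?_
    have p0 : G * a ^ 3 * N + M * (G * a ^ 3) ≤ (G * N + M * G) * a := by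
      have := mul_le_mul_of_nonneg_left hGa (add_nonneg hN0 hM0)
      linarith only [this]
    have p1 : 0 ≤ T * h := by positivity
    have p2 : 0 ≤ G * (a + h) := by positivity
    rw [hT] at p1 ⊢
    have e1 : N * (a + h) = M * (a + h) + G * (a + h) := by rw [hN]; ring
    rw [add_mul N, e1]
    linarith only [p0, p1, p2]

end Moments

/-! ### Expansion of the quadratic form. -/

/-- A quadratic form in weights with prescribed first moments, for a form coefficient that is
expanded to first order on the diagonal. -/
theorem abs_sum_sum_mul_sub_le {P : Finset ℝ} {q : ℝ → ℝ} {R : ℝ → ℝ → ℝ}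
    {ρ d α x κ C E u v : ℝ} (hC : ∑ t ∈ P, |q t| ≤ C)
    (hR : ∀ t ∈ P, ∀ s ∈ P, |R t s - (ρ + d * (t - x) + d * (s - x) - α / 2 * |t - s|)| ≤ E)
    (hE : 0 ≤ E) (h1 : |∑ t ∈ P, q t - 1| ≤ v) (h2 : |∑ t ∈ P, q t * (t - x)| ≤ u)
    (h3 : |∑ t ∈ P, ∑ s ∈ P, q t * q s * |t - s| - κ| ≤ u) :
    |∑ t ∈ P, ∑ s ∈ P, q t * q s * R t s - (ρ - κ / 2 * α)| ≤
      E * C ^ 2 + |ρ| * (v * (C + 1)) + 2 * |d| * (C * u) + |α| / 2 * u := by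
  set W := ∑ t ∈ P, q t with hW
  set U := ∑ t ∈ P, q t * (t - x) with hU
  set D := ∑ t ∈ P, ∑ s ∈ P, q t * q s * |t - s| with hD
  have hWC : |W| ≤ C := (Finset.abs_sum_le_sum_abs _ _).trans hC
  have hC0 : 0 ≤ C := (abs_nonneg _).trans hWC
  have hmain : ∑ t ∈ P, ∑ s ∈ P, q t * q s *
      (ρ + d * (t - x) + d * (s - x) - α / 2 * |t - s|) =
      ρ * (W * W) + 2 * d * (W * U) - α / 2 * D := by
    have e : ∀ t s : ℝ, q t * q s * (ρ + d * (t - x) + d * (s - x) - α / 2 * |t - s|) =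
        ρ * (q t * q s) + d * (q t * (t - x) * q s) + d * (q t * (q s * (s - x))) -
          α / 2 * (q t * q s * |t - s|) := by intros; ring
    simp only [e, Finset.sum_sub_distrib, Finset.sum_add_distrib, ← Finset.mul_sum,
      ← Finset.sum_mul]
    rw [← hW, ← hU, ← hD]
    ring
  have herr : |∑ t ∈ P, ∑ s ∈ P, q t * q s * R t s - ∑ t ∈ P, ∑ s ∈ P, q t * q s *
      (ρ + d * (t - x) + d * (s - x) - α / 2 * |t - s|)| ≤ E * C ^ 2 := by
    rw [← Finset.sum_sub_distrib]
    simp only [← Finset.sum_sub_distrib, ← mul_sub]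
    refine (Finset.abs_sum_le_sum_abs _ _).trans ?_
    refine (Finset.sum_le_sum fun t _ => Finset.abs_sum_le_sum_abs _ _).trans ?_
    calc _ ≤ ∑ t ∈ P, ∑ s ∈ P, |q t| * (|q s| * E) := by
          refine Finset.sum_le_sum fun t ht => Finset.sum_le_sum fun s hs => ?_
          rw [abs_mul, abs_mul, mul_assoc]
          have := hR t ht s hs
          gcongr
      _ = (∑ t ∈ P, |q t|) * (∑ s ∈ P, |q s|) * E := by
          simp only [← Finset.mul_sum, ← Finset.sum_mul]; ring
      _ ≤ C * C * E := by
          have : 0 ≤ ∑ t ∈ P, |q t| := Finset.sum_nonneg fun _ _ => abs_nonneg _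
          gcongr
      _ = E * C ^ 2 := by ring
  rw [hmain] at herr
  have hWW : |W * W - 1| ≤ v * (C + 1) := by
    rw [show W * W - 1 = (W - 1) * (W + 1) by ring, abs_mul]
    have : |W + 1| ≤ C + 1 := (abs_add_le _ _).trans (by rw [abs_one]; linarith)
    exact mul_le_mul h1 this (abs_nonneg _) ((abs_nonneg _).trans h1)
  have hWU : |W * U| ≤ C * u := by
    rw [abs_mul]; exact mul_le_mul hWC h2 (abs_nonneg _) hC0
  have g1 : |ρ * (W * W - 1)| ≤ |ρ| * (v * (C + 1)) := by rw [abs_mul]; gcongr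
  have g2 : |2 * d * (W * U)| ≤ 2 * |d| * (C * u) := by
    rw [abs_mul, abs_mul, abs_two]; gcongr
  have g3 : |α / 2 * (D - κ)| ≤ |α| / 2 * u := by
    rw [abs_mul, abs_div, abs_two]; gcongr
  set S := ∑ t ∈ P, ∑ s ∈ P, q t * q s * R t s
  rw [show S - (ρ - κ / 2 * α) = (S - (ρ * (W * W) + 2 * d * (W * U) - α / 2 * D)) +
    ρ * (W * W - 1) + 2 * d * (W * U) - α / 2 * (D - κ) by ring]
  refine (abs_sub _ _).trans (add_le_add ((abs_add_le _ _).trans (add_le_add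
    ((abs_add_le _ _).trans (add_le_add herr g1)) g2)) g3)

/-- Nonasymptotic expansion of the quadratic form of the trapezoidal weights. -/
theorem exists_trapWeight_form_bound {R : ℝ → ℝ → ℝ} {α f K : ℝ → ℝ}
    (hA : AssumptionA R) (hB : AssumptionB R α) (hC : AssumptionC R) (hD : AssumptionD K)
    (hsymm : ∀ t ∈ Icc (0 : ℝ) 1, ∀ s ∈ Icc (0 : ℝ) 1, R t s = R s t) {c₀ C₀ C₁ : ℝ}
    (hf : DensityBounds f c₀ C₀ C₁) {x : ℝ} (hx : x ∈ Ioo (0 : ℝ) 1) :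
    ∃ C η : ℝ, 0 ≤ C ∧ 0 < η ∧ ∀ (h : ℝ) (n : ℕ), 0 < h → h < η → 0 < n →
      1 / (n * h * f x) ≤ 1 →
      |∑ t ∈ windowPoints f n x h, ∑ s ∈ windowPoints f n x h,
        trapWeight K f n x h t * trapWeight K f n x h s * R t s -
          (R x x - h / 2 * kernelC K * α x)| ≤
        C * (h * (1 / (n * h * f x) + h) + (1 / (n * h * f x)) ^ 3) := by
  obtain ⟨K₂, L, hK⟩ := hD.exists_bounds
  have hxI := Ioo_subset_Icc_self hx
  have hfx := hf.pos_apply hxI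
  obtain ⟨M, hM0, hM⟩ := exists_trapWeight_moments hK hD.even hD.integral_eq_one hf hxI
  obtain ⟨d, A, hA0, hexp⟩ := exists_covariance_expansion hA hB hC hsymm hx
  have hr : 0 < min x (1 - x) := lt_min hx.1 (sub_pos.2 hx.2)
  have hB1 := hf.one_le_ratio
  have hB0 : 0 < C₀ / c₀ := by linarith
  -- The threshold gives `2 (C₀/c₀) h < min x (1 - x)`. As `C₀/c₀ ≥ 1`, this also yields `0 < x -
  -- 2h` and `x + 2h < 1`, as the covariance expansion demands.
  refine ⟨A * M ^ 2 + |R x x| * (M * (M + 1)) + 2 * |d| * (M * M) + |α x| / 2 * M,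
    min 1 (min x (1 - x) / (2 * (C₀ / c₀))), by positivity, by positivity, ?_⟩
  intro h n hh hη hn ha1
  have hh1 : h < 1 := hη.trans_le (min_le_left _ _)
  have hh2 : h * (2 * (C₀ / c₀)) < min x (1 - x) :=
    (lt_div_iff₀ (by positivity)).1 (hη.trans_le (min_le_right _ _))
  have hh3 : h ≤ C₀ / c₀ * h := le_mul_of_one_le_left hh.le hB1
  have hlo := hh2.trans_le (min_le_left _ _)
  have hhi := hh2.trans_le (min_le_right _ _)
  obtain ⟨m1, m2, m3, m4⟩ := hM h n hh hh1.le hn (by linarith) (by linarith) ha1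
  have hn' : (0 : ℝ) < n := by exact_mod_cast hn
  set a := 1 / (n * h * f x) with ha
  have ha0 : 0 < a := by positivity
  have := abs_sum_sum_mul_sub_le (R := R) (ρ := R x x) (d := d) (α := α x) (x := x)
    (κ := h * kernelC K) (E := A * h ^ 2) m2 (fun t ht s hs =>
      hexp h hh (by linarith) (by linarith) t s (hf.windowPoints_subset hn ht).2
        (hf.windowPoints_subset hn hs).2) (by positivity) m1 m3 m4
  rw [show h * kernelC K / 2 * α x = h / 2 * kernelC K * α x by ring] at this
  refine this.trans ?_
  have p1 : h ^ 2 ≤ h * (a + h) + a ^ 3 := by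
    have : 0 ≤ h * a + a ^ 3 := by positivity
    linarith
  have p2 : a * h + a ^ 3 ≤ h * (a + h) + a ^ 3 := by
    have : 0 ≤ h * h := by positivity
    linarith
  have p3 : h * (a + h) ≤ h * (a + h) + a ^ 3 := by
    have : 0 ≤ a ^ 3 := by positivity
    linarith
  calc _ = A * M ^ 2 * h ^ 2 + |R x x| * (M * (M + 1)) * (a * h + a ^ 3) +
        2 * |d| * (M * M) * (h * (a + h)) + |α x| / 2 * M * (h * (a + h)) := by ring
    _ ≤ A * M ^ 2 * (h * (a + h) + a ^ 3) + |R x x| * (M * (M + 1)) * (h * (a + h) + a ^ 3) +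
        2 * |d| * (M * M) * (h * (a + h) + a ^ 3) + |α x| / 2 * M * (h * (a + h) + a ^ 3) := by
      gcongr
    _ = _ := by ring

/-- An error bounded by a sum of two rates splits into a part for each rate. -/
theorem exists_split_of_bound {ι : Type*} {l : Filter ι} {e u v c : ι → ℝ}
    (h : ∀ᶠ p in l, 0 < u p ∧ 0 < v p ∧ |e p| ≤ c p * (u p + v p)) :
    ∃ r₁ r₂ : ι → ℝ, (∀ᶠ p in l, |r₁ p| ≤ c p * u p) ∧ (∀ᶠ p in l, |r₂ p| ≤ c p * v p) ∧
      ∀ᶠ p in l, e p = r₁ p + r₂ p := by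
  -- The error is divided between the two rates in proportion to their sizes.
  refine ⟨fun p => e p / (u p + v p) * u p, fun p => e p / (u p + v p) * v p, ?_, ?_, ?_⟩
  · filter_upwards [h] with p ⟨hu, hv, he⟩
    have huv : 0 < u p + v p := add_pos hu hv
    rw [abs_mul, abs_div, abs_of_pos huv, abs_of_pos hu]
    exact mul_le_mul_of_nonneg_right ((div_le_iff₀ huv).2 he) hu.le
  · filter_upwards [h] with p ⟨hu, hv, he⟩
    have huv : 0 < u p + v p := add_pos hu hv
    rw [abs_mul, abs_div, abs_of_pos huv, abs_of_pos hv]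
    exact mul_le_mul_of_nonneg_right ((div_le_iff₀ huv).2 he) hv.le
  · filter_upwards [h] with p ⟨hu, hv, he⟩
    have huv : 0 < u p + v p := add_pos hu hv
    field_simp

end TrapReg

end

/-! ### Passage to the limit. -/

theorem proposition2 {Ω : Type*} [MeasurableSpace Ω] (μ : Measure Ω) [IsProbabilityMeasure μ]
    (ε : ℕ → ℝ → Ω → ℝ) (R : ℝ → ℝ → ℝ) (α g f K : ℝ → ℝ)
    (hε : TrapReg.IsErrorSequence μ ε R)
    (hg : ContDiffOn ℝ 2 g (Icc (0 : ℝ) 1))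
    (hA : TrapReg.AssumptionA R) (hB : TrapReg.AssumptionB R α)
    (hC : TrapReg.AssumptionC R) (hD : TrapReg.AssumptionD K)
    (hf : TrapReg.IsDesignDensity f)
    (hf2 : ContDiffOn ℝ 2 f (Icc (0 : ℝ) 1))
    (hf2L : ∃ L, LipschitzOnWith L (iteratedDerivWithin 2 f (Icc (0 : ℝ) 1)) (Icc (0 : ℝ) 1))
    (hRL : TrapReg.SecondPartialLipschitz R)
    -- the pair `(n, m)` moves along an arbitrary filter along which `n → ∞`
    (l : Filter (ℕ × ℕ)) (h : ℕ → ℕ → ℝ)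
    (hn : Tendsto (fun p : ℕ × ℕ => p.1) l atTop)
    (hm : ∀ᶠ p in l, 1 ≤ p.2)
    (hh : Tendsto (fun p : ℕ × ℕ => h p.1 p.2) l (𝓝 0))
    (hnh : Tendsto (fun p : ℕ × ℕ => (p.1 : ℝ) * h p.1 p.2) l atTop)
    (x : ℝ) (hx : x ∈ Ioo (0 : ℝ) 1) :
    ∃ r₁ r₂ : ℕ × ℕ → ℝ,
      r₁ =o[l] (fun p => h p.1 p.2 / (p.2 : ℝ)) ∧
      r₂ =O[l] (fun p => 1 / ((p.2 : ℝ) * (p.1 : ℝ) ^ 2)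
        + 1 / ((p.2 : ℝ) * (p.1 : ℝ) ^ 3 * h p.1 p.2 ^ 3)) ∧
      ∀ᶠ p in l,
        Var[TrapReg.trapEstimator K f g ε p.1 p.2 (h p.1 p.2) x; μ] =
          1 / (p.2 : ℝ) * (R x x - h p.1 p.2 / 2 * TrapReg.kernelC K * α x)
          + TrapReg.kernelV K / (12 * (p.2 : ℝ) * (p.1 : ℝ) ^ 2 * h p.1 p.2) * (α x / f x ^ 2)
          + r₁ p + r₂ p := by
  have hxI := Ioo_subset_Icc_self hx
  have hsymm : ∀ t ∈ Icc (0 : ℝ) 1, ∀ s ∈ Icc (0 : ℝ) 1, R t s = R s t := by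
    intro t ht s hs
    rw [← hε.autocov 0 t ht s hs, ← hε.autocov 0 s hs t ht, covariance_comm]
  obtain ⟨c₀, C₀, C₁, hfb⟩ := hf.exists_bounds (hf2.of_le (by norm_num))
  have hfx := hfb.pos_apply hxI
  obtain ⟨C, η, hC0, hη, hbound⟩ :=
    TrapReg.exists_trapWeight_form_bound hA hB hC hD hsymm hfb hx
  set a : ℕ × ℕ → ℝ := fun p => 1 / (p.1 * h p.1 p.2 * f x) with ha
  have ha_tendsto : Tendsto a l (𝓝 0) := by
    have := (hnh.atTop_mul_const hfx).inv_tendsto_atTop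
    refine this.congr fun p => ?_
    simp only [ha, Pi.inv_apply, one_div]
  -- Positivity of the bandwidth is not assumed separately: it holds eventually because `n h → ∞`
  -- with `n > 0`.
  have hgood : ∀ᶠ p in l, 0 < p.1 ∧ 1 ≤ p.2 ∧ 0 < h p.1 p.2 ∧ h p.1 p.2 < η ∧ a p ≤ 1 := by
    filter_upwards [hn.eventually_gt_atTop 0, hm, hnh.eventually_gt_atTop 0,
      hh.eventually_lt_const hη, ha_tendsto.eventually_le_const one_pos] with p h1 h2 h3 h4 h5
    exact ⟨h1, h2, (mul_pos_iff_of_pos_left (Nat.cast_pos.2 h1)).1 h3, h4, h5⟩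
  set B := C + |TrapReg.kernelV K * α x| / 12 with hBdef
  have hB0 : 0 ≤ B := by positivity
  obtain ⟨r₁, r₂, hr₁, hr₂, hsum⟩ := TrapReg.exists_split_of_bound (l := l)
    (e := fun p => Var[TrapReg.trapEstimator K f g ε p.1 p.2 (h p.1 p.2) x; μ] -
      1 / (p.2 : ℝ) * (R x x - h p.1 p.2 / 2 * TrapReg.kernelC K * α x) -
      TrapReg.kernelV K / (12 * (p.2 : ℝ) * (p.1 : ℝ) ^ 2 * h p.1 p.2) * (α x / f x ^ 2))
    (u := fun p => h p.1 p.2 * (a p + h p.1 p.2)) (v := fun p => a p ^ 3)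
    (c := fun p => 1 / (p.2 : ℝ) * B) (by
      filter_upwards [hgood] with p ⟨hp1, hp2, hp3, hp4, hp5⟩
      have hp1' : (0 : ℝ) < p.1 := by exact_mod_cast hp1
      have hp2' : (0 : ℝ) < p.2 := by exact_mod_cast hp2
      have ha0 : 0 < a p := by simp only [ha]; positivity
      refine ⟨by positivity, by positivity, ?_⟩
      have hvar : Var[TrapReg.trapEstimator K f g ε p.1 p.2 (h p.1 p.2) x; μ] =
          1 / (p.2 : ℝ) * ∑ t ∈ TrapReg.windowPoints f p.1 x (h p.1 p.2),
            ∑ s ∈ TrapReg.windowPoints f p.1 x (h p.1 p.2),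
              TrapReg.trapWeight K f p.1 x (h p.1 p.2) t *
                TrapReg.trapWeight K f p.1 x (h p.1 p.2) s * R t s := by
        rw [← hε.variance_sum_mul_meanObservation g _ _
          (fun t ht => (hfb.windowPoints_subset hp1 ht).1) hp2]
        congr 1
        funext ω
        exact TrapReg.trapEstimator_eq_sum K f g ε p.1 p.2 (h p.1 p.2) x ω
      have hform := hbound _ p.1 hp3 hp4 hp1 hp5
      -- In terms of `a` the `V` term carries the factor `a² h ≤ a h`, so it fits into the same
      -- error bound as the remainder of the quadratic form.
      have hV : TrapReg.kernelV K / (12 * (p.2 : ℝ) * (p.1 : ℝ) ^ 2 * h p.1 p.2) *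
          (α x / f x ^ 2) = 1 / (p.2 : ℝ) * (TrapReg.kernelV K * α x / 12 *
            (a p ^ 2 * h p.1 p.2)) := by
        simp only [ha]; field_simp
      rw [hvar, hV, ← mul_sub, ← mul_sub, abs_mul, abs_of_pos (by positivity : 0 < 1 / (p.2 : ℝ)),
        mul_assoc (1 / (p.2 : ℝ)) B]
      refine mul_le_mul_of_nonneg_left ((abs_sub _ _).trans ?_) (by positivity)
      rw [hBdef, add_mul]
      refine add_le_add hform ?_
      rw [abs_mul, abs_div, abs_of_pos (by positivity : 0 < a p ^ 2 * h p.1 p.2),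
        abs_of_pos (by norm_num : (0 : ℝ) < 12)]
      refine mul_le_mul_of_nonneg_left ?_ (by positivity)
      have e1 : a p ^ 2 * h p.1 p.2 ≤ a p * h p.1 p.2 := by
        rw [pow_two, mul_assoc]
        exact mul_le_of_le_one_left (by positivity) hp5
      have e2 : 0 ≤ h p.1 p.2 * h p.1 p.2 + a p ^ 3 := by positivity
      linarith)
  refine ⟨r₁, r₂, ?_, ?_, ?_⟩
  · have hlim : Tendsto (fun p => B * (a p + h p.1 p.2)) l (𝓝 0) := by
      have := (ha_tendsto.add hh).const_mul B
      simpa using this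
    rw [isLittleO_iff]
    intro δ hδ
    filter_upwards [hgood, hr₁, hlim.eventually_le_const hδ] with p ⟨hp1, hp2, hp3, hp4, hp5⟩ h1 h2
    have hp2' : (0 : ℝ) < p.2 := by exact_mod_cast hp2
    rw [Real.norm_eq_abs, Real.norm_eq_abs, abs_of_pos (div_pos hp3 hp2')]
    calc _ ≤ 1 / (p.2 : ℝ) * B * (h p.1 p.2 * (a p + h p.1 p.2)) := h1
      _ = B * (a p + h p.1 p.2) * (h p.1 p.2 / p.2) := by ring
      _ ≤ _ := mul_le_mul_of_nonneg_right h2 (by positivity)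
  · refine IsBigO.of_bound (B / f x ^ 3) ?_
    filter_upwards [hgood, hr₂] with p ⟨hp1, hp2, hp3, hp4, hp5⟩ h1
    have hp1' : (0 : ℝ) < p.1 := by exact_mod_cast hp1
    have hp2' : (0 : ℝ) < p.2 := by exact_mod_cast hp2
    rw [Real.norm_eq_abs, Real.norm_eq_abs, abs_of_pos (by positivity : 0 <
      1 / ((p.2 : ℝ) * (p.1 : ℝ) ^ 2) + 1 / ((p.2 : ℝ) * (p.1 : ℝ) ^ 3 * h p.1 p.2 ^ 3))]
    calc _ ≤ 1 / (p.2 : ℝ) * B * a p ^ 3 := h1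
      _ = B / f x ^ 3 * (1 / ((p.2 : ℝ) * (p.1 : ℝ) ^ 3 * h p.1 p.2 ^ 3)) := by
        simp only [ha]; field_simp
      _ ≤ _ := by
        refine mul_le_mul_of_nonneg_left (le_add_of_nonneg_left ?_) (by positivity)
        positivity
  · filter_upwards [hsum] with p hp
    linarith
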